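/- Let $\kappa\in\{0,1,2,\dots\}$, let $R\ge 1$, and let $\chi_R:\mathbb R\to\mathbb R$ be a $C^\infty$ function with $\chi_R=1$ on $[-R,R]$ and $\chi_R=0$ outside $(-\tfrac32R,\tfrac32R)$. Notation. Put $\mathfrak f_z(x)=\frac1{x-z}$ and $\mathcal F f(s)=\int_{\mathbb R} f(x)e^{-ixs}\,dx$. For $b_{max}>0$ let $\Pi_{b_{max}}=\{a+ib: 0<|b|<b_{max}\}$. For $p\in\{1,\infty\}$ let $L^p(\Pi_{b_{max}})$ be the space of measurable $h:\Pi_{b_{max}}\to\mathbb C$ with $h(\bar z)=\overline{h(z)}$ and finite norm, where $\|h\|_{L^1}=\int_{\Pi_{b_{max}}}|h|\,da\,db$ and $\|h\|_{L^\infty}=\sup_{\Pi_{b_{max}}}|h|$. For $k\in\{0,1,2,\dots\}$ let $\mathcal K^{k}_{b_{max}}f=\mathcal F^{-1}\big(K^{k}_{b_{max}}\big)\ast f=\mathcal F^{-1}\big(K^{k}_{b_{max}}\,\mathcal F f\big)$, where $$K^{k}_{b_{max}}(s)=\Big(2\int_0^{b_{max}} b^{1+k}\,\mathcal F(\operatorname{Im}\mathfrak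 f_{ib})(s)\,db\Big)^{-1}.$$ For $V:\mathbb R\to\mathbb R$ write the second-order Taylor expansion of $V'$ around $a_T$ as $$V'(x)=V'(a_T)+V''(a_T)(x-a_T)+\tfrac12V'''(a_T)(x-a_T)^2+(x-a_T)^3W_{a_T}(x-a_T).$$ For $\kappa'\in\{\kappa,\kappa+1\}$ and $z_T=a_T+ib_T$ let $$g^{\kappa';\kappa,(3)}_{pot}(a,b;a_T,b_T)=\mathbf 1_{|b|<b_{max}}\frac{(-ib_T)|b_T|^\kappa}{(1+\kappa)!}\,\mathcal K^{\kappa'}_{b_{max}}\Big(x\mapsto\chi_R(x)(x-a_T)^3W_{a_T}(x-a_T)\,\mathfrak f_{z_T}'(x)\Big)(a),$$ $$\mathcal H^{\kappa';\kappa,(3)}_{pot}(h)(a,b)=\int_{-3R}^{3R}da_T\int_{-b_{max}}^{b_{max}}db_T\;g^{\kappa';\kappa,(3)}_{pot}(a,b;a_T,b_T)\,h(a_T,b_T),$$ and $\mathcal H^{\kappa,(3)}_{pot}:=\mathcal H^{\kappa;\kappa,(3)}_{pot}$. Finally let $\|f\|_{k,[-r,r]}=\sup_{0\le j\le k}\sup_{[-r,r]}|f^{(j)}|$.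 Lemma. There is a constant $C$, depending only on $\kappa$, $R$ and $\chi_R$, such that for all $b_{max}\in(0,\tfrac12]$, all $V:\mathbb R\to\mathbb R$ and both $p=1$ and $p=\infty$: (i) if $V\in C^{9+\kappa}(\mathbb R)$, then $\mathcal H^{\kappa+1;\kappa,(3)}_{pot}$ is a well-defined bounded operator from $L^p(\Pi_{b_{max}})$ to itself, with $$|||\mathcal H^{\kappa+1;\kappa,(3)}_{pot}|||_{L^p(\Pi_{b_{max}})\to L^p(\Pi_{b_{max}})}\le C\,b_{max}^{-1}\,\|V'\|_{8+\kappa,[-3R,3R]};$$ (ii) if $V\in C^{8+\kappa}(\mathbb R)$, then $\mathcal H^{\kappa,(3)}_{pot}$ is a well-defined bounded operator from $L^p(\Pi_{b_{max}})$ to itself, with $$|||\mathcal H^{\kappa,(3)}_{pot}|||_{L^p(\Pi_{b_{max}})\to L^p(\Pi_{b_{max}})}\le C\,\|V'\|_{7+\kappa,[-3R,3R]}.$$ Here well-defined means that the Fourier integrals defining $g^{\kappa';\kappa,(3)}_{pot}$ converge absolutely for $a_T\in[-3R,3R]$, $0<|b_T|<b_{max}$, and that the integral defining $\mathcal H^{\kappa';\kappa,(3)}_{pot}(h)(a,b)$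 converges absolutely for every $(a,b)$ with $a+ib\in\Pi_{b_{max}}$ if $p=\infty$, and for almost every such $(a,b)$ if $p=1$. -/

import Mathlib

open MeasureTheory Set
open scoped NNReal ENNReal ComplexConjugate

noncomputable section

namespace StieltjesPot

/-- The Stieltjes kernel `𝔣_z(x) = 1 / (x - z)`. -/
def stieltjesKernel (z : ℂ) (x : ℝ) : ℂ := 1 / ((x : ℂ) - z)

/-- Fourier transform, normalized as `(𝓕 f)(s) = ∫ f(x) e^{-ixs} dx`. -/
def fourierT (f : ℝ → ℂ) (s : ℝ) : ℂ :=
  ∫ x : ℝ, f x * Complex.exp (-(Complex.I * (x : ℂ) * (s : ℂ)))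

/-- Inverse Fourier transform, `(𝓕⁻¹ g)(x) = (2π)⁻¹ ∫ g(s) e^{ixs} ds`. -/
def fourierTInv (g : ℝ → ℂ) (x : ℝ) : ℂ :=
  (1 / (2 * (Real.pi : ℂ))) * ∫ s : ℝ, g s * Complex.exp (Complex.I * (x : ℂ) * (s : ℂ))

/-- The symbol `K^κ_{bmax}(s) = (2 ∫_0^{bmax} b^{1+κ} 𝓕(Im 𝔣_{ib})(s) db)⁻¹`. -/
def symbolK (κ : ℕ) (bmax : ℝ) (s : ℝ) : ℂ :=
  (2 * ∫ b in (0 : ℝ)..bmax, (b : ℂ) ^ (1 + κ) *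
    fourierT (fun x : ℝ => ((stieltjesKernel (Complex.I * (b : ℂ)) x).im : ℂ)) s)⁻¹

/-- The convolution operator `𝒦^κ_{bmax} f = 𝓕⁻¹(K^κ_{bmax}) * f`. Since `K^κ_{bmax}` grows
polynomially, `𝓕⁻¹(K^κ_{bmax})` is a tempered distribution, and the convolution is computed
as the Fourier multiplier `𝓕⁻¹(K^κ_{bmax} · 𝓕 f)`. -/
def opK (κ : ℕ) (bmax : ℝ) (f : ℝ → ℂ) (x : ℝ) : ℂ :=
  fourierTInv (fun s => symbolK κ bmax s * fourierT f s) x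

/-- A smooth cut-off `χ_R`: equal to `1` on `[-R, R]`, and to `0` off the ball `B(0, 3R/2)`. -/
structure IsCutoff (R : ℝ) (χ : ℝ → ℝ) : Prop where
  smooth : ContDiff ℝ ((⊤ : ℕ∞) : WithTop ℕ∞) χ
  eq_one : ∀ x ∈ Icc (-R) R, χ x = 1
  eq_zero : ∀ x ∉ Metric.ball (0 : ℝ) (3 / 2 * R), χ x = 0

/-- The Taylor remainder of `V'` after the second-order expansion around `a`,
`(x - a)³ W_a(x - a) = V'(x) - V'(a) - V''(a) (x - a) - V'''(a) (x - a)² / 2`. -/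
def taylorRem (V : ℝ → ℝ) (a x : ℝ) : ℝ :=
  deriv V x - deriv V a - iteratedDeriv 2 V a * (x - a) - iteratedDeriv 3 V a * (x - a) ^ 2 / 2

/-- The function `x ↦ χ_R(x) (x - a_T)³ W_{a_T}(x - a_T) 𝔣'_{z_T}(x)`, where
`z_T = a_T + i b_T` and `w = (a_T, b_T)`. -/
def remFun (χ V : ℝ → ℝ) (w : ℝ × ℝ) (x : ℝ) : ℂ :=
  (χ x : ℂ) * (taylorRem V w.1 x : ℂ) *
    deriv (stieltjesKernel ((w.1 : ℂ) + Complex.I * (w.2 : ℂ))) x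

open Classical in
/-- The kernel `g_pot^{κ';κ,(3)}(a, b; a_T, b_T)`, with `z = (a, b)` and `w = (a_T, b_T)`. -/
def potKernel (χ V : ℝ → ℝ) (κ' κ : ℕ) (bmax : ℝ) (z w : ℝ × ℝ) : ℂ :=
  if |z.2| < bmax then
    (-Complex.I * (w.2 : ℂ)) * ((|w.2| : ℝ) : ℂ) ^ κ / (Nat.factorial (1 + κ) : ℂ) *
      opK κ' bmax (remFun χ V w) z.1
  else 0

/-- The domain of integration `[-3R, 3R] × (-bmax, bmax)` in the variables `(a_T, b_T)`. -/
def box (R bmax : ℝ) : Set (ℝ × ℝ) := Icc (-(3 * R)) (3 * R) ×ˢ Ioo (-bmax) bmax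

/-- The operator `𝓗_pot^{κ';κ,(3)}`. The operator `𝓗_pot^{κ,(3)}` is the case `κ' = κ`. -/
def potOp (χ V : ℝ → ℝ) (R : ℝ) (κ' κ : ℕ) (bmax : ℝ) (h : ℝ × ℝ → ℂ) (z : ℝ × ℝ) : ℂ :=
  ∫ w in box R bmax, potKernel χ V κ' κ bmax z w * h w

/-- The double strip `Π_{bmax} = {a + ib | 0 < |b| < bmax}`, in the coordinates `(a, b)`. -/
def strip (bmax : ℝ) : Set (ℝ × ℝ) := {z | 0 < |z.2| ∧ |z.2| < bmax}

open Classical in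
/-- The norm of `L^p(Π_{bmax})`, with values in `[0, ∞]`; for `p = ∞` it is the supremum. -/
def stripNorm (bmax : ℝ) (p : ℝ≥0∞) (h : ℝ × ℝ → ℂ) : ℝ≥0∞ :=
  if p = ∞ then ⨆ z ∈ strip bmax, ‖h z‖ₑ
  else (∫⁻ z in strip bmax, ‖h z‖ₑ ^ p.toReal) ^ (1 / p.toReal)

/-- Membership in `L^p(Π_{bmax})`: measurable functions with `h(z̄) = conj (h(z))` and
finite norm. -/
structure MemStrip (bmax : ℝ) (p : ℝ≥0∞) (h : ℝ × ℝ → ℂ) : Prop where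
  aemeasurable : AEMeasurable h (volume.restrict (strip bmax))
  symm : ∀ z ∈ strip bmax, h (z.1, -z.2) = conj (h z)
  norm_lt_top : stripNorm bmax p h < ∞

/-- The operator norm `|||T|||` for `T` acting on `L^p(Π_{bmax})`, with values in `[0, ∞]`. -/
def stripOpNorm (bmax : ℝ) (p : ℝ≥0∞) (T : (ℝ × ℝ → ℂ) → (ℝ × ℝ → ℂ)) : ℝ≥0∞ :=
  sInf {c : ℝ≥0∞ | ∀ h, MemStrip bmax p h → stripNorm bmax p (T h) ≤ c * stripNorm bmax p h}

/-- The norm `‖f‖_{k,[-r,r]} = sup_{0 ≤ j ≤ k} sup_{[-r,r]} |f^{(j)}|`. -/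
def ckNorm (k : ℕ) (r : ℝ) (f : ℝ → ℝ) : ℝ≥0∞ :=
  ⨆ j ∈ Iic k, ⨆ x ∈ Icc (-r) r, ‖iteratedDeriv j f x‖ₑ

/-- The kernel is given by convergent integrals: `K^{κ'}_{bmax} · 𝓕 F` is integrable for the
functions `F` to which `𝒦^{κ'}_{bmax}` is applied. -/
def KernelDefined (χ V : ℝ → ℝ) (R : ℝ) (κ' : ℕ) (bmax : ℝ) : Prop :=
  ∀ w ∈ box R bmax, w.2 ≠ 0 →
    Integrable (remFun χ V w) ∧
    Integrable (fun s => symbolK κ' bmax s * fourierT (remFun χ V w) s)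

/-- `𝓗_pot^{κ';κ,(3)}` is well defined as an operator from `L^p(Π_{bmax})` to itself: the
integral defining it converges absolutely (at every point of the strip for `p = ∞`, at almost
every point otherwise), and its value lies in `L^p(Π_{bmax})`. -/
def ActsOn (χ V : ℝ → ℝ) (R : ℝ) (κ' κ : ℕ) (bmax : ℝ) (p : ℝ≥0∞) : Prop :=
  ∀ h, MemStrip bmax p h →
    (∀ᵐ z ∂(volume.restrict (strip bmax)),
      IntegrableOn (fun w => potKernel χ V κ' κ bmax z w * h w) (box R bmax)) ∧
    (p = ∞ → ∀ z ∈ strip bmax,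
      IntegrableOn (fun w => potKernel χ V κ' κ bmax z w * h w) (box R bmax)) ∧
    MemStrip bmax p (potOp χ V R κ' κ bmax h)

end StieltjesPot

end

open StieltjesPot

open StieltjesPot

noncomputable section

namespace StieltjesPot

open Filter Topology
open scoped FourierTransform

/-! Write `B` for `bmax` and `k` for `κ'`. The kernel `g_pot` is dominated pointwise by a constant
times a sum of two Poisson-type profiles in `x - a_T`, at scales `1` and `|b_T|`; the Schur test
then gives `L^1` and `L^∞` together.

The symbol is explicit: the transform of the Poisson kernel is `π e^{-b|s|}`, so `K^k` is the
reciprocal of a truncated Laplace moment. It is an even function with a kink at `0`, of size `(B⁻¹ +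
|s|)^(k+2)`, and each derivative away from `0` gains one power (`exists_symbolHalf_le`). Integrating
by parts twice on each half-line bounds `(𝒦 f)(y)` and `y² (𝒦 f)(y)` by weighted `L¹` norms of `𝓕 f`
and its first two derivatives, plus a term in `𝓕 f(0)` caused by the kink (`exists_opK_bound`).

For `b > 0`, put `x = a + y` and divide `y³` by `(y - ib)²`. The function becomes a polynomial of
degree one times `Φ = χ W`, plus `Φ` times `3b²/(y - ib) + ib³/(y - ib)²` (`remFun_add_eq`). The
first part is smooth at unit scale (`exists_opK_smooth_bound`). The singular factors are Laplace
transforms of densities living on `t ≲ 1/b`, so the transform of the second part is an average of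
translates of `𝓕 Φ`, and the factor `b²` pays for the singularity (`exists_opK_singular_bound`).
Both parts give `|b|^k |𝒦 f| ≤ C N B⁻² · schurKernel` (`exists_remFun_bound`), with `N` the norm of
`V'`; negative `b` follows by conjugation.

`schurKernel` has integral `2π` in either horizontal variable, and the strip has height `2B`. The
prefactor `|b_T|^(κ+1)` leaves `B^(κ+1-k)` after `|b_T|^k` is spent, so the operator norm is at most
a constant times `B^(κ+1-k) · B⁻² · B · N`, that is `B⁻¹ N` for `k = κ + 1` and `N` for `k = κ`.

Regularity count: the weight `k + 2` needs decay of order `k + 4` for integrability, hence `k + 4`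
derivatives of `W`, hence `k + 7` derivatives of `V'`. -/

/-! ### The Fourier transform of the Poisson kernel. -/

theorem integrable_exp_neg_mul_abs {c : ℝ} (hc : 0 < c) :
    Integrable (fun t : ℝ => Complex.exp (-(c : ℂ) * ((|t| : ℝ) : ℂ))) := by
  rw [← integrableOn_univ, ← Iic_union_Ioi (a := (0 : ℝ))]
  refine IntegrableOn.union ?_ ?_
  · refine (integrableOn_exp_mul_complex_Iic (a := (c : ℂ)) (by simpa using hc) 0).congr_fun
      (fun t ht => ?_) measurableSet_Iic
    simp only [abs_of_nonpos (mem_Iic.1 ht)]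
    simp
  · refine (integrableOn_exp_mul_complex_Ioi (a := -(c : ℂ)) (by simpa using hc) 0).congr_fun
      (fun t ht => ?_) measurableSet_Ioi
    simp only [abs_of_pos (mem_Ioi.1 ht)]

theorem fourier_exp_neg_mul_abs {c : ℝ} (hc : 0 < c) (ξ : ℝ) :
    𝓕 (fun t : ℝ => Complex.exp (-(c : ℂ) * ((|t| : ℝ) : ℂ))) ξ =
      ((2 * c / (c ^ 2 + (2 * Real.pi * ξ) ^ 2) : ℝ) : ℂ) := by
  rw [Real.fourier_eq']
  have hint : Integrable (fun v : ℝ => Complex.exp (↑(-2 * Real.pi * inner ℝ v ξ) * Complex.I) •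
      Complex.exp (-(c : ℂ) * ((|v| : ℝ) : ℂ))) := by
    refine (integrable_exp_neg_mul_abs hc).bdd_mul (c := 1) (by fun_prop) ?_
    filter_upwards with v
    rw [Complex.norm_exp_ofReal_mul_I]
  rw [← integral_add_compl measurableSet_Iic hint (s := Iic (0:ℝ)), compl_Iic]
  have h1 : ∫ v in Iic (0:ℝ), Complex.exp (↑(-2 * Real.pi * inner ℝ v ξ) * Complex.I) •
      Complex.exp (-(c : ℂ) * ((|v| : ℝ) : ℂ)) =
      ∫ v in Iic (0:ℝ), Complex.exp (((c : ℂ) - 2 * Real.pi * ξ * Complex.I) * v) := by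
    refine setIntegral_congr_fun measurableSet_Iic fun v hv => ?_
    simp only [smul_eq_mul, ← Complex.exp_add, abs_of_nonpos (mem_Iic.1 hv)]
    congr 1
    simp
    ring
  have h2 : ∫ v in Ioi (0:ℝ), Complex.exp (↑(-2 * Real.pi * inner ℝ v ξ) * Complex.I) •
      Complex.exp (-(c : ℂ) * ((|v| : ℝ) : ℂ)) =
      ∫ v in Ioi (0:ℝ), Complex.exp ((-(c : ℂ) - 2 * Real.pi * ξ * Complex.I) * v) := by
    refine setIntegral_congr_fun measurableSet_Ioi fun v hv => ?_
    simp only [smul_eq_mul, ← Complex.exp_add, abs_of_pos (mem_Ioi.1 hv)]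
    congr 1
    simp
    ring
  rw [h1, h2, integral_exp_mul_complex_Iic (by simpa using hc),
    integral_exp_mul_complex_Ioi (by simpa using hc)]
  have e1 : ((c : ℂ) - 2 * Real.pi * ξ * Complex.I) ≠ 0 := by
    intro h
    have := congrArg Complex.re h
    simp at this
    exact hc.ne' this
  have e2 : (-(c : ℂ) - 2 * Real.pi * ξ * Complex.I) ≠ 0 := by
    intro h
    have := congrArg Complex.re h
    simp at this
    exact hc.ne' this
  have e3 : ((c : ℂ) ^ 2 + (2 * Real.pi * ξ) ^ 2) ≠ 0 := by
    have : (0:ℝ) < c ^ 2 + (2 * Real.pi * ξ) ^ 2 := by positivity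
    exact_mod_cast this.ne'
  push_cast
  simp only [mul_zero, Complex.exp_zero]
  rw [div_add_div _ _ e1 e2, div_eq_div_iff (mul_ne_zero e1 e2) e3]
  ring_nf
  simp only [Complex.I_sq]
  ring

theorem integrable_div_sq_add_sq {c : ℝ} (hc : 0 < c) :
    Integrable (fun x : ℝ => c / (x ^ 2 + c ^ 2)) := by
  have h := (integrable_inv_one_add_sq.comp_div hc.ne').const_mul c⁻¹
  refine h.congr (ae_of_all _ fun x => ?_)
  simp only
  field_simp
  ring

theorem stieltjesKernel_I_mul_im (β x : ℝ) :
    (stieltjesKernel (Complex.I * (β : ℂ)) x).im = β / (x ^ 2 + β ^ 2) := by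
  simp [stieltjesKernel, Complex.normSq]
  ring

theorem fourierT_eq_fourier (f : ℝ → ℂ) (s : ℝ) :
    fourierT f s = 𝓕 f (s / (2 * Real.pi)) := by
  rw [Real.fourier_eq', fourierT]
  refine integral_congr_ae (ae_of_all _ fun x => ?_)
  simp only [smul_eq_mul]
  rw [mul_comm]
  congr 2
  have : (Real.pi : ℂ) ≠ 0 := by exact_mod_cast Real.pi_ne_zero
  simp
  field_simp

/-- Fourier inversion applied to `e^{-β|t|}`, whose transform is the Poisson kernel up to scaling.
Evaluating at `-s` matches the sign of the exponent, and evenness removes the sign again; the rest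
is the substitution by `2π`. -/
theorem fourierT_im_stieltjesKernel {β : ℝ} (hβ : 0 < β) (s : ℝ) :
    fourierT (fun x : ℝ => ((stieltjesKernel (Complex.I * (β : ℂ)) x).im : ℂ)) s =
      ((Real.pi * Real.exp (-β * |s|) : ℝ) : ℂ) := by
  have hcont : Continuous (fun t : ℝ => Complex.exp (-(β : ℂ) * ((|t| : ℝ) : ℂ))) := by fun_prop
  have hF : 𝓕 (fun t : ℝ => Complex.exp (-(β : ℂ) * ((|t| : ℝ) : ℂ))) =
      fun ξ : ℝ => ((2 * β / (β ^ 2 + (2 * Real.pi * ξ) ^ 2) : ℝ) : ℂ) :=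
    funext fun ξ => fourier_exp_neg_mul_abs hβ ξ
  have hFint : Integrable (𝓕 (fun t : ℝ => Complex.exp (-(β : ℂ) * ((|t| : ℝ) : ℂ)))) := by
    rw [hF]
    have h := ((integrable_div_sq_add_sq hβ).comp_mul_left'
      (show (2 * Real.pi) ≠ 0 by positivity)).const_mul 2
    refine h.ofReal.congr (ae_of_all _ fun x => ?_)
    simp only
    norm_cast
    rw [add_comm, mul_div_assoc]
    rfl
  have hinv := hcont.fourierInv_fourier_eq (integrable_exp_neg_mul_abs hβ) hFint
  have hs := congrFun hinv (-s)
  rw [Real.fourierInv_eq', hF] at hs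
  rw [abs_neg] at hs
  have hr : ((Real.pi * Real.exp (-β * |s|) : ℝ) : ℂ) =
      Real.pi * Complex.exp (-(β : ℂ) * ((|s| : ℝ) : ℂ)) := by push_cast; rfl
  rw [hr, ← hs, fourierT]
  simp only [stieltjesKernel_I_mul_im]
  have hsub := Measure.integral_comp_mul_left (fun x : ℝ => ((β / (x ^ 2 + β ^ 2) : ℝ) : ℂ) *
    Complex.exp (-(Complex.I * x * s))) (2 * Real.pi)
  have hpi : (Real.pi : ℂ) ≠ 0 := by exact_mod_cast Real.pi_ne_zero
  have habs : |(2 * Real.pi)⁻¹| = (2 * Real.pi)⁻¹ := abs_of_pos (by positivity)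
  rw [habs] at hsub
  have : (∫ x : ℝ, ((β / (x ^ 2 + β ^ 2) : ℝ) : ℂ) * Complex.exp (-(Complex.I * x * s))) =
      (2 * Real.pi : ℝ) • ((2 * Real.pi)⁻¹ • (∫ x : ℝ, ((β / (x ^ 2 + β ^ 2) : ℝ) : ℂ) *
    Complex.exp (-(Complex.I * x * s)))) := by
    rw [smul_smul, mul_inv_cancel₀ (by positivity), one_smul]
  rw [this, ← hsub, ← integral_smul, ← integral_const_mul]
  refine integral_congr_ae (ae_of_all _ fun x => ?_)
  simp only [smul_eq_mul, Complex.real_smul]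
  have he : Complex.exp (-(Complex.I * ((2 * Real.pi * x : ℝ) : ℂ) * s)) =
      Complex.exp (((2 * Real.pi * inner ℝ x (-s) : ℝ) : ℂ) * Complex.I) := by
    congr 1
    simp
    ring
  rw [he]
  push_cast
  rw [add_comm ((β : ℂ) ^ 2)]
  ring

/-! ### Size of the symbol and of its derivatives. -/

/-- The Laplace moments `∫_0^B β^j e^{-β s} dβ`. -/
def laplaceMoment (j : ℕ) (B s : ℝ) : ℝ := ∫ β in (0 : ℝ)..B, β ^ j * Real.exp (-β * s)

theorem symbolK_eq {B : ℝ} (hB : 0 < B) (k : ℕ) (s : ℝ) :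
    symbolK k B s = (((2 * Real.pi * laplaceMoment (k + 1) B |s|)⁻¹ : ℝ) : ℂ) := by
  rw [symbolK, laplaceMoment, Complex.ofReal_inv]
  congr 1
  have : ∫ b in (0 : ℝ)..B, (b : ℂ) ^ (1 + k) *
      fourierT (fun x : ℝ => ((stieltjesKernel (Complex.I * (b : ℂ)) x).im : ℂ)) s =
      ∫ b in (0 : ℝ)..B, ((Real.pi * (b ^ (k + 1) * Real.exp (-b * |s|)) : ℝ) : ℂ) := by
    refine intervalIntegral.integral_congr_ae (ae_of_all _ fun b hb => ?_)
    rw [uIoc_of_le hB.le] at hb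
    rw [fourierT_im_stieltjesKernel hb.1]
    push_cast
    ring
  rw [this, intervalIntegral.integral_ofReal, intervalIntegral.integral_const_mul]
  push_cast
  ring

theorem hasDerivAt_laplaceMoment (j : ℕ) (B s : ℝ) :
    HasDerivAt (laplaceMoment j B) (-laplaceMoment (j + 1) B s) s := by
  have h := intervalIntegral.hasDerivAt_integral_of_dominated_loc_of_deriv_le
    (μ := volume) (a := 0) (b := B) (F := fun s β : ℝ => β ^ j * Real.exp (-β * s))
    (F' := fun s β : ℝ => -(β ^ (j + 1) * Real.exp (-β * s))) (x₀ := s)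
    (s := Metric.ball s 1)
    (bound := fun β => |β| ^ (j + 1) * Real.exp (|β| * (|s| + 1)))
    (Metric.ball_mem_nhds s one_pos)
    (Eventually.of_forall fun x => (by fun_prop : Continuous _).aestronglyMeasurable)
    ((by fun_prop : Continuous _).intervalIntegrable _ _)
    ((by fun_prop : Continuous _).aestronglyMeasurable)
    (ae_of_all _ fun β _ x hx => ?_)
    ((by fun_prop : Continuous _).intervalIntegrable _ _)
    (ae_of_all _ fun β _ x _ => ?_)
  · have h2 := h.2
    rw [intervalIntegral.integral_neg] at h2
    exact h2
  · rw [norm_neg, norm_mul, norm_pow, Real.norm_eq_abs, Real.norm_eq_abs, Real.abs_exp]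
    refine mul_le_mul_of_nonneg_left (Real.exp_le_exp.2 ?_) (by positivity)
    have hx' : |x| ≤ |s| + 1 := by
      have := abs_sub_abs_le_abs_sub x s
      have h3 : |x - s| < 1 := by simpa [Real.dist_eq] using hx
      linarith
    calc -β * x ≤ |-β * x| := le_abs_self _
      _ = |β| * |x| := by rw [abs_mul, abs_neg]
      _ ≤ _ := by gcongr
  · have h1 : HasDerivAt (fun x : ℝ => -β * x) (-β) x := by
      simpa using (hasDerivAt_id x).const_mul (-β)
    have := (h1.exp).const_mul (β ^ j)
    convert! this using 1
    ring

theorem continuous_laplaceMoment (j : ℕ) (B : ℝ) : Continuous (laplaceMoment j B) :=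
  continuous_iff_continuousAt.2 fun s => (hasDerivAt_laplaceMoment j B s).continuousAt

theorem integrableOn_pow_mul_exp_neg_mul (j : ℕ) {r : ℝ} (hr : 0 < r) :
    IntegrableOn (fun β : ℝ => β ^ j * Real.exp (-β * r)) (Ioi 0) := by
  have h := Real.GammaIntegral_convergent (s := j + 1) (by positivity)
  have h2 := (integrableOn_Ioi_comp_mul_left_iff (fun x : ℝ => Real.exp (-x) * x ^ ((j : ℝ) + 1 - 1))
    0 hr).2 (by simpa using h)
  have h3 := h2.const_mul ((r ^ j)⁻¹)
  refine h3.congr ?_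
  filter_upwards with x
  simp only [add_sub_cancel_right, Real.rpow_natCast]
  rw [mul_pow]
  field_simp

theorem integral_pow_mul_exp_neg_mul (j : ℕ) {r : ℝ} (hr : 0 < r) :
    ∫ β in Ioi (0 : ℝ), β ^ j * Real.exp (-β * r) = j.factorial * r⁻¹ ^ (j + 1) := by
  have h := Real.integral_rpow_mul_exp_neg_mul_Ioi (a := j + 1) (by positivity) hr
  simp only [add_sub_cancel_right, Real.rpow_natCast, Real.Gamma_nat_eq_factorial] at h
  rw [show ((j : ℝ) + 1) = ((j + 1 : ℕ) : ℝ) by push_cast; ring, Real.rpow_natCast] at h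
  rw [mul_comm, ← one_div, ← h]
  refine integral_congr_ae (ae_of_all _ fun x => ?_)
  simp only
  ring_nf

/-- Since `β/B ≤ 1` on the range of integration, `e^{-βs} ≤ e · e^{-β(B⁻¹ + s)}`; the integral then
extends to the whole half-line, where it is a Gamma integral. -/
theorem laplaceMoment_le (j : ℕ) {B s : ℝ} (hB : 0 < B) (hs : 0 ≤ s) :
    laplaceMoment j B s ≤ Real.exp 1 * j.factorial * (B⁻¹ + s)⁻¹ ^ (j + 1) := by
  have hr : 0 < B⁻¹ + s := by positivity
  rw [mul_assoc, ← integral_pow_mul_exp_neg_mul j hr, ← integral_const_mul, laplaceMoment,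
    intervalIntegral.integral_of_le hB.le]
  refine (setIntegral_mono_on ?_ (IntegrableOn.mono_set (t := Ioi 0)
    ((integrableOn_pow_mul_exp_neg_mul j hr).const_mul _) Ioc_subset_Ioi_self) measurableSet_Ioc fun β hβ => ?_).trans
    (setIntegral_mono_set ((integrableOn_pow_mul_exp_neg_mul j hr).const_mul _) ?_
      Ioc_subset_Ioi_self.eventuallyLE)
  · exact ((by fun_prop : Continuous fun β : ℝ => β ^ j * Real.exp (-β * s)).integrableOn_Ioc)
  · have h1 : Real.exp 1 * (β ^ j * Real.exp (-β * (B⁻¹ + s))) =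
        β ^ j * Real.exp (1 + -β * (B⁻¹ + s)) := by rw [Real.exp_add]; ring
    rw [h1]
    have h0 := hβ.1.le
    gcongr
    have : β * B⁻¹ ≤ 1 := by
      rw [← div_eq_mul_inv, div_le_one hB]; exact hβ.2
    linarith
  · filter_upwards [self_mem_ae_restrict measurableSet_Ioi] with β hβ
    have : (0:ℝ) < β := hβ
    simp only [Pi.zero_apply]
    positivity

/-- Only `β ≤ (B⁻¹ + s)⁻¹` is kept. This lies within `[0, B]`, and there `βs ≤ 1`, so the
exponential is at least `e⁻¹`. -/
theorem le_laplaceMoment (j : ℕ) {B s : ℝ} (hB : 0 < B) (hs : 0 ≤ s) :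
    Real.exp (-1) / (j + 1) * (B⁻¹ + s)⁻¹ ^ (j + 1) ≤ laplaceMoment j B s := by
  have hr : 0 < B⁻¹ + s := by positivity
  set δ := (B⁻¹ + s)⁻¹ with hδ
  have hδ0 : 0 < δ := by positivity
  have hδB : δ ≤ B := by
    rw [hδ, inv_le_comm₀ hr hB]; linarith
  have h1 : ∫ β in (0 : ℝ)..δ, β ^ j * Real.exp (-1) ≤ laplaceMoment j B s := by
    rw [laplaceMoment, intervalIntegral.integral_of_le hB.le,
      intervalIntegral.integral_of_le hδ0.le]
    refine (setIntegral_mono_on ?_ ?_ measurableSet_Ioc fun β hβ => ?_).trans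
      (setIntegral_mono_set ?_ ?_ (Ioc_subset_Ioc_right hδB).eventuallyLE)
    · exact ((by fun_prop : Continuous fun β : ℝ => β ^ j * Real.exp (-1)).integrableOn_Ioc)
    · exact ((by fun_prop : Continuous fun β : ℝ => β ^ j * Real.exp (-β * s)).integrableOn_Ioc)
    · have h0 := hβ.1.le
      gcongr
      have : β * s ≤ δ * (B⁻¹ + s) := by
        gcongr
        · exact hβ.2
        · have : 0 < B⁻¹ := by positivity
          linarith
      rw [hδ, inv_mul_cancel₀ hr.ne'] at this
      linarith
    · exact ((by fun_prop : Continuous fun β : ℝ => β ^ j * Real.exp (-β * s)).integrableOn_Ioc)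
    · filter_upwards [self_mem_ae_restrict measurableSet_Ioc] with β hβ
      have : (0:ℝ) < β := hβ.1
      simp only [Pi.zero_apply]
      positivity
  refine le_trans (le_of_eq ?_) h1
  rw [intervalIntegral.integral_mul_const, integral_pow]
  simp
  ring

theorem laplaceMoment_pos (j : ℕ) {B : ℝ} (hB : 0 < B) (s : ℝ) : 0 < laplaceMoment j B s := by
  rw [laplaceMoment]
  refine intervalIntegral.intervalIntegral_pos_of_pos_on
    ((by fun_prop : Continuous _).intervalIntegrable _ _) (fun x hx => ?_) hB
  have := hx.1
  positivity

/-- The function of which `symbolK k B` is the even extension from `[0, ∞)`. -/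
def symbolHalf (k : ℕ) (B s : ℝ) : ℝ := (2 * Real.pi * laplaceMoment (k + 1) B s)⁻¹

/-- The derivative of `symbolHalf`. -/
def symbolHalfDeriv (k : ℕ) (B s : ℝ) : ℝ :=
  2 * Real.pi * laplaceMoment (k + 2) B s * symbolHalf k B s ^ 2

/-- The second derivative of `symbolHalf`. -/
def symbolHalfDeriv2 (k : ℕ) (B s : ℝ) : ℝ :=
  -(2 * Real.pi * laplaceMoment (k + 3) B s * symbolHalf k B s ^ 2) +
    2 * (2 * Real.pi * laplaceMoment (k + 2) B s) * symbolHalf k B s * symbolHalfDeriv k B s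

theorem hasDerivAt_symbolHalf (k : ℕ) {B : ℝ} (hB : 0 < B) (s : ℝ) :
    HasDerivAt (symbolHalf k B) (symbolHalfDeriv k B s) s := by
  have hne : 2 * Real.pi * laplaceMoment (k + 1) B s ≠ 0 := by
    have := laplaceMoment_pos (k + 1) hB s
    positivity
  have h := ((hasDerivAt_laplaceMoment (k + 1) B s).const_mul (2 * Real.pi)).inv hne
  convert! h using 1
  rw [symbolHalfDeriv, symbolHalf]
  field_simp

theorem hasDerivAt_symbolHalfDeriv (k : ℕ) {B : ℝ} (hB : 0 < B) (s : ℝ) :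
    HasDerivAt (symbolHalfDeriv k B) (symbolHalfDeriv2 k B s) s := by
  have h := ((hasDerivAt_laplaceMoment (k + 2) B s).const_mul (2 * Real.pi)).mul
    ((hasDerivAt_symbolHalf k hB s).pow 2)
  convert! h using 1
  simp [symbolHalfDeriv2]
  ring

theorem continuous_symbolHalf (k : ℕ) {B : ℝ} (hB : 0 < B) : Continuous (symbolHalf k B) :=
  continuous_iff_continuousAt.2 fun s => (hasDerivAt_symbolHalf k hB s).continuousAt

theorem continuous_symbolHalfDeriv (k : ℕ) {B : ℝ} (hB : 0 < B) :
    Continuous (symbolHalfDeriv k B) :=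
  continuous_iff_continuousAt.2 fun s => (hasDerivAt_symbolHalfDeriv k hB s).continuousAt

theorem continuous_symbolHalfDeriv2 (k : ℕ) {B : ℝ} (hB : 0 < B) :
    Continuous (symbolHalfDeriv2 k B) := by
  have := continuous_symbolHalf k hB
  have := continuous_symbolHalfDeriv k hB
  have := continuous_laplaceMoment (k + 2) B
  have := continuous_laplaceMoment (k + 3) B
  unfold symbolHalfDeriv2
  fun_prop

theorem symbolHalf_pos (k : ℕ) {B : ℝ} (hB : 0 < B) (s : ℝ) : 0 < symbolHalf k B s := by
  have := laplaceMoment_pos (k + 1) hB s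
  unfold symbolHalf
  positivity

theorem symbolK_eq_symbolHalf (k : ℕ) {B : ℝ} (hB : 0 < B) (s : ℝ) :
    symbolK k B s = (symbolHalf k B |s| : ℂ) := symbolK_eq hB k s

theorem continuous_symbolK (k : ℕ) {B : ℝ} (hB : 0 < B) : Continuous (symbolK k B) := by
  have := continuous_symbolHalf k hB
  rw [show symbolK k B = fun s => (symbolHalf k B |s| : ℂ) from
    funext (symbolK_eq_symbolHalf k hB)]
  fun_prop

/-- The moment of order `j` is comparable to `(B⁻¹ + s)^(-(j+1))` uniformly in `B`. Differentiating
a moment raises its order by one, so each derivative of the reciprocal loses one power of `B⁻¹ + s`.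
-/
theorem exists_symbolHalf_le (k : ℕ) : ∃ C : ℝ, 0 ≤ C ∧ ∀ B : ℝ, 0 < B → ∀ s : ℝ, 0 ≤ s →
    |symbolHalf k B s| ≤ C * (B⁻¹ + s) ^ (k + 2) ∧
    |symbolHalfDeriv k B s| ≤ C * (B⁻¹ + s) ^ (k + 1) ∧
    |symbolHalfDeriv2 k B s| ≤ C * (B⁻¹ + s) ^ k := by
  set c0 : ℝ := (2 * Real.pi * (Real.exp (-1) / ((k + 1 : ℕ) + 1)))⁻¹ with hc0
  set c2 : ℝ := 2 * Real.pi * (Real.exp 1 * (k + 2).factorial) with hc2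
  set c3 : ℝ := 2 * Real.pi * (Real.exp 1 * (k + 3).factorial) with hc3
  have hc0' : 0 < c0 := by positivity
  have hc2' : 0 < c2 := by positivity
  have hc3' : 0 < c3 := by positivity
  refine ⟨c0 + c2 * c0 ^ 2 + (c3 * c0 ^ 2 + 2 * c2 * c0 * (c2 * c0 ^ 2)), by positivity,
    fun B hB s hs => ?_⟩
  have hr : 0 < B⁻¹ + s := by positivity
  set r := B⁻¹ + s with hrdef
  have h0 : symbolHalf k B s ≤ c0 * r ^ (k + 2) := by
    rw [symbolHalf, hc0, ← inv_inv (r ^ (k + 2)), ← mul_inv]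
    refine inv_anti₀ (by positivity) ?_
    rw [mul_assoc]
    have := le_laplaceMoment (k + 1) hB hs
    rw [← hrdef, inv_pow] at this
    gcongr
  have hp := symbolHalf_pos k hB s
  have hL2 : 2 * Real.pi * laplaceMoment (k + 2) B s ≤ c2 * r⁻¹ ^ (k + 3) := by
    rw [hc2, mul_assoc _ _ (r⁻¹ ^ (k + 3))]
    exact mul_le_mul_of_nonneg_left (laplaceMoment_le (k + 2) hB hs) (by positivity)
  have hL3 : 2 * Real.pi * laplaceMoment (k + 3) B s ≤ c3 * r⁻¹ ^ (k + 4) := by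
    rw [hc3, mul_assoc _ _ (r⁻¹ ^ (k + 4))]
    exact mul_le_mul_of_nonneg_left (laplaceMoment_le (k + 3) hB hs) (by positivity)
  have hL2p := laplaceMoment_pos (k + 2) hB s
  have hL3p := laplaceMoment_pos (k + 3) hB s
  have hd : symbolHalfDeriv k B s ≤ c2 * c0 ^ 2 * r ^ (k + 1) := by
    calc symbolHalfDeriv k B s ≤ c2 * r⁻¹ ^ (k + 3) * (c0 * r ^ (k + 2)) ^ 2 := by
          rw [symbolHalfDeriv]; gcongr
      _ = _ := by
        rw [inv_pow]
        field_simp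
        ring
  have hdp : 0 < symbolHalfDeriv k B s := by rw [symbolHalfDeriv]; positivity
  have hd2 : |symbolHalfDeriv2 k B s| ≤
      (c3 * c0 ^ 2 + 2 * c2 * c0 * (c2 * c0 ^ 2)) * r ^ k := by
    calc |symbolHalfDeriv2 k B s| ≤ 2 * Real.pi * laplaceMoment (k + 3) B s * symbolHalf k B s ^ 2 +
          2 * (2 * Real.pi * laplaceMoment (k + 2) B s) * symbolHalf k B s *
            symbolHalfDeriv k B s := by
          rw [symbolHalfDeriv2]
          refine (abs_add_le _ _).trans (le_of_eq ?_)
          rw [abs_neg, abs_of_pos (by positivity), abs_of_pos (by positivity)]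
      _ ≤ c3 * r⁻¹ ^ (k + 4) * (c0 * r ^ (k + 2)) ^ 2 +
          2 * (c2 * r⁻¹ ^ (k + 3)) * (c0 * r ^ (k + 2)) * (c2 * c0 ^ 2 * r ^ (k + 1)) := by
          gcongr
      _ = _ := by
        rw [inv_pow, inv_pow]
        field_simp
        ring
  refine ⟨?_, ?_, ?_⟩
  · rw [abs_of_pos hp]
    refine h0.trans ?_
    gcongr
    have : 0 < c2 * c0 ^ 2 := by positivity
    have : 0 < c3 * c0 ^ 2 + 2 * c2 * c0 * (c2 * c0 ^ 2) := by positivity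
    linarith
  · rw [abs_of_pos hdp]
    refine hd.trans ?_
    gcongr
    have : 0 < c3 * c0 ^ 2 + 2 * c2 * c0 * (c2 * c0 ^ 2) := by positivity
    linarith
  · refine hd2.trans (mul_le_mul_of_nonneg_right ?_ (by positivity))
    have : 0 < c2 * c0 ^ 2 := by positivity
    linarith

/-! ### Oscillatory integrals against the symbol. -/

/-- Integration by parts, twice, for an oscillatory integral on a half-line. -/
theorem sq_mul_integral_Ioi_mul_cexp {Q Q1 Q2 : ℝ → ℂ} (h : ∀ s, HasDerivAt Q (Q1 s) s)
    (h1 : ∀ s, HasDerivAt Q1 (Q2 s) s) (i : IntegrableOn Q (Ioi 0))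
    (i1 : IntegrableOn Q1 (Ioi 0)) (i2 : IntegrableOn Q2 (Ioi 0)) (y : ℝ) :
    (y : ℂ) ^ 2 * ∫ s in Ioi (0 : ℝ), Q s * Complex.exp (Complex.I * y * s) =
      Complex.I * y * Q 0 - Q1 0 -
        ∫ s in Ioi (0 : ℝ), Q2 s * Complex.exp (Complex.I * y * s) := by
  have hexp : ∀ {F : ℝ → ℂ}, IntegrableOn F (Ioi 0) →
      IntegrableOn (fun s : ℝ => F s * Complex.exp (Complex.I * y * s)) (Ioi 0) := by
    intro F hF
    refine Integrable.mul_bdd (c := 1) hF (by fun_prop) (ae_of_all _ fun s => ?_)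
    rw [show Complex.I * y * s = ((y * s : ℝ) : ℂ) * Complex.I by push_cast; ring,
      Complex.norm_exp_ofReal_mul_I]
  -- Both integrations by parts are done at once with the primitive `(-iyQ + Q') e^{iys}`. It tends
  -- to `0` at infinity because it and its derivative are integrable.
  have hder : ∀ s, HasDerivAt
      (fun s : ℝ => (-(Complex.I * y) * Q s + Q1 s) * Complex.exp (Complex.I * y * s))
      ((y : ℂ) ^ 2 * (Q s * Complex.exp (Complex.I * y * s)) +
        Q2 s * Complex.exp (Complex.I * y * s)) s := by
    intro s
    have he : HasDerivAt (fun s : ℝ => Complex.exp (Complex.I * y * s))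
        (Complex.exp (Complex.I * y * s) * (Complex.I * y)) s := by
      have h0 : HasDerivAt (fun s : ℝ => Complex.I * y * (s : ℂ)) (Complex.I * y) s := by
        simpa using (Complex.ofRealCLM.hasDerivAt (x := s)).const_mul (Complex.I * y)
      exact h0.cexp
    convert! ((((h s).const_mul (-(Complex.I * y))).add (h1 s)).mul he) using 1
    simp only [Pi.add_apply]
    ring_nf
    rw [Complex.I_sq]
    ring
  have hint' := ((hexp i).const_mul ((y : ℂ) ^ 2)).add (hexp i2)
  have hlim := tendsto_zero_of_hasDerivAt_of_integrableOn_Ioi (a := 0)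
    (fun s _ => hder s) hint' (by
      have := ((hexp i).const_mul (-(Complex.I * y))).add (hexp i1)
      refine this.congr (ae_of_all _ fun s => ?_)
      simp only [Pi.add_apply]
      ring)
  have hfin := integral_Ioi_of_hasDerivAt_of_tendsto' (a := 0) (fun s _ => hder s) hint' hlim
  rw [integral_add ((hexp i).const_mul ((y : ℂ) ^ 2)) (hexp i2), integral_const_mul] at hfin
  rw [eq_sub_iff_add_eq, hfin]
  simp
  ring

/-- The weighted norm `∫ (B⁻¹ + |s|)^n |g(s)| ds`. -/
def symbolNorm (B : ℝ) (n : ℕ) (g : ℝ → ℂ) : ℝ≥0∞ :=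
  ∫⁻ s, ENNReal.ofReal ((B⁻¹ + |s|) ^ n) * ‖g s‖ₑ

theorem symbolNorm_comp_neg (B : ℝ) (n : ℕ) (g : ℝ → ℂ) :
    symbolNorm B n (fun s => g (-s)) = symbolNorm B n g := by
  rw [symbolNorm, symbolNorm, ← lintegral_neg_eq_self]
  simp

theorem symbolNorm_mono_exponent {B : ℝ} (hB : 0 < B) (hB1 : B ≤ 1) {m n : ℕ} (hmn : m ≤ n)
    (g : ℝ → ℂ) : symbolNorm B m g ≤ symbolNorm B n g := by
  refine lintegral_mono fun s => ?_
  gcongr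
  have : 1 ≤ B⁻¹ := (one_le_inv₀ hB).2 hB1
  have := abs_nonneg s
  linarith

theorem enorm_mul_le_weight {c C r : ℝ} {n : ℕ} (hC : 0 ≤ C) (h : |c| ≤ C * r ^ n) (z : ℂ) :
    ‖(c : ℂ) * z‖ₑ ≤ ENNReal.ofReal C * (ENNReal.ofReal (r ^ n) * ‖z‖ₑ) := by
  rw [enorm_mul, ← mul_assoc, ← ENNReal.ofReal_mul hC]
  gcongr
  rw [← ofReal_norm, Complex.norm_real]
  exact ENNReal.ofReal_le_ofReal h

theorem enorm_mul_cexp_I (z : ℂ) (y s : ℝ) :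
    ‖z * Complex.exp (Complex.I * y * s)‖ₑ = ‖z‖ₑ := by
  rw [enorm_mul, show Complex.I * y * s = ((y * s : ℝ) : ℂ) * Complex.I by push_cast; ring,
    ← ofReal_norm (Complex.exp _), Complex.norm_exp_ofReal_mul_I]
  simp

/-- On a half-line, two derivatives of the symbol and of the transform control `y²` times the
multiplier integral. -/
theorem half_line_bound {k : ℕ} {C : ℝ} (hC : 0 ≤ C) {B : ℝ} (hB : 0 < B) (hB1 : B ≤ 1)
    (hK : ∀ s : ℝ, 0 ≤ s → |symbolHalf k B s| ≤ C * (B⁻¹ + s) ^ (k + 2) ∧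
      |symbolHalfDeriv k B s| ≤ C * (B⁻¹ + s) ^ (k + 1) ∧
      |symbolHalfDeriv2 k B s| ≤ C * (B⁻¹ + s) ^ k)
    {g g1 g2 : ℝ → ℂ} (hg : ∀ s, HasDerivAt g (g1 s) s) (hg1 : ∀ s, HasDerivAt g1 (g2 s) s)
    (hg2 : Continuous g2) (f0 : symbolNorm B (k + 2) g < ∞) (f1 : symbolNorm B (k + 2) g1 < ∞)
    (f2 : symbolNorm B (k + 2) g2 < ∞) (y : ℝ) :
    ∃ r : ℂ, (y : ℂ) ^ 2 * (∫ s in Ioi (0 : ℝ), (symbolHalf k B s : ℂ) * g s *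
        Complex.exp (Complex.I * y * s)) =
      Complex.I * y * (symbolHalf k B 0 * g 0) - symbolHalf k B 0 * g1 0 -
        symbolHalfDeriv k B 0 * g 0 - r ∧
      ‖r‖ₑ ≤ ENNReal.ofReal C * (symbolNorm B k g + 2 * symbolNorm B (k + 1) g1 +
        symbolNorm B (k + 2) g2) := by
  have cK := continuous_symbolHalf k hB
  have cK1 := continuous_symbolHalfDeriv k hB
  have cK2 := continuous_symbolHalfDeriv2 k hB
  have cg : Continuous g := continuous_iff_continuousAt.2 fun s => (hg s).continuousAt
  have cg1 : Continuous g1 := continuous_iff_continuousAt.2 fun s => (hg1 s).continuousAt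
  have key : ∀ {c : ℝ → ℝ} {u : ℝ → ℂ} (n : ℕ), (∀ s, 0 ≤ s → |c s| ≤ C * (B⁻¹ + s) ^ n) →
      ∫⁻ s in Ioi (0 : ℝ), ‖(c s : ℂ) * u s‖ₑ ≤ ENNReal.ofReal C * symbolNorm B n u := by
    intro c u n hc
    rw [symbolNorm, ← lintegral_const_mul' _ _ ENNReal.ofReal_ne_top]
    refine le_trans ?_ (setLIntegral_le_lintegral (Ioi 0) _)
    refine setLIntegral_mono' measurableSet_Ioi fun s hs => ?_
    have hs' : (0 : ℝ) < s := hs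
    rw [abs_of_pos hs']
    exact enorm_mul_le_weight hC (hc s hs'.le) _
  have integ : ∀ {c : ℝ → ℝ} {u : ℝ → ℂ} (n : ℕ), n ≤ k + 2 → Continuous c → Continuous u →
      (∀ s, 0 ≤ s → |c s| ≤ C * (B⁻¹ + s) ^ n) → symbolNorm B (k + 2) u < ∞ →
      IntegrableOn (fun s => (c s : ℂ) * u s) (Ioi 0) := by
    intro c u n hn hcc hcu hc hu
    refine ⟨(by fun_prop : Continuous _).aestronglyMeasurable, (key n hc).trans_lt ?_⟩
    exact ENNReal.mul_lt_top ENNReal.ofReal_lt_top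
      ((symbolNorm_mono_exponent hB hB1 hn u).trans_lt hu)
  have b0 := fun s hs => (hK s hs).1
  have b1 := fun s hs => (hK s hs).2.1
  have b2 := fun s hs => (hK s hs).2.2
  have d0 := fun s => (hasDerivAt_symbolHalf k hB s).ofReal_comp
  have d1 := fun s => (hasDerivAt_symbolHalfDeriv k hB s).ofReal_comp
  have main := sq_mul_integral_Ioi_mul_cexp
    (Q := fun s => (symbolHalf k B s : ℂ) * g s)
    (Q1 := fun s => (symbolHalfDeriv k B s : ℂ) * g s + (symbolHalf k B s : ℂ) * g1 s)
    (Q2 := fun s => ((symbolHalfDeriv2 k B s : ℂ) * g s + (symbolHalfDeriv k B s : ℂ) * g1 s) +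
      ((symbolHalfDeriv k B s : ℂ) * g1 s + (symbolHalf k B s : ℂ) * g2 s))
    (fun s => (d0 s).mul (hg s)) (fun s => ((d1 s).mul (hg s)).add ((d0 s).mul (hg1 s)))
    (integ _ le_rfl cK cg b0 f0)
    ((integ _ (by omega) cK1 cg b1 f0).add (integ _ le_rfl cK cg1 b0 f1))
    (((integ _ (by omega) cK2 cg b2 f0).add (integ _ (by omega) cK1 cg1 b1 f1)).add
      ((integ _ (by omega) cK1 cg1 b1 f1).add (integ _ le_rfl cK hg2 b0 f2))) y
  refine ⟨∫ s in Ioi (0 : ℝ), (((symbolHalfDeriv2 k B s : ℂ) * g s +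
      (symbolHalfDeriv k B s : ℂ) * g1 s) + ((symbolHalfDeriv k B s : ℂ) * g1 s +
        (symbolHalf k B s : ℂ) * g2 s)) * Complex.exp (Complex.I * y * s), main.trans ?_, ?_⟩
  · ring
  · refine (enorm_integral_le_lintegral_enorm _).trans ?_
    simp only [enorm_mul_cexp_I]
    have m0 : Measurable fun s => ‖(symbolHalfDeriv2 k B s : ℂ) * g s‖ₑ :=
      (by fun_prop : Continuous fun s => (symbolHalfDeriv2 k B s : ℂ) * g s).measurable.enorm
    have m1 : Measurable fun s => ‖(symbolHalfDeriv k B s : ℂ) * g1 s‖ₑ :=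
      (by fun_prop : Continuous fun s => (symbolHalfDeriv k B s : ℂ) * g1 s).measurable.enorm
    calc _ ≤ ∫⁻ s in Ioi (0 : ℝ), ((‖(symbolHalfDeriv2 k B s : ℂ) * g s‖ₑ +
          ‖(symbolHalfDeriv k B s : ℂ) * g1 s‖ₑ) + (‖(symbolHalfDeriv k B s : ℂ) * g1 s‖ₑ +
          ‖(symbolHalf k B s : ℂ) * g2 s‖ₑ)) :=
          lintegral_mono fun s => (enorm_add_le _ _).trans
            (add_le_add (enorm_add_le _ _) (enorm_add_le _ _))
      _ = ((∫⁻ s in Ioi (0 : ℝ), ‖(symbolHalfDeriv2 k B s : ℂ) * g s‖ₑ) +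
          (∫⁻ s in Ioi (0 : ℝ), ‖(symbolHalfDeriv k B s : ℂ) * g1 s‖ₑ)) +
          ((∫⁻ s in Ioi (0 : ℝ), ‖(symbolHalfDeriv k B s : ℂ) * g1 s‖ₑ) +
          (∫⁻ s in Ioi (0 : ℝ), ‖(symbolHalf k B s : ℂ) * g2 s‖ₑ)) := by
          have m01 : Measurable fun s => ‖(symbolHalfDeriv2 k B s : ℂ) * g s‖ₑ +
            ‖(symbolHalfDeriv k B s : ℂ) * g1 s‖ₑ := m0.add m1
          rw [lintegral_add_left m01, lintegral_add_left m0, lintegral_add_left m1]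
      _ ≤ (ENNReal.ofReal C * symbolNorm B k g + ENNReal.ofReal C * symbolNorm B (k + 1) g1) +
          (ENNReal.ofReal C * symbolNorm B (k + 1) g1 +
            ENNReal.ofReal C * symbolNorm B (k + 2) g2) := by
          gcongr
          exacts [key _ b2, key _ b1, key _ b1, key _ b0]
      _ = _ := by ring

theorem enorm_symbolK_mul_le {k : ℕ} {C : ℝ} (hC : 0 ≤ C) {B : ℝ} (hB : 0 < B)
    (hK : ∀ s : ℝ, 0 ≤ s → |symbolHalf k B s| ≤ C * (B⁻¹ + s) ^ (k + 2)) (s : ℝ) (z : ℂ) :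
    ‖symbolK k B s * z‖ₑ ≤
      ENNReal.ofReal C * (ENNReal.ofReal ((B⁻¹ + |s|) ^ (k + 2)) * ‖z‖ₑ) := by
  rw [symbolK_eq_symbolHalf k hB]
  exact enorm_mul_le_weight hC (hK _ (abs_nonneg s)) z

theorem lintegral_symbolK_mul_le {k : ℕ} {C : ℝ} (hC : 0 ≤ C) {B : ℝ} (hB : 0 < B)
    (hK : ∀ s : ℝ, 0 ≤ s → |symbolHalf k B s| ≤ C * (B⁻¹ + s) ^ (k + 2)) (g : ℝ → ℂ) :
    ∫⁻ s, ‖symbolK k B s * g s‖ₑ ≤ ENNReal.ofReal C * symbolNorm B (k + 2) g := by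
  rw [symbolNorm, ← lintegral_const_mul' _ _ ENNReal.ofReal_ne_top]
  exact lintegral_mono fun s => enorm_symbolK_mul_le hC hB hK s (g s)

/-- The symbol is smooth on each closed half-line but has a kink at `0`, so `half_line_bound` is
applied to `g` and to its reflection. When the halves are added, the boundary terms containing the
value of the symbol at `0` cancel. The jump of its derivative survives and produces the term
`B⁻¹^(k+1) |g(0)|`. -/
theorem exists_multiplier_bound (k : ℕ) : ∃ C : ℝ, 0 ≤ C ∧ ∀ B : ℝ, 0 < B → B ≤ 1 →
    ∀ g g1 g2 : ℝ → ℂ, (∀ s, HasDerivAt g (g1 s) s) → (∀ s, HasDerivAt g1 (g2 s) s) →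
    Continuous g2 → symbolNorm B (k + 2) g < ∞ → symbolNorm B (k + 2) g1 < ∞ →
    symbolNorm B (k + 2) g2 < ∞ →
    Integrable (fun s => symbolK k B s * g s) ∧
    ∀ y : ℝ, ‖∫ s, symbolK k B s * g s * Complex.exp (Complex.I * y * s)‖ₑ ≤
        ENNReal.ofReal C * symbolNorm B (k + 2) g ∧
      ENNReal.ofReal (y ^ 2) *
          ‖∫ s, symbolK k B s * g s * Complex.exp (Complex.I * y * s)‖ₑ ≤
        ENNReal.ofReal C * (symbolNorm B k g + symbolNorm B (k + 1) g1 +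
          symbolNorm B (k + 2) g2 + ENNReal.ofReal (B⁻¹ ^ (k + 1)) * ‖g 0‖ₑ) := by
  obtain ⟨C, hC, hK⟩ := exists_symbolHalf_le k
  -- The largest coefficient is that of `g1`: the cross term of Leibniz' rule counts twice, on each
  -- of two half-lines.
  refine ⟨4 * C, by positivity, fun B hB hB1 g g1 g2 hg hg1 hg2 f0 f1 f2 => ?_⟩
  have hCC : ENNReal.ofReal C ≤ ENNReal.ofReal (4 * C) := ENNReal.ofReal_le_ofReal (by linarith)
  have cg : Continuous g := continuous_iff_continuousAt.2 fun s => (hg s).continuousAt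
  have cK := continuous_symbolK k hB
  have hl := lintegral_symbolK_mul_le hC hB (fun s hs => (hK B hB s hs).1) g
  have hi : Integrable (fun s => symbolK k B s * g s) :=
    ⟨(by fun_prop : Continuous _).aestronglyMeasurable,
      hl.trans_lt (ENNReal.mul_lt_top ENNReal.ofReal_lt_top f0)⟩
  refine ⟨hi, fun y => ⟨?_, ?_⟩⟩
  · refine (enorm_integral_le_lintegral_enorm _).trans ?_
    simp only [enorm_mul_cexp_I]
    exact hl.trans (by gcongr)
  have hie : Integrable (fun s : ℝ => symbolK k B s * g s * Complex.exp (Complex.I * y * s)) := by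
    refine hi.mul_bdd (c := 1) (by fun_prop) (ae_of_all _ fun s => ?_)
    rw [show Complex.I * y * s = ((y * s : ℝ) : ℂ) * Complex.I by push_cast; ring,
      Complex.norm_exp_ofReal_mul_I]
  obtain ⟨r, hr, hrb⟩ := half_line_bound hC hB hB1 (hK B hB) hg hg1 hg2 f0 f1 f2 y
  have hgn : ∀ s, HasDerivAt (fun s => g (-s)) (-g1 (-s)) s := fun s => by
    simpa [Function.comp_def] using (hg (-s)).scomp s (hasDerivAt_neg s)
  have hgn1 : ∀ s, HasDerivAt (fun s => -g1 (-s)) (g2 (-s)) s := fun s => by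
    simpa [Function.comp_def] using ((hg1 (-s)).scomp s (hasDerivAt_neg s)).fun_neg
  have eN1 : ∀ n, symbolNorm B n (fun s => -g1 (-s)) = symbolNorm B n g1 := fun n => by
    rw [← symbolNorm_comp_neg]; simp [symbolNorm]
  obtain ⟨r', hr', hrb'⟩ := half_line_bound hC hB hB1 (hK B hB) hgn hgn1
    (by fun_prop) (by rwa [symbolNorm_comp_neg]) (by rwa [eN1])
    (by rwa [symbolNorm_comp_neg B (k + 2) g2]) (-y)
  rw [symbolNorm_comp_neg, symbolNorm_comp_neg B (k + 2) g2, eN1] at hrb'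
  have hsplit : ∫ s, symbolK k B s * g s * Complex.exp (Complex.I * y * s) =
      (∫ s in Ioi (0 : ℝ), (symbolHalf k B s : ℂ) * g (-s) *
        Complex.exp (Complex.I * (-y : ℝ) * s)) +
      ∫ s in Ioi (0 : ℝ), (symbolHalf k B s : ℂ) * g s * Complex.exp (Complex.I * y * s) := by
    rw [← integral_add_compl measurableSet_Iic hie (s := Iic (0:ℝ)), compl_Iic]
    congr 1
    · rw [← neg_zero, ← integral_comp_neg_Ioi, neg_zero]
      refine setIntegral_congr_fun measurableSet_Ioi fun s hs => ?_
      simp only [symbolK_eq_symbolHalf k hB, abs_neg, abs_of_pos (mem_Ioi.1 hs)]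
      push_cast
      ring_nf
    · refine setIntegral_congr_fun measurableSet_Ioi fun s hs => ?_
      simp only [symbolK_eq_symbolHalf k hB, abs_of_pos (mem_Ioi.1 hs)]
  have htot : (y : ℂ) ^ 2 * ∫ s, symbolK k B s * g s * Complex.exp (Complex.I * y * s) =
      -(2 * (symbolHalfDeriv k B 0 * g 0)) - r - r' := by
    rw [hsplit, mul_add, hr]
    rw [Complex.ofReal_neg, neg_sq] at hr'
    rw [Complex.ofReal_neg, hr', neg_zero]
    ring
  have hy : ENNReal.ofReal (y ^ 2) = ‖(y : ℂ) ^ 2‖ₑ := by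
    rw [← ofReal_norm]; simp
  rw [hy, ← enorm_mul, htot]
  have hj : ‖(2 * ((symbolHalfDeriv k B 0 : ℂ) * g 0))‖ₑ ≤
      2 * (ENNReal.ofReal C * (ENNReal.ofReal (B⁻¹ ^ (k + 1)) * ‖g 0‖ₑ)) := by
    rw [enorm_mul]
    have h2 : ‖(2 : ℂ)‖ₑ = 2 := by
      rw [← ofReal_norm]; simp
    rw [h2]
    gcongr
    refine enorm_mul_le_weight hC ?_ _
    simpa using (hK B hB 0 le_rfl).2.1
  have h4 : ENNReal.ofReal (4 * C) = 4 * ENNReal.ofReal C := by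
    rw [ENNReal.ofReal_mul (by norm_num)]; simp
  calc _ ≤ ‖(2 * ((symbolHalfDeriv k B 0 : ℂ) * g 0))‖ₑ + ‖r‖ₑ + ‖r'‖ₑ := by
        refine (enorm_sub_le).trans ?_
        gcongr
        refine (enorm_sub_le).trans ?_
        rw [enorm_neg]
    _ ≤ 2 * (ENNReal.ofReal C * (ENNReal.ofReal (B⁻¹ ^ (k + 1)) * ‖g 0‖ₑ)) +
        ENNReal.ofReal C * (symbolNorm B k g + 2 * symbolNorm B (k + 1) g1 +
          symbolNorm B (k + 2) g2) + ENNReal.ofReal C * (symbolNorm B k g +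
            2 * symbolNorm B (k + 1) g1 + symbolNorm B (k + 2) g2) := by gcongr
    _ = ENNReal.ofReal C * (2 * symbolNorm B k g + 4 * symbolNorm B (k + 1) g1 +
          2 * symbolNorm B (k + 2) g2 + 2 * (ENNReal.ofReal (B⁻¹ ^ (k + 1)) * ‖g 0‖ₑ)) := by ring
    _ ≤ ENNReal.ofReal C * (4 * symbolNorm B k g + 4 * symbolNorm B (k + 1) g1 +
          4 * symbolNorm B (k + 2) g2 + 4 * (ENNReal.ofReal (B⁻¹ ^ (k + 1)) * ‖g 0‖ₑ)) := by
        gcongr <;> norm_num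
    _ = _ := by rw [h4]; ring

/-! ### The Fourier transform and the operator `𝒦`. -/

theorem hasDerivAt_fourierT {f : ℝ → ℂ} (hf : Integrable f)
    (hf' : Integrable fun x : ℝ => (x : ℂ) * f x) (s : ℝ) :
    HasDerivAt (fourierT f) (-Complex.I * fourierT (fun x => (x : ℂ) * f x) s) s := by
  have hf'' : Integrable fun x : ℝ => x • f x := by simpa only [Complex.real_smul] using! hf'
  have h1 := Real.hasDerivAt_fourier hf hf'' (s / (2 * Real.pi))
  have h2 : HasDerivAt (fun s : ℝ => s / (2 * Real.pi)) (1 / (2 * Real.pi)) s :=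
    (hasDerivAt_id s).div_const _
  have h3 := h1.scomp s h2
  have e : fourierT f = (𝓕 f) ∘ fun s : ℝ => s / (2 * Real.pi) :=
    funext fun s => fourierT_eq_fourier f s
  rw [e]
  convert! h3 using 1
  rw [fourierT_eq_fourier]
  have hpi : (Real.pi : ℂ) ≠ 0 := by exact_mod_cast Real.pi_ne_zero
  rw [Real.fourier_eq', Real.fourier_eq', ← integral_const_mul, ← integral_smul]
  refine integral_congr_ae (ae_of_all _ fun x => ?_)
  simp only [smul_eq_mul, Complex.real_smul]
  push_cast
  field_simp

theorem norm_cexp_neg_I_mul (x s : ℝ) : ‖Complex.exp (-(Complex.I * (x : ℂ) * (s : ℂ)))‖ = 1 := by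
  rw [show -(Complex.I * (x : ℂ) * (s : ℂ)) = ((-(x * s) : ℝ) : ℂ) * Complex.I by push_cast; ring,
    Complex.norm_exp_ofReal_mul_I]

theorem integrable_mul_cexp {f : ℝ → ℂ} (hf : Integrable f) (s : ℝ) :
    Integrable fun x : ℝ => f x * Complex.exp (-(Complex.I * (x : ℂ) * (s : ℂ))) :=
  hf.mul_bdd (c := 1) (by fun_prop) (ae_of_all _ fun x => (norm_cexp_neg_I_mul x s).le)

theorem norm_fourierT_le (f : ℝ → ℂ) (s : ℝ) : ‖fourierT f s‖ ≤ ∫ x, ‖f x‖ := by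
  refine (norm_integral_le_integral_norm _).trans (le_of_eq ?_)
  simp only [norm_mul, norm_cexp_neg_I_mul, mul_one]

theorem fourierT_add {f g : ℝ → ℂ} (hf : Integrable f) (hg : Integrable g) (s : ℝ) :
    fourierT (fun x => f x + g x) s = fourierT f s + fourierT g s := by
  rw [fourierT, fourierT, fourierT, ← integral_add (integrable_mul_cexp hf s)
    (integrable_mul_cexp hg s)]
  simp only [add_mul]

theorem fourierT_const_mul (c : ℂ) (f : ℝ → ℂ) (s : ℝ) :
    fourierT (fun x => c * f x) s = c * fourierT f s := by
  rw [fourierT, fourierT, ← integral_const_mul]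
  simp only [mul_assoc]

theorem fourierT_conj (f : ℝ → ℂ) (s : ℝ) :
    fourierT (fun x => conj (f x)) s = conj (fourierT f (-s)) := by
  rw [fourierT, fourierT, ← integral_conj]
  simp [← Complex.exp_conj]

theorem fourierT_comp_add (f : ℝ → ℂ) (a s : ℝ) :
    fourierT f s = Complex.exp (-(Complex.I * a * s)) * fourierT (fun y => f (a + y)) s := by
  rw [fourierT, fourierT, ← integral_add_left_eq_self _ a, ← integral_const_mul]
  refine integral_congr_ae (ae_of_all _ fun x => ?_)
  simp only
  rw [mul_left_comm, ← Complex.exp_add]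
  congr 2
  push_cast
  ring

theorem continuous_fourierT {f : ℝ → ℂ} (hf : Integrable f) : Continuous (fourierT f) := by
  refine continuous_of_dominated (bound := fun x => ‖f x‖)
    (fun s => (integrable_mul_cexp hf s).aestronglyMeasurable)
    (fun s => ae_of_all _ fun x => ?_) hf.norm (ae_of_all _ fun x => by fun_prop)
  rw [norm_mul, norm_cexp_neg_I_mul, mul_one]

theorem pow_mul_norm_fourierT_le {f : ℝ → ℂ} {m : ℕ} (hf : ContDiff ℝ m f)
    (hc : HasCompactSupport f) (s : ℝ) :
    |s| ^ m * ‖fourierT f s‖ ≤ ∫ x, ‖iteratedDeriv m f x‖ := by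
  have hi : ∀ n : ℕ, (n : ℕ∞) ≤ (m : ℕ∞) → Integrable (iteratedDeriv n f) := fun n hn => by
    refine (hf.continuous_iteratedDeriv n (by exact_mod_cast hn)).integrable_of_hasCompactSupport ?_
    have h := hc.iteratedFDeriv (𝕜 := ℝ) n
    rw [iteratedDeriv_eq_equiv_comp]
    exact h.comp_left (map_zero _)
  have h := congrFun (Real.fourier_iteratedDeriv (N := m) (n := m) (by exact_mod_cast hf) hi le_rfl)
    (s / (2 * Real.pi))
  rw [← fourierT_eq_fourier, ← fourierT_eq_fourier] at h
  refine le_trans (le_of_eq ?_) (norm_fourierT_le _ s)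
  rw [h, norm_smul, norm_pow]
  congr 2
  have hpi : (Real.pi : ℂ) ≠ 0 := by exact_mod_cast Real.pi_ne_zero
  rw [show 2 * (Real.pi : ℂ) * Complex.I * ((s / (2 * Real.pi) : ℝ) : ℂ) = (s : ℂ) * Complex.I by
    push_cast; field_simp]
  simp

/-- Combines the bounds from zero and from `m` derivatives through `(1 + |s|)^m ≤ 2^m (1 + |s|^m)`.
Each contributes `2rM`, the length of the support times the sup. -/
theorem norm_fourierT_le_of_support {f : ℝ → ℂ} {m : ℕ} (hf : ContDiff ℝ m f) {r M : ℝ}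
    (hr : 0 ≤ r) (hs : ∀ x, r < |x| → f x = 0)
    (hM : ∀ j ≤ m, ∀ x, ‖iteratedDeriv j f x‖ ≤ M) (s : ℝ) :
    ‖fourierT f s‖ ≤ 2 ^ m * (4 * r * M) / (1 + |s|) ^ m := by
  have hsub : tsupport f ⊆ Icc (-r) r := by
    refine closure_minimal (fun x hx => ?_) isClosed_Icc
    by_contra hx'
    exact hx (hs x (by rw [← not_le, abs_le]; exact hx'))
  have hc : HasCompactSupport f := HasCompactSupport.of_support_subset_isCompact isCompact_Icc
    ((subset_tsupport f).trans hsub)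
  have hint : ∀ j ≤ m, ∫ x, ‖iteratedDeriv j f x‖ ≤ 2 * r * M := by
    intro j hj
    have hz : ∀ x ∉ Icc (-r) r, ‖iteratedDeriv j f x‖ = 0 := by
      intro x hx
      have := (tsupport_iteratedFDeriv_subset (𝕜 := ℝ) (f := f) j).trans hsub
      rw [← norm_iteratedFDeriv_eq_norm_iteratedDeriv]
      by_contra h
      exact hx (this (subset_tsupport _ (by simpa using h)))
    rw [← setIntegral_eq_integral_of_forall_compl_eq_zero hz]
    refine (le_abs_self _).trans ?_
    have := norm_setIntegral_le_of_norm_le_const (μ := volume) (s := Icc (-r) r) (C := M)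
      (f := fun x => ‖iteratedDeriv j f x‖) (by simp) (fun x _ => by simpa using hM j hj x)
    rw [Real.norm_eq_abs] at this
    refine this.trans (le_of_eq ?_)
    rw [Measure.real, Real.volume_Icc, ENNReal.toReal_ofReal (by linarith)]
    ring
  have h0 := (pow_mul_norm_fourierT_le (m := 0) (hf.of_le (by simp)) hc s).trans (hint 0 (by omega))
  have hm := (pow_mul_norm_fourierT_le hf hc s).trans (hint m le_rfl)
  rw [pow_zero, one_mul] at h0
  rw [le_div_iff₀ (by positivity)]
  have hp : (1 + |s|) ^ m ≤ 2 ^ m * (1 + |s| ^ m) := by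
    have h2 : 1 + |s| ≤ 2 * max 1 |s| := by
      have := le_max_left 1 |s|
      have := le_max_right 1 |s|
      linarith
    calc (1 + |s|) ^ m ≤ (2 * max 1 |s|) ^ m := by gcongr
      _ = 2 ^ m * max 1 |s| ^ m := mul_pow _ _ _
      _ ≤ _ := by
        gcongr
        rcases le_total 1 |s| with h | h
        · rw [max_eq_right h]; linarith
        · rw [max_eq_left h, one_pow]
          have : 0 ≤ |s| ^ m := by positivity
          linarith
  calc ‖fourierT f s‖ * (1 + |s|) ^ m ≤ ‖fourierT f s‖ * (2 ^ m * (1 + |s| ^ m)) := by gcongr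
    _ = 2 ^ m * (‖fourierT f s‖ + |s| ^ m * ‖fourierT f s‖) := by ring
    _ ≤ 2 ^ m * (2 * r * M + 2 * r * M) := by gcongr
    _ = _ := by ring

/-- The symbol is real and even. This later reduces `b_T < 0` to `b_T > 0`. -/
theorem opK_conj {k : ℕ} {B : ℝ} (hB : 0 < B) (f : ℝ → ℂ) (x : ℝ) :
    opK k B (fun x => conj (f x)) x = conj (opK k B f x) := by
  rw [opK, opK, fourierTInv, fourierTInv, map_mul, ← integral_conj]
  congr 1
  · simp [map_ofNat]
  rw [← integral_neg_eq_self]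
  refine integral_congr_ae (ae_of_all _ fun s => ?_)
  simp only [fourierT_conj, symbolK_eq_symbolHalf k hB, abs_neg, neg_neg, map_mul,
    Complex.conj_ofReal, ← Complex.exp_conj, Complex.conj_I]
  push_cast
  ring_nf

theorem opK_comp_add (k : ℕ) (B : ℝ) (f : ℝ → ℂ) (a y : ℝ) :
    opK k B f (a + y) = opK k B (fun y => f (a + y)) y := by
  rw [opK, opK, fourierTInv, fourierTInv]
  congr 1
  refine integral_congr_ae (ae_of_all _ fun s => ?_)
  simp only
  rw [fourierT_comp_add f a, mul_left_comm, mul_comm (Complex.exp _), mul_assoc, ← Complex.exp_add]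
  congr 2
  push_cast
  ring

theorem opK_add {k : ℕ} {B : ℝ} {f g : ℝ → ℂ} (hf : Integrable f) (hg : Integrable g)
    (hf' : Integrable fun s => symbolK k B s * fourierT f s)
    (hg' : Integrable fun s => symbolK k B s * fourierT g s) (y : ℝ) :
    opK k B (fun x => f x + g x) y = opK k B f y + opK k B g y := by
  rw [opK, opK, opK, fourierTInv, fourierTInv, fourierTInv, ← mul_add]
  have hb : ∀ {F : ℝ → ℂ}, Integrable F →
      Integrable fun s : ℝ => F s * Complex.exp (Complex.I * y * s) := fun hF => by
    refine hF.mul_bdd (c := 1) (by fun_prop) (ae_of_all _ fun s => ?_)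
    rw [show Complex.I * y * s = ((y * s : ℝ) : ℂ) * Complex.I by push_cast; ring,
      Complex.norm_exp_ofReal_mul_I]
  rw [← integral_add (hb hf') (hb hg')]
  simp only [fourierT_add hf hg, mul_add, add_mul]

theorem symbolNorm_const_mul (B : ℝ) (n : ℕ) (c : ℂ) (g : ℝ → ℂ) :
    symbolNorm B n (fun s => c * g s) = ‖c‖ₑ * symbolNorm B n g := by
  rw [symbolNorm, symbolNorm, ← lintegral_const_mul' _ _ (by simp)]
  refine lintegral_congr fun s => ?_
  rw [enorm_mul]
  ring

/-- Translates `exists_multiplier_bound` through the rule that differentiating `𝓕 f` multiplies `f`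
by `-ix`. The weights `k`, `k + 1`, `k + 2` record how many of the two derivatives fall on the
symbol. -/
theorem exists_opK_bound (k : ℕ) : ∃ C : ℝ, 0 ≤ C ∧ ∀ B : ℝ, 0 < B → B ≤ 1 →
    ∀ f : ℝ → ℂ, Continuous f → HasCompactSupport f → symbolNorm B (k + 2) (fourierT f) < ∞ →
    symbolNorm B (k + 2) (fourierT fun x => (x : ℂ) * f x) < ∞ →
    symbolNorm B (k + 2) (fourierT fun x => (x : ℂ) * ((x : ℂ) * f x)) < ∞ →
    Integrable (fun s => symbolK k B s * fourierT f s) ∧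
    ∀ y : ℝ, ‖opK k B f y‖ₑ ≤ ENNReal.ofReal C * symbolNorm B (k + 2) (fourierT f) ∧
      ENNReal.ofReal (y ^ 2) * ‖opK k B f y‖ₑ ≤
        ENNReal.ofReal C * (symbolNorm B k (fourierT f) +
          symbolNorm B (k + 1) (fourierT fun x => (x : ℂ) * f x) +
          symbolNorm B (k + 2) (fourierT fun x => (x : ℂ) * ((x : ℂ) * f x)) +
          ENNReal.ofReal (B⁻¹ ^ (k + 1)) * ‖fourierT f 0‖ₑ) := by
  obtain ⟨C, hC, h⟩ := exists_multiplier_bound k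
  refine ⟨C, hC, fun B hB hB1 f cf sf f0 f1 f2 => ?_⟩
  have i0 : Integrable f := cf.integrable_of_hasCompactSupport sf
  have i1 : Integrable fun x : ℝ => (x : ℂ) * f x :=
    (by fun_prop : Continuous _).integrable_of_hasCompactSupport sf.mul_left
  have i2 : Integrable fun x : ℝ => (x : ℂ) * ((x : ℂ) * f x) :=
    (by fun_prop : Continuous _).integrable_of_hasCompactSupport sf.mul_left.mul_left
  have eI : ∀ (n : ℕ) (g : ℝ → ℂ),
      symbolNorm B n (fun s => -Complex.I * g s) = symbolNorm B n g := fun n g => by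
    rw [symbolNorm_const_mul]; simp [← ofReal_norm]
  have h2 := h B hB hB1 (fourierT f) (fun s => -Complex.I * fourierT (fun x => (x : ℂ) * f x) s)
    (fun s => -Complex.I * (-Complex.I * fourierT (fun x => (x : ℂ) * ((x : ℂ) * f x)) s))
    (hasDerivAt_fourierT i0 i1)
    (fun s => (hasDerivAt_fourierT i1 i2 s).const_mul _)
    (by have := continuous_fourierT i2; fun_prop) f0 (by rwa [eI]) (by rwa [eI, eI])
  simp only [eI] at h2
  refine ⟨h2.1, fun y => ?_⟩
  have hle : ‖opK k B f y‖ₑ ≤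
      ‖∫ s, symbolK k B s * fourierT f s * Complex.exp (Complex.I * y * s)‖ₑ := by
    rw [opK, fourierTInv, enorm_mul]
    refine mul_le_of_le_one_left (zero_le) ?_
    rw [← ofReal_norm, ← ENNReal.ofReal_one]
    refine ENNReal.ofReal_le_ofReal ?_
    have := Real.pi_gt_three
    simp only [one_div, norm_inv, norm_mul, Complex.norm_ofNat, Complex.norm_real,
      Real.norm_eq_abs, abs_of_pos Real.pi_pos]
    refine inv_le_one_of_one_le₀ (by linarith)
  exact ⟨hle.trans (h2.2 y).1, (by gcongr : _ ≤ _).trans (h2.2 y).2⟩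

/-! ### Weighted norms at scale `b`. -/

/-- The weighted norm `∫ (1 + b |s|)^n |g(s)| ds`. -/
def scaleNorm (b : ℝ) (n : ℕ) (g : ℝ → ℂ) : ℝ≥0∞ :=
  ∫⁻ s, ENNReal.ofReal ((1 + b * |s|) ^ n) * ‖g s‖ₑ

theorem scaleNorm_const_mul (b : ℝ) (n : ℕ) (c : ℂ) (g : ℝ → ℂ) :
    scaleNorm b n (fun s => c * g s) = ‖c‖ₑ * scaleNorm b n g := by
  rw [scaleNorm, scaleNorm, ← lintegral_const_mul' _ _ (by simp)]
  refine lintegral_congr fun s => ?_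
  rw [enorm_mul]
  ring

theorem scaleNorm_add_le (b : ℝ) (n : ℕ) {g h : ℝ → ℂ} (hg : Continuous g) :
    scaleNorm b n (fun s => g s + h s) ≤ scaleNorm b n g + scaleNorm b n h := by
  rw [scaleNorm, scaleNorm, scaleNorm, ← lintegral_add_left]
  · refine lintegral_mono fun s => ?_
    rw [← mul_add]
    gcongr
    exact enorm_add_le _ _
  · exact (by fun_prop : Continuous fun s : ℝ => (1 + b * |s|) ^ n).measurable.ennreal_ofReal.mul
      hg.measurable.enorm

theorem symbolNorm_add_le (B : ℝ) (n : ℕ) {g h : ℝ → ℂ} (hg : Continuous g) :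
    symbolNorm B n (fun s => g s + h s) ≤ symbolNorm B n g + symbolNorm B n h := by
  rw [symbolNorm, symbolNorm, symbolNorm, ← lintegral_add_left]
  · refine lintegral_mono fun s => ?_
    rw [← mul_add]
    gcongr
    exact enorm_add_le _ _
  · exact (by fun_prop : Continuous fun s : ℝ => (B⁻¹ + |s|) ^ n).measurable.ennreal_ofReal.mul
      hg.measurable.enorm

theorem scaleNorm_mono {b b' : ℝ} (hb : 0 ≤ b) (h : b ≤ b') {m n : ℕ} (hmn : m ≤ n)
    (g : ℝ → ℂ) : scaleNorm b m g ≤ scaleNorm b' n g := by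
  refine lintegral_mono fun s => ?_
  have := abs_nonneg s
  have h1 : b * |s| ≤ b' * |s| := by gcongr
  have h0 : 0 ≤ b * |s| := by positivity
  gcongr ENNReal.ofReal ?_ * _
  calc (1 + b * |s|) ^ m ≤ (1 + b' * |s|) ^ m := by gcongr
    _ ≤ _ := pow_le_pow_right₀ (by linarith) hmn

/-- From `b (B⁻¹ + |s|) ≤ 1 + b|s|`: powers of `b` turn the weight of the symbol into one adapted to
a function varying at scale `b`. -/
theorem pow_mul_symbolNorm_le {b B : ℝ} (hb : 0 ≤ b) (hB : 0 < B) (hbB : b ≤ B) (n : ℕ)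
    (g : ℝ → ℂ) : ENNReal.ofReal (b ^ n) * symbolNorm B n g ≤ scaleNorm b n g := by
  rw [symbolNorm, ← lintegral_const_mul' _ _ ENNReal.ofReal_ne_top]
  refine lintegral_mono fun s => ?_
  rw [← mul_assoc, ← ENNReal.ofReal_mul (by positivity), ← mul_pow]
  have h1 : b * B⁻¹ ≤ 1 := by rw [← div_eq_mul_inv, div_le_one hB]; exact hbB
  gcongr
  rw [mul_add]
  gcongr

theorem symbolNorm_le {B : ℝ} (hB : 0 < B) (hB1 : B ≤ 1) (n : ℕ)
    (g : ℝ → ℂ) : symbolNorm B n g ≤ ENNReal.ofReal (B⁻¹ ^ n) * scaleNorm 1 n g := by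
  rw [scaleNorm, ← lintegral_const_mul' _ _ ENNReal.ofReal_ne_top]
  refine lintegral_mono fun s => ?_
  rw [← mul_assoc, ← ENNReal.ofReal_mul (by positivity), ← mul_pow]
  have h1 : 1 ≤ B⁻¹ := (one_le_inv₀ hB).2 hB1
  gcongr
  rw [mul_add, mul_one, one_mul]
  gcongr
  exact le_mul_of_one_le_left (abs_nonneg s) h1

/-- Two orders of decay beyond the weight leave `(1 + |s|)⁻² ≤ (1 + s²)⁻¹`, whose integral is `π`.
-/
theorem scaleNorm_le_of_decay {n : ℕ} {g : ℝ → ℂ} {M : ℝ} (hM : 0 ≤ M)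
    (h : ∀ s, ‖g s‖ ≤ M / (1 + |s|) ^ (n + 2)) :
    scaleNorm 1 n g ≤ ENNReal.ofReal (Real.pi * M) := by
  have hi : ∫⁻ s : ℝ, ENNReal.ofReal ((1 + s ^ 2)⁻¹) = ENNReal.ofReal Real.pi := by
    rw [← ofReal_integral_eq_lintegral_ofReal integrable_inv_one_add_sq
      (ae_of_all _ fun s => by positivity), integral_univ_inv_one_add_sq]
  rw [mul_comm, ENNReal.ofReal_mul hM, ← hi, ← lintegral_const_mul' _ _ ENNReal.ofReal_ne_top]
  refine lintegral_mono fun s => ?_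
  rw [← ofReal_norm, ← ENNReal.ofReal_mul (by positivity), ← ENNReal.ofReal_mul hM]
  refine ENNReal.ofReal_le_ofReal ?_
  have hp : 0 < 1 + |s| := by positivity
  calc (1 + 1 * |s|) ^ n * ‖g s‖ ≤ (1 + 1 * |s|) ^ n * (M / (1 + |s|) ^ (n + 2)) := by
        gcongr; exact h s
    _ = M * ((1 + |s|) ^ 2)⁻¹ := by
        rw [one_mul, pow_add]
        field_simp
    _ ≤ M * (1 + s ^ 2)⁻¹ := by
        gcongr
        rw [← sq_abs s]
        nlinarith [abs_nonneg s]

/-! ### Functions with a pole at distance `b` from the real line. -/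

/-- The singular factor `c₁ / (y - i b) + c₂ b / (y - i b)²`. -/
def singularFactor (c₁ c₂ : ℂ) (b y : ℝ) : ℂ :=
  c₁ / ((y : ℂ) - Complex.I * b) + c₂ * b / ((y : ℂ) - Complex.I * b) ^ 2

/-- The density of `singularFactor` as a one-sided Fourier-Laplace transform. -/
def laplaceDensity (c₁ c₂ : ℂ) (b t : ℝ) : ℂ :=
  (Complex.I * c₁ - c₂ * b * t) * Complex.exp (-(b : ℂ) * t)

theorem sub_I_mul_ne_zero {b : ℝ} (hb : b ≠ 0) (y : ℝ) : (y : ℂ) - Complex.I * b ≠ 0 := by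
  intro h
  have := congrArg Complex.im h
  simp at this
  exact hb this

theorem continuous_singularFactor (c₁ c₂ : ℂ) {b : ℝ} (hb : b ≠ 0) :
    Continuous (singularFactor c₁ c₂ b) := by
  unfold singularFactor
  have h := sub_I_mul_ne_zero hb
  refine Continuous.add (Continuous.div (by fun_prop) (by fun_prop) h)
    (Continuous.div (by fun_prop) (by fun_prop) fun y => pow_ne_zero 2 (h y))

/-- Substituting `y = (y - ib) + ib` shows that the family is stable under multiplication by `y`, up
to a constant and with a gain of a factor `b`. This gain matches the lower weights allowed for the
derivatives of the transform. -/
theorem mul_singularFactor (c₁ c₂ : ℂ) {b : ℝ} (hb : b ≠ 0) (y : ℝ) :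
    (y : ℂ) * singularFactor c₁ c₂ b y =
      c₁ + b * singularFactor (Complex.I * c₁ + c₂) (Complex.I * c₂) b y := by
  have h := sub_I_mul_ne_zero hb y
  unfold singularFactor
  field_simp
  ring

theorem norm_laplaceDensity_le (c₁ c₂ : ℂ) {b t : ℝ} (hb : 0 < b) (ht : 0 < t) :
    ‖laplaceDensity c₁ c₂ b t‖ ≤ (‖c₁‖ + ‖c₂‖) * ((1 + b * t) * Real.exp (-(b * t))) := by
  have h1 : ‖Complex.exp (-(b : ℂ) * t)‖ = Real.exp (-(b * t)) := by
    rw [Complex.norm_exp]; simp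
  rw [laplaceDensity, norm_mul, h1, ← mul_assoc]
  gcongr
  calc ‖Complex.I * c₁ - c₂ * b * t‖ ≤ ‖Complex.I * c₁‖ + ‖c₂ * b * t‖ := norm_sub_le _ _
    _ = ‖c₁‖ + ‖c₂‖ * (b * t) := by
      simp [abs_of_pos hb, abs_of_pos ht]; ring
    _ ≤ _ := by
      have := norm_nonneg c₁
      have := norm_nonneg c₂
      have h3 : 0 ≤ ‖c₁‖ * (b * t) := by positivity
      nlinarith

theorem integrableOn_laplaceDensity (c₁ c₂ : ℂ) {b : ℝ} (hb : 0 < b) :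
    IntegrableOn (laplaceDensity c₁ c₂ b) (Ioi 0) := by
  have h0 := integrableOn_pow_mul_exp_neg_mul 0 hb
  have h1 := integrableOn_pow_mul_exp_neg_mul 1 hb
  have h := Integrable.const_mul (Integrable.add h0 (Integrable.const_mul h1 b)) (‖c₁‖ + ‖c₂‖)
  refine h.mono' (by unfold laplaceDensity; exact (by fun_prop : Continuous _).aestronglyMeasurable)
    ?_
  filter_upwards [self_mem_ae_restrict measurableSet_Ioi] with t ht
  refine (norm_laplaceDensity_le c₁ c₂ hb ht).trans (le_of_eq ?_)
  simp only [Pi.add_apply]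
  ring_nf

/-- With `p = b + iy = i(y - ib)`, the functions `1/p` and `1/p²` are the Laplace transforms of `1`
and `t`. -/
theorem singularFactor_eq_integral (c₁ c₂ : ℂ) {b : ℝ} (hb : 0 < b) (y : ℝ) :
    singularFactor c₁ c₂ b y = ∫ t in Ioi (0 : ℝ),
      laplaceDensity c₁ c₂ b t * Complex.exp (-(Complex.I * (y : ℂ) * (t : ℂ))) := by
  set p : ℂ := b + Complex.I * y with hp
  have hpre : 0 < p.re := by simp [hp, hb]
  have hp0 : p ≠ 0 := fun h => by rw [h] at hpre; simp at hpre
  have e1 : ∫ t in Ioi (0 : ℝ), Complex.exp (-p * t) = 1 / p := by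
    rw [integral_exp_mul_complex_Ioi (by simpa using hpre)]
    simp
  have i1 : IntegrableOn (fun t : ℝ => Complex.exp (-p * t)) (Ioi 0) :=
    integrableOn_exp_mul_complex_Ioi (by simpa using hpre) 0
  have i2 : IntegrableOn (fun t : ℝ => (t : ℂ) * Complex.exp (-p * t)) (Ioi 0) := by
    have h1 := integrableOn_pow_mul_exp_neg_mul 1 hb
    refine Integrable.mono' h1 (by fun_prop : Continuous _).aestronglyMeasurable ?_
    filter_upwards [self_mem_ae_restrict measurableSet_Ioi] with t ht
    have ht' : (0 : ℝ) < t := ht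
    rw [norm_mul, Complex.norm_exp, Complex.norm_real, Real.norm_eq_abs, abs_of_pos ht', pow_one]
    simp [hp]
    ring_nf
    rfl
  have e2 : ∫ t in Ioi (0 : ℝ), (t : ℂ) * Complex.exp (-p * t) = 1 / p ^ 2 := by
    have hd : ∀ t : ℝ, HasDerivAt (fun t : ℝ => -(p⁻¹ * t + (p ^ 2)⁻¹) * Complex.exp (-p * t))
        ((t : ℂ) * Complex.exp (-p * t)) t := by
      intro t
      have h0 : HasDerivAt (fun t : ℝ => -p * (t : ℂ)) (-p) t := by
        simpa using (Complex.ofRealCLM.hasDerivAt (x := t)).const_mul (-p)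
      have h1 : HasDerivAt (fun t : ℝ => -(p⁻¹ * (t : ℂ) + (p ^ 2)⁻¹)) (-p⁻¹) t := by
        simpa using (((Complex.ofRealCLM.hasDerivAt (x := t)).const_mul p⁻¹).add_const
          ((p ^ 2)⁻¹)).fun_neg
      convert! h1.mul h0.cexp using 1
      field_simp
      ring
    have hF : IntegrableOn (fun t : ℝ => -(p⁻¹ * t + (p ^ 2)⁻¹) * Complex.exp (-p * t))
        (Ioi 0) := by
      refine ((Integrable.const_mul i2 (-p⁻¹)).add (Integrable.const_mul i1 (-(p ^ 2)⁻¹))).congr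
        (ae_of_all _ fun t => ?_)
      simp only [Pi.add_apply]
      ring
    have h := integral_Ioi_of_hasDerivAt_of_tendsto' (a := 0) (fun t _ => hd t) i2
      (tendsto_zero_of_hasDerivAt_of_integrableOn_Ioi (fun t _ => hd t) i2 hF)
    rw [h]
    simp
  have hcongr : ∀ t : ℝ, laplaceDensity c₁ c₂ b t *
      Complex.exp (-(Complex.I * (y : ℂ) * (t : ℂ))) =
      Complex.I * c₁ * Complex.exp (-p * t) - c₂ * b * ((t : ℂ) * Complex.exp (-p * t)) := by
    intro t
    rw [laplaceDensity, mul_assoc, ← Complex.exp_add,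
      show -(b : ℂ) * t + -(Complex.I * (y : ℂ) * (t : ℂ)) = -p * t by rw [hp]; ring]
    ring
  simp only [hcongr]
  rw [integral_sub (Integrable.const_mul i1 _) (Integrable.const_mul i2 _), integral_const_mul,
    integral_const_mul, e1, e2]
  have hu := sub_I_mul_ne_zero hb.ne' y
  have hpu : p = Complex.I * ((y : ℂ) - Complex.I * b) := by
    rw [hp, mul_sub, ← mul_assoc, Complex.I_mul_I]; ring
  rw [hpu, singularFactor, mul_pow, Complex.I_sq]
  have hI := Complex.I_ne_zero
  field_simp
  ring

/-- By Fubini, multiplying `Φ` by the transform of `ω` averages the translates `𝓕 Φ(s + t)` against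
`ω(t)`. -/
theorem enorm_fourierT_mul_le {Φ ω : ℝ → ℂ} (hΦ : Integrable Φ) (hω : IntegrableOn ω (Ioi 0))
    {q : ℝ → ℂ} (hq : ∀ y : ℝ, q y = ∫ t in Ioi (0 : ℝ),
      ω t * Complex.exp (-(Complex.I * (y : ℂ) * (t : ℂ)))) (s : ℝ) :
    ‖fourierT (fun y => Φ y * q y) s‖ₑ ≤ ∫⁻ t in Ioi (0 : ℝ), ‖ω t‖ₑ * ‖fourierT Φ (s + t)‖ₑ := by
  have hprod : Integrable (Function.uncurry fun y t : ℝ => (Φ y * ω t) *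
      Complex.exp (-(Complex.I * (y : ℂ) * ((s + t : ℝ) : ℂ))))
      (volume.prod (volume.restrict (Ioi 0))) := by
    have h := Integrable.mul_prod hΦ hω
    refine Integrable.mul_bdd (c := 1) h ?_ (ae_of_all _ fun z => ?_)
    · exact (by fun_prop : Continuous fun z : ℝ × ℝ =>
        Complex.exp (-(Complex.I * (z.1 : ℂ) * ((s + z.2 : ℝ) : ℂ)))).aestronglyMeasurable
    · exact (norm_cexp_neg_I_mul z.1 (s + z.2)).le
  have heq : fourierT (fun y => Φ y * q y) s =
      ∫ t in Ioi (0 : ℝ), ω t * fourierT Φ (s + t) := by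
    have h1 : fourierT (fun y => Φ y * q y) s = ∫ y, ∫ t in Ioi (0 : ℝ), (Φ y * ω t) *
      Complex.exp (-(Complex.I * (y : ℂ) * ((s + t : ℝ) : ℂ))) := by
      rw [fourierT]
      refine integral_congr_ae (ae_of_all _ fun y => ?_)
      simp only
      rw [hq, mul_comm (Φ y), mul_assoc, ← integral_mul_const]
      refine integral_congr_ae (ae_of_all _ fun t => ?_)
      simp only
      rw [show -(Complex.I * (y : ℂ) * ((s + t : ℝ) : ℂ)) =
        -(Complex.I * (y : ℂ) * (t : ℂ)) + -(Complex.I * (y : ℂ) * (s : ℂ)) by push_cast; ring,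
        Complex.exp_add]
      ring
    rw [h1, integral_integral_swap hprod]
    refine integral_congr_ae (ae_of_all _ fun t => ?_)
    simp only
    rw [fourierT, ← integral_const_mul]
    refine integral_congr_ae (ae_of_all _ fun y => ?_)
    simp only
    ring
  rw [heq]
  refine (enorm_integral_le_lintegral_enorm _).trans (le_of_eq ?_)
  simp only [enorm_mul]

/-- Half of the exponential absorbs the polynomial, by `x^m / m! ≤ e^x` at `x = (1 + bt)/2`; the
other half integrates to `2/b`. -/
theorem exists_lintegral_one_add_mul_pow_mul_exp_le (m : ℕ) : ∃ C : ℝ, 0 ≤ C ∧ ∀ b : ℝ, 0 < b →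
    ∫⁻ t in Ioi (0 : ℝ), ENNReal.ofReal ((1 + b * t) ^ m * Real.exp (-(b * t))) ≤
      ENNReal.ofReal (C * b⁻¹) := by
  refine ⟨2 ^ m * m.factorial * Real.exp (1 / 2) * 2, by positivity, fun b hb => ?_⟩
  have hi := integrableOn_pow_mul_exp_neg_mul 0 (r := b / 2) (by positivity)
  have hI := integral_pow_mul_exp_neg_mul 0 (r := b / 2) (by positivity)
  have hl : ∫⁻ t in Ioi (0 : ℝ), ENNReal.ofReal (t ^ 0 * Real.exp (-t * (b / 2))) =
      ENNReal.ofReal (2 * b⁻¹) := by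
    rw [← ofReal_integral_eq_lintegral_ofReal hi (ae_of_all _ fun t => by positivity), hI]
    congr 1
    simp
    ring
  rw [mul_assoc, ENNReal.ofReal_mul (by positivity), ← hl,
    ← lintegral_const_mul' _ _ ENNReal.ofReal_ne_top]
  refine setLIntegral_mono' measurableSet_Ioi fun t ht => ?_
  have ht' : (0 : ℝ) < t := ht
  rw [← ENNReal.ofReal_mul (by positivity)]
  refine ENNReal.ofReal_le_ofReal ?_
  have h := Real.pow_div_factorial_le_exp ((1 + b * t) / 2) (by positivity) m
  rw [div_le_iff₀ (by positivity), div_pow, div_le_iff₀ (by positivity)] at h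
  calc (1 + b * t) ^ m * Real.exp (-(b * t)) ≤
      (Real.exp ((1 + b * t) / 2) * m.factorial * 2 ^ m) * Real.exp (-(b * t)) := by gcongr
    _ = 2 ^ m * m.factorial * (Real.exp ((1 + b * t) / 2) * Real.exp (-(b * t))) := by ring
    _ = 2 ^ m * m.factorial * (Real.exp (1 / 2) * Real.exp (-t * (b / 2))) := by
      rw [← Real.exp_add, ← Real.exp_add]; ring_nf
    _ = _ := by ring

/-- After the translation `r = s + t`, the weight splits as `(1 + b|r - t|)^n ≤ (1 + bt)^n (1 +
|r|)^n`, using `b ≤ 1`. The loss `b⁻¹` is the `L¹` norm of the density. -/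
theorem exists_scaleNorm_singular_le (n : ℕ) : ∃ C : ℝ, 0 ≤ C ∧ ∀ b : ℝ, 0 < b → b ≤ 1 →
    ∀ Φ : ℝ → ℂ, Integrable Φ → ∀ c₁ c₂ : ℂ,
    scaleNorm b n (fourierT fun y => Φ y * singularFactor c₁ c₂ b y) ≤
      ENNReal.ofReal (C * (‖c₁‖ + ‖c₂‖) * b⁻¹) * scaleNorm 1 n (fourierT Φ) := by
  -- The exponent is `n` from moving the weight, plus `1` from the polynomial factor of the density.
  obtain ⟨C, hC, h⟩ := exists_lintegral_one_add_mul_pow_mul_exp_le (n + 1)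
  refine ⟨C, hC, fun b hb hb1 Φ hΦ c₁ c₂ => ?_⟩
  have hω := integrableOn_laplaceDensity c₁ c₂ hb
  have cF := continuous_fourierT hΦ
  have cω : Continuous (laplaceDensity c₁ c₂ b) := by unfold laplaceDensity; fun_prop
  have hmeas : Measurable (Function.uncurry fun s t : ℝ => ENNReal.ofReal ((1 + b * |s|) ^ n) *
      (‖laplaceDensity c₁ c₂ b t‖ₑ * ‖fourierT Φ (s + t)‖ₑ)) := by
    have m1 : Measurable fun z : ℝ × ℝ => ENNReal.ofReal ((1 + b * |z.1|) ^ n) :=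
      (by fun_prop : Continuous fun z : ℝ × ℝ => (1 + b * |z.1|) ^ n).measurable.ennreal_ofReal
    have m2 : Measurable fun z : ℝ × ℝ => ‖laplaceDensity c₁ c₂ b z.2‖ₑ :=
      (cω.comp continuous_snd).measurable.enorm
    have m3 : Measurable fun z : ℝ × ℝ => ‖fourierT Φ (z.1 + z.2)‖ₑ :=
      (by fun_prop : Continuous fun z : ℝ × ℝ => fourierT Φ (z.1 + z.2)).measurable.enorm
    exact m1.mul (m2.mul m3)
  calc scaleNorm b n (fourierT fun y => Φ y * singularFactor c₁ c₂ b y)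
      ≤ ∫⁻ s, ∫⁻ t in Ioi (0 : ℝ), ENNReal.ofReal ((1 + b * |s|) ^ n) *
        (‖laplaceDensity c₁ c₂ b t‖ₑ * ‖fourierT Φ (s + t)‖ₑ) := by
        refine lintegral_mono fun s => ?_
        simp only
        rw [lintegral_const_mul' _ _ ENNReal.ofReal_ne_top]
        gcongr
        exact enorm_fourierT_mul_le hΦ hω (singularFactor_eq_integral c₁ c₂ hb) s
    _ = ∫⁻ t in Ioi (0 : ℝ), ∫⁻ s, ENNReal.ofReal ((1 + b * |s|) ^ n) *
        (‖laplaceDensity c₁ c₂ b t‖ₑ * ‖fourierT Φ (s + t)‖ₑ) :=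
        lintegral_lintegral_swap hmeas.aemeasurable
    _ ≤ ∫⁻ t in Ioi (0 : ℝ), ENNReal.ofReal (‖c₁‖ + ‖c₂‖) *
        ENNReal.ofReal ((1 + b * t) ^ (n + 1) * Real.exp (-(b * t))) *
          scaleNorm 1 n (fourierT Φ) := by
        refine setLIntegral_mono' measurableSet_Ioi fun t ht => ?_
        have ht' : (0 : ℝ) < t := ht
        rw [← lintegral_sub_right_eq_self _ t, scaleNorm, ← lintegral_const_mul' _ _ (by finiteness)]
        refine lintegral_mono fun r => ?_
        have e : r - t + t = r := by ring
        have hd : ‖laplaceDensity c₁ c₂ b t‖ₑ ≤ ENNReal.ofReal (‖c₁‖ + ‖c₂‖) *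
            ENNReal.ofReal ((1 + b * t) * Real.exp (-(b * t))) := by
          rw [← ofReal_norm, ← ENNReal.ofReal_mul (by positivity)]
          exact ENNReal.ofReal_le_ofReal (norm_laplaceDensity_le c₁ c₂ hb ht')
        have hw : (1 + b * |r - t|) ^ n ≤ (1 + b * t) ^ n * (1 + 1 * |r|) ^ n := by
          rw [← mul_pow]
          gcongr
          have h1 : |r - t| ≤ |r| + t := by
            simpa [abs_of_pos ht'] using abs_sub r t
          have h2 : b * |r - t| ≤ b * (|r| + t) := by gcongr
          have h3 : b * |r| ≤ 1 * |r| := by gcongr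
          have h4 : 0 ≤ b * t * (1 * |r|) := by positivity
          linarith
        rw [e]
        calc _ ≤ ENNReal.ofReal ((1 + b * t) ^ n * (1 + 1 * |r|) ^ n) *
              (ENNReal.ofReal (‖c₁‖ + ‖c₂‖) *
            ENNReal.ofReal ((1 + b * t) * Real.exp (-(b * t))) * ‖fourierT Φ r‖ₑ) := by
              gcongr
          _ = _ := by
            rw [ENNReal.ofReal_mul (by positivity), pow_succ, mul_assoc ((1 + b * t) ^ n),
              ENNReal.ofReal_mul (p := (1 + b * t) ^ n) (by positivity)]
            ring
    _ = ENNReal.ofReal (‖c₁‖ + ‖c₂‖) * (∫⁻ t in Ioi (0 : ℝ),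
        ENNReal.ofReal ((1 + b * t) ^ (n + 1) * Real.exp (-(b * t)))) *
          scaleNorm 1 n (fourierT Φ) := by
        rw [lintegral_mul_const, lintegral_const_mul]
        · fun_prop
        · fun_prop
    _ ≤ ENNReal.ofReal (‖c₁‖ + ‖c₂‖) * ENNReal.ofReal (C * b⁻¹) *
          scaleNorm 1 n (fourierT Φ) := by
        gcongr
        exact h b hb
    _ = _ := by
        rw [← ENNReal.ofReal_mul (by positivity)]
        congr 2
        ring

/-- At a single frequency the sup norm of the density can be used in place of its `L¹` norm, so no
`b⁻¹` is lost: `(1 + bt) e^{-bt} ≤ 1`. -/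
theorem enorm_fourierT_singular_zero_le {b : ℝ} (hb : 0 < b) {Φ : ℝ → ℂ} (hΦ : Integrable Φ)
    (c₁ c₂ : ℂ) (n : ℕ) : ‖fourierT (fun y => Φ y * singularFactor c₁ c₂ b y) 0‖ₑ ≤
      ENNReal.ofReal (‖c₁‖ + ‖c₂‖) * scaleNorm 1 n (fourierT Φ) := by
  refine (enorm_fourierT_mul_le hΦ (integrableOn_laplaceDensity c₁ c₂ hb)
    (singularFactor_eq_integral c₁ c₂ hb) 0).trans ?_
  rw [scaleNorm, ← lintegral_const_mul' _ _ ENNReal.ofReal_ne_top]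
  refine le_trans ?_ (setLIntegral_le_lintegral (Ioi 0) _)
  refine setLIntegral_mono' measurableSet_Ioi fun t ht => ?_
  have ht' : (0 : ℝ) < t := ht
  rw [zero_add]
  gcongr
  · rw [← ofReal_norm]
    refine ENNReal.ofReal_le_ofReal ((norm_laplaceDensity_le c₁ c₂ hb ht').trans ?_)
    refine mul_le_of_le_one_right (by positivity) ?_
    rw [Real.exp_neg, ← div_eq_mul_inv, div_le_one (Real.exp_pos _), add_comm]
    exact Real.add_one_le_exp _
  · rw [← one_mul ‖fourierT Φ t‖ₑ]
    gcongr
    · rw [← ENNReal.ofReal_one]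
      refine ENNReal.ofReal_le_ofReal (one_le_pow₀ ?_)
      have := abs_nonneg t
      linarith
    · rw [one_mul]

theorem mul_norm_le_of_enorm_le {a r : ℝ} (ha : 0 ≤ a) (hr : 0 ≤ r) {z : ℂ}
    (h : ENNReal.ofReal a * ‖z‖ₑ ≤ ENNReal.ofReal r) : a * ‖z‖ ≤ r := by
  rw [← ofReal_norm, ← ENNReal.ofReal_mul ha] at h
  exact (ENNReal.ofReal_le_ofReal_iff hr).1 h

/-! ### Decay of `𝒦 f` for smooth and for singular `f`. -/

/-- The operator `𝒦` on functions whose transform decays fast at unit scale. -/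
theorem exists_opK_smooth_bound (k : ℕ) : ∃ C : ℝ, 0 ≤ C ∧ ∀ B : ℝ, 0 < B → B ≤ 1 →
    ∀ f : ℝ → ℂ, Continuous f → HasCompactSupport f → ∀ M : ℝ, 0 ≤ M →
    scaleNorm 1 (k + 2) (fourierT f) ≤ ENNReal.ofReal M →
    scaleNorm 1 (k + 2) (fourierT fun x => (x : ℂ) * f x) ≤ ENNReal.ofReal M →
    scaleNorm 1 (k + 2) (fourierT fun x => (x : ℂ) * ((x : ℂ) * f x)) ≤ ENNReal.ofReal M →
    ‖fourierT f 0‖ ≤ M →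
    Integrable (fun s => symbolK k B s * fourierT f s) ∧
    ∀ y : ℝ, (1 + y ^ 2) * ‖opK k B f y‖ ≤ C * M * B⁻¹ ^ (k + 2) := by
  obtain ⟨C, hC, h⟩ := exists_opK_bound k
  -- One term from the sup bound and four from the bound for `y²`.
  refine ⟨5 * C, by positivity, fun B hB hB1 f cf sf M hM m0 m1 m2 mz => ?_⟩
  have key : ∀ {n : ℕ} {g : ℝ → ℂ}, n ≤ k + 2 → scaleNorm 1 (k + 2) g ≤ ENNReal.ofReal M →
      symbolNorm B n g ≤ ENNReal.ofReal (B⁻¹ ^ (k + 2) * M) := by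
    intro n g hn hg
    rw [ENNReal.ofReal_mul (by positivity)]
    exact (symbolNorm_mono_exponent hB hB1 hn g).trans
      ((symbolNorm_le hB hB1 (k + 2) g).trans (by gcongr))
  have ft : ENNReal.ofReal (B⁻¹ ^ (k + 2) * M) < ∞ := ENNReal.ofReal_lt_top
  obtain ⟨hi, hb⟩ := h B hB hB1 f cf sf ((key le_rfl m0).trans_lt ft)
    ((key le_rfl m1).trans_lt ft) ((key le_rfl m2).trans_lt ft)
  refine ⟨hi, fun y => ?_⟩
  have hz : ENNReal.ofReal (B⁻¹ ^ (k + 1)) * ‖fourierT f 0‖ₑ ≤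
      ENNReal.ofReal (B⁻¹ ^ (k + 2) * M) := by
    rw [← ofReal_norm, ← ENNReal.ofReal_mul (by positivity)]
    have : 1 ≤ B⁻¹ := (one_le_inv₀ hB).2 hB1
    gcongr
    norm_num
  have hMB : 0 ≤ B⁻¹ ^ (k + 2) * M := by positivity
  refine mul_norm_le_of_enorm_le (by positivity) (by positivity) ?_
  rw [ENNReal.ofReal_add zero_le_one (by positivity), ENNReal.ofReal_one, add_mul, one_mul]
  calc _ ≤ ENNReal.ofReal C * ENNReal.ofReal (B⁻¹ ^ (k + 2) * M) + ENNReal.ofReal C *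
        (ENNReal.ofReal (B⁻¹ ^ (k + 2) * M) + ENNReal.ofReal (B⁻¹ ^ (k + 2) * M) +
          ENNReal.ofReal (B⁻¹ ^ (k + 2) * M) + ENNReal.ofReal (B⁻¹ ^ (k + 2) * M)) := by
        refine add_le_add ((hb y).1.trans ?_) ((hb y).2.trans ?_)
        · gcongr
          exact key le_rfl m0
        · gcongr
          exacts [key (by omega) m0, key (by omega) m1, key le_rfl m2]
    _ = ENNReal.ofReal (5 * C * M * B⁻¹ ^ (k + 2)) := by
        rw [← ENNReal.ofReal_add hMB hMB, ← ENNReal.ofReal_add (by positivity) hMB,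
          ← ENNReal.ofReal_add (by positivity) hMB, ← ENNReal.ofReal_mul hC,
          ← ENNReal.ofReal_mul hC, ← ENNReal.ofReal_add (by positivity) (by positivity)]
        congr 1
        ring

theorem fourierT_mul_singular {Φ : ℝ → ℂ} (cΦ : Continuous Φ) (sΦ : HasCompactSupport Φ)
    (c₁ c₂ : ℂ) {b : ℝ} (hb : b ≠ 0) :
    (fourierT fun y => (y : ℂ) * (Φ y * singularFactor c₁ c₂ b y)) = fun s =>
      c₁ * fourierT Φ s +
        b * fourierT (fun y => Φ y * singularFactor (Complex.I * c₁ + c₂) (Complex.I * c₂) b y)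
          s := by
  funext s
  have cs := continuous_singularFactor (Complex.I * c₁ + c₂) (Complex.I * c₂) hb
  have i1 : Integrable fun y => c₁ * Φ y :=
    (cΦ.integrable_of_hasCompactSupport sΦ).const_mul c₁
  have i2 : Integrable fun y =>
      (b : ℂ) * (Φ y * singularFactor (Complex.I * c₁ + c₂) (Complex.I * c₂) b y) :=
    ((by fun_prop : Continuous fun y => Φ y * singularFactor (Complex.I * c₁ + c₂)
      (Complex.I * c₂) b y).integrable_of_hasCompactSupport sΦ.mul_right).const_mul _
  rw [← fourierT_const_mul, ← fourierT_const_mul, ← fourierT_add i1 i2]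
  congr 1
  funext y
  rw [mul_left_comm, mul_singularFactor c₁ c₂ hb]
  ring

/-- The operator `𝒦` on functions with a singularity at distance `b` from the real line. -/
theorem exists_opK_singular_bound (k : ℕ) : ∃ C : ℝ, 0 ≤ C ∧ ∀ b B : ℝ, 0 < b → b ≤ B → B ≤ 1 →
    ∀ Φ : ℝ → ℂ, Continuous Φ → HasCompactSupport Φ → ∀ M : ℝ, 0 ≤ M →
    scaleNorm 1 (k + 2) (fourierT Φ) ≤ ENNReal.ofReal M →
    scaleNorm 1 (k + 2) (fourierT fun x => (x : ℂ) * Φ x) ≤ ENNReal.ofReal M →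
    ∀ c₁ c₂ : ℂ,
    Integrable (fun s => symbolK k B s *
      fourierT (fun x => Φ x * singularFactor c₁ c₂ b x) s) ∧
    ∀ y : ℝ, b ^ (k + 2) * (y ^ 2 + b ^ 2) *
      ‖opK k B (fun x => Φ x * singularFactor c₁ c₂ b x) y‖ ≤
        C * (‖c₁‖ + ‖c₂‖) * M * (b * B⁻¹) := by
  obtain ⟨C, hC, h⟩ := exists_opK_bound k
  obtain ⟨D, hD, hS⟩ := exists_scaleNorm_singular_le (k + 2)
  -- `7D + 5` bounds the part with `y²` (`U1` below) and `D` the part with `b²` (`U0`).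
  refine ⟨C * (8 * D + 5), by positivity, fun b B hb hbB hB1 Φ cΦ sΦ M hM m0 m1 c₁ c₂ => ?_⟩
  have hB : 0 < B := hb.trans_le hbB
  have hb1 : b ≤ 1 := hbB.trans hB1
  have hBi : 1 ≤ B⁻¹ := (one_le_inv₀ hB).2 hB1
  have iΦ : Integrable Φ := cΦ.integrable_of_hasCompactSupport sΦ
  have iΦ1 : Integrable fun x : ℝ => (x : ℂ) * Φ x :=
    (by fun_prop : Continuous _).integrable_of_hasCompactSupport sΦ.mul_left
  have cs : ∀ d₁ d₂, Continuous (singularFactor d₁ d₂ b) :=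
    fun d₁ d₂ => continuous_singularFactor d₁ d₂ hb.ne'
  have is : ∀ d₁ d₂, Integrable fun x => Φ x * singularFactor d₁ d₂ b x := fun d₁ d₂ =>
    (cΦ.mul (cs d₁ d₂)).integrable_of_hasCompactSupport sΦ.mul_right
  have S : ∀ d₁ d₂ : ℂ, ∀ σ : ℝ, ‖d₁‖ + ‖d₂‖ ≤ σ →
      scaleNorm b (k + 2) (fourierT fun y => Φ y * singularFactor d₁ d₂ b y) ≤
        ENNReal.ofReal (D * σ * M * b⁻¹) := by
    intro d₁ d₂ σ hσ
    refine (hS b hb hb1 Φ iΦ d₁ d₂).trans ?_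
    calc _ ≤ ENNReal.ofReal (D * (‖d₁‖ + ‖d₂‖) * b⁻¹) * ENNReal.ofReal M := by gcongr
      _ = ENNReal.ofReal (D * (‖d₁‖ + ‖d₂‖) * M * b⁻¹) := by
        rw [← ENNReal.ofReal_mul (by positivity)]; congr 1; ring
      _ ≤ _ := by gcongr
  set σ := ‖c₁‖ + ‖c₂‖ with hσ
  have n1 := norm_nonneg c₁
  have n2 := norm_nonneg c₂
  have hσ0 : 0 ≤ σ := by positivity
  -- The coefficients after one multiplication by `y`. Their total size at most doubles each time,
  -- which gives `σ`, `2σ`, `4σ`.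
  set d₁ := Complex.I * c₁ + c₂ with hd₁
  set d₂ := Complex.I * c₂ with hd₂
  have hd₁σ : ‖d₁‖ ≤ σ := (norm_add_le _ _).trans (by simp [hσ])
  have hd₂σ : ‖d₂‖ ≤ σ := by simp [hd₂, hσ]
  have hdσ : ‖d₁‖ + ‖d₂‖ ≤ 2 * σ := by linarith
  have heσ : ‖Complex.I * d₁ + d₂‖ + ‖Complex.I * d₂‖ ≤ 4 * σ := by
    have := norm_add_le (Complex.I * d₁) d₂
    simp only [norm_mul, Complex.norm_I, one_mul] at this ⊢
    linarith
  have s0 := S c₁ c₂ σ le_rfl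
  have s1 := S d₁ d₂ (2 * σ) hdσ
  have s2 := S (Complex.I * d₁ + d₂) (Complex.I * d₂) (4 * σ) heσ
  have e1 := fourierT_mul_singular cΦ sΦ c₁ c₂ hb.ne'
  have e2 : (fourierT fun y => (y : ℂ) * ((y : ℂ) * (Φ y * singularFactor c₁ c₂ b y))) = fun s =>
      c₁ * fourierT (fun y => (y : ℂ) * Φ y) s + b * (d₁ * fourierT Φ s + b *
        fourierT (fun y => Φ y * singularFactor (Complex.I * d₁ + d₂) (Complex.I * d₂) b y) s) := by
    have h1 := fourierT_mul_singular (Φ := fun y => (y : ℂ) * Φ y) (by fun_prop) sΦ.mul_left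
      c₁ c₂ hb.ne'
    have h2 := fourierT_mul_singular cΦ sΦ d₁ d₂ hb.ne'
    simp only [mul_assoc] at h1
    rw [h1]
    funext s
    rw [← congrFun h2 s]
  have enb : ‖(b : ℂ)‖ₑ = ENNReal.ofReal b := by
    rw [← ofReal_norm]; simp [abs_of_pos hb]
  have T0 : ENNReal.ofReal (b ^ (k + 2)) *
      symbolNorm B (k + 2) (fourierT fun y => Φ y * singularFactor c₁ c₂ b y) ≤
      ENNReal.ofReal (D * σ * M * b⁻¹) :=
    (pow_mul_symbolNorm_le hb.le hB hbB _ _).trans s0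
  have T1 : ENNReal.ofReal (b ^ (k + 2)) *
      symbolNorm B k (fourierT fun y => Φ y * singularFactor c₁ c₂ b y) ≤
      ENNReal.ofReal (D * σ * M * b) := by
    calc _ = ENNReal.ofReal (b ^ 2) * (ENNReal.ofReal (b ^ k) *
          symbolNorm B k (fourierT fun y => Φ y * singularFactor c₁ c₂ b y)) := by
          rw [← mul_assoc, ← ENNReal.ofReal_mul (by positivity)]; ring_nf
      _ ≤ ENNReal.ofReal (b ^ 2) * ENNReal.ofReal (D * σ * M * b⁻¹) := by
          gcongr
          exact (pow_mul_symbolNorm_le hb.le hB hbB _ _).trans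
            ((scaleNorm_mono hb.le le_rfl (by omega) _).trans s0)
      _ = _ := by
          rw [← ENNReal.ofReal_mul (by positivity)]
          congr 1
          field_simp
  have mb : scaleNorm b (k + 2) (fourierT Φ) ≤ ENNReal.ofReal M :=
    (scaleNorm_mono hb.le hb1 le_rfl _).trans m0
  have c0' := continuous_fourierT iΦ
  have c1' := continuous_fourierT iΦ1
  have T2' : scaleNorm b (k + 2)
      (fourierT fun y => (y : ℂ) * (Φ y * singularFactor c₁ c₂ b y)) ≤
      ENNReal.ofReal (σ * M + 2 * D * σ * M) := by
    rw [e1]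
    refine (scaleNorm_add_le b (k + 2) (by fun_prop)).trans ?_
    rw [scaleNorm_const_mul, scaleNorm_const_mul, enb, ENNReal.ofReal_add (by positivity)
      (by positivity)]
    refine add_le_add ?_ ?_
    · rw [ENNReal.ofReal_mul hσ0, ← ofReal_norm]
      gcongr
      linarith
    · calc _ ≤ ENNReal.ofReal b * ENNReal.ofReal (D * (2 * σ) * M * b⁻¹) := by gcongr
        _ = _ := by
          rw [← ENNReal.ofReal_mul hb.le]
          congr 1
          field_simp
  have T2 : ENNReal.ofReal (b ^ (k + 2)) *
      symbolNorm B (k + 1) (fourierT fun y => (y : ℂ) * (Φ y * singularFactor c₁ c₂ b y)) ≤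
      ENNReal.ofReal (b * (σ * M + 2 * D * σ * M)) := by
    calc _ = ENNReal.ofReal b * (ENNReal.ofReal (b ^ (k + 1)) * symbolNorm B (k + 1)
          (fourierT fun y => (y : ℂ) * (Φ y * singularFactor c₁ c₂ b y))) := by
          rw [← mul_assoc, ← ENNReal.ofReal_mul (by positivity)]; ring_nf
      _ ≤ ENNReal.ofReal b * ENNReal.ofReal (σ * M + 2 * D * σ * M) := by
          gcongr
          exact (pow_mul_symbolNorm_le hb.le hB hbB _ _).trans
            ((scaleNorm_mono hb.le le_rfl (by omega) _).trans T2')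
      _ = _ := by rw [← ENNReal.ofReal_mul (by positivity)]
  have hpow : ∀ n : ℕ, (b * B⁻¹) ^ (n + 1) ≤ b * B⁻¹ := fun n => by
    have h1 : b * B⁻¹ ≤ 1 := by rw [← div_eq_mul_inv, div_le_one hB]; exact hbB
    exact pow_le_of_le_one (by positivity) h1 (by omega)
  -- Here the weight uses all of `b^(k+2)`. The pole-free term `c₁ 𝓕(yΦ)` carries no factor `b`, so
  -- it is measured at unit scale, where it costs `(b/B)^(k+2) ≤ b/B`. The remaining terms carry the
  -- explicit `b`.
  have T3 : ENNReal.ofReal (b ^ (k + 2)) * symbolNorm B (k + 2)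
      (fourierT fun y => (y : ℂ) * ((y : ℂ) * (Φ y * singularFactor c₁ c₂ b y))) ≤
      ENNReal.ofReal (σ * M * (b * B⁻¹) + b * (σ * M + 4 * D * σ * M)) := by
    have a1 : ENNReal.ofReal (b ^ (k + 2)) *
        symbolNorm B (k + 2) (fun s => c₁ * fourierT (fun y => (y : ℂ) * Φ y) s) ≤
        ENNReal.ofReal (σ * M * (b * B⁻¹)) := by
      rw [symbolNorm_const_mul]
      calc _ ≤ ENNReal.ofReal (b ^ (k + 2)) * (ENNReal.ofReal σ *
            (ENNReal.ofReal (B⁻¹ ^ (k + 2)) * ENNReal.ofReal M)) := by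
            gcongr
            · rw [← ofReal_norm]; gcongr; linarith
            · exact (symbolNorm_le hB hB1 _ _).trans (by gcongr)
        _ = ENNReal.ofReal (σ * M * (b * B⁻¹) ^ (k + 2)) := by
            rw [← ENNReal.ofReal_mul (by positivity), ← ENNReal.ofReal_mul (by positivity),
              ← ENNReal.ofReal_mul (by positivity), mul_pow]
            congr 1
            ring
        _ ≤ _ := by
            gcongr
            exact hpow (k + 1)
    have a2 : scaleNorm b (k + 2) (fun s => d₁ * fourierT Φ s + b *
        fourierT (fun y => Φ y * singularFactor (Complex.I * d₁ + d₂) (Complex.I * d₂) b y) s) ≤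
        ENNReal.ofReal (σ * M + 4 * D * σ * M) := by
      refine (scaleNorm_add_le b (k + 2) (by fun_prop)).trans ?_
      rw [scaleNorm_const_mul, scaleNorm_const_mul, enb, ENNReal.ofReal_add (by positivity)
        (by positivity)]
      refine add_le_add ?_ ?_
      · rw [ENNReal.ofReal_mul hσ0, ← ofReal_norm]
        gcongr
      · calc _ ≤ ENNReal.ofReal b * ENNReal.ofReal (D * (4 * σ) * M * b⁻¹) := by gcongr
          _ = _ := by
            rw [← ENNReal.ofReal_mul hb.le]
            congr 1
            field_simp
    rw [e2, ENNReal.ofReal_add (by positivity) (by positivity)]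
    calc _ ≤ ENNReal.ofReal (b ^ (k + 2)) *
          (symbolNorm B (k + 2) (fun s => c₁ * fourierT (fun y => (y : ℂ) * Φ y) s) +
            symbolNorm B (k + 2) (fun s => (b : ℂ) * (d₁ * fourierT Φ s + b *
        fourierT (fun y => Φ y * singularFactor (Complex.I * d₁ + d₂) (Complex.I * d₂) b y) s))) := by
          gcongr
          exact symbolNorm_add_le B (k + 2) (by fun_prop)
      _ ≤ _ := by
          rw [mul_add, symbolNorm_const_mul B (k + 2) (b : ℂ), enb]
          refine add_le_add a1 ?_
          rw [mul_left_comm, ENNReal.ofReal_mul hb.le]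
          gcongr
          exact (pow_mul_symbolNorm_le hb.le hB hbB _ _).trans a2
  have T4 : ENNReal.ofReal (b ^ (k + 2)) * (ENNReal.ofReal (B⁻¹ ^ (k + 1)) *
      ‖fourierT (fun y => Φ y * singularFactor c₁ c₂ b y) 0‖ₑ) ≤
      ENNReal.ofReal (σ * M * (b * B⁻¹)) := by
    calc _ ≤ ENNReal.ofReal (b ^ (k + 2)) * (ENNReal.ofReal (B⁻¹ ^ (k + 1)) *
          (ENNReal.ofReal σ * ENNReal.ofReal M)) := by
          gcongr
          exact (enorm_fourierT_singular_zero_le hb iΦ c₁ c₂ (k + 2)).trans (by gcongr)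
      _ = ENNReal.ofReal (σ * M * ((b * B⁻¹) ^ (k + 1) * b)) := by
          rw [← ENNReal.ofReal_mul (by positivity), ← ENNReal.ofReal_mul (by positivity),
              ← ENNReal.ofReal_mul (by positivity), mul_pow]
          congr 1
          ring
      _ ≤ _ := by
          refine ENNReal.ofReal_le_ofReal (mul_le_mul_of_nonneg_left ?_ (by positivity))
          exact (mul_le_of_le_one_right (by positivity) hb1).trans (hpow k)
  have fin : ∀ {x : ℝ≥0∞} {r : ℝ}, ENNReal.ofReal (b ^ (k + 2)) * x ≤ ENNReal.ofReal r →
      x < ∞ := by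
    intro x r hx
    have hne : ENNReal.ofReal (b ^ (k + 2)) ≠ 0 := by
      simpa using (by positivity : 0 < b ^ (k + 2))
    exact ENNReal.lt_top_of_mul_ne_top_right (hx.trans_lt ENNReal.ofReal_lt_top).ne hne
  have T2f : symbolNorm B (k + 2) (fourierT fun y => (y : ℂ) * (Φ y * singularFactor c₁ c₂ b y)) <
      ∞ := fin ((pow_mul_symbolNorm_le hb.le hB hbB _ _).trans T2')
  obtain ⟨hi, hbd⟩ := h B hB hB1 (fun x => Φ x * singularFactor c₁ c₂ b x) (cΦ.mul (cs _ _))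
    sΦ.mul_right (fin T0) T2f (fin T3)
  refine ⟨hi, fun y => ?_⟩
  refine mul_norm_le_of_enorm_le (by positivity) (by positivity) ?_
  have hbb : b ≤ b * B⁻¹ := le_mul_of_one_le_right hb.le hBi
  have U1 : ENNReal.ofReal (b ^ (k + 2)) * (ENNReal.ofReal (y ^ 2) *
      ‖opK k B (fun x => Φ x * singularFactor c₁ c₂ b x) y‖ₑ) ≤
      ENNReal.ofReal (C * (7 * D + 5) * σ * M * (b * B⁻¹)) := by
    refine (mul_le_mul_right (hbd y).2 _).trans ?_
    rw [mul_left_comm]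
    calc _ ≤ ENNReal.ofReal C * (ENNReal.ofReal (D * σ * M * b) +
          ENNReal.ofReal (b * (σ * M + 2 * D * σ * M)) +
          ENNReal.ofReal (σ * M * (b * B⁻¹) + b * (σ * M + 4 * D * σ * M)) +
          ENNReal.ofReal (σ * M * (b * B⁻¹))) := by
          refine mul_le_mul_right ?_ _
          rw [mul_add, mul_add, mul_add]
          exact add_le_add (add_le_add (add_le_add T1 T2) T3) T4
      _ = ENNReal.ofReal (C * (D * σ * M * b + b * (σ * M + 2 * D * σ * M) +
          (σ * M * (b * B⁻¹) + b * (σ * M + 4 * D * σ * M)) + σ * M * (b * B⁻¹))) := by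
          rw [← ENNReal.ofReal_add (by positivity) (by positivity),
            ← ENNReal.ofReal_add (by positivity) (by positivity),
            ← ENNReal.ofReal_add (by positivity) (by positivity), ← ENNReal.ofReal_mul hC]
      _ ≤ _ := by
          refine ENNReal.ofReal_le_ofReal ?_
          have h1 : (7 * D * σ * M + 2 * σ * M) * b ≤ (7 * D * σ * M + 2 * σ * M) * (b * B⁻¹) := by
            gcongr
          have h2 : 0 ≤ σ * M * (b * B⁻¹) := by positivity
          calc _ ≤ C * ((7 * D + 5) * σ * M * (b * B⁻¹)) :=
                mul_le_mul_of_nonneg_left (by linarith) hC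
            _ = _ := by ring
  have U0 : ENNReal.ofReal (b ^ (k + 2)) * (ENNReal.ofReal (b ^ 2) *
      ‖opK k B (fun x => Φ x * singularFactor c₁ c₂ b x) y‖ₑ) ≤
      ENNReal.ofReal (C * D * σ * M * (b * B⁻¹)) := by
    calc _ ≤ ENNReal.ofReal (b ^ (k + 2)) * (ENNReal.ofReal (b ^ 2) * (ENNReal.ofReal C *
          symbolNorm B (k + 2) (fourierT fun y => Φ y * singularFactor c₁ c₂ b y))) := by
          gcongr
          exact (hbd y).1
      _ = ENNReal.ofReal (b ^ 2) * (ENNReal.ofReal C * (ENNReal.ofReal (b ^ (k + 2)) *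
          symbolNorm B (k + 2) (fourierT fun y => Φ y * singularFactor c₁ c₂ b y))) := by ring
      _ ≤ ENNReal.ofReal (b ^ 2) * (ENNReal.ofReal C * ENNReal.ofReal (D * σ * M * b⁻¹)) := by
          gcongr
      _ = ENNReal.ofReal (C * D * σ * M * b) := by
          rw [← ENNReal.ofReal_mul hC, ← ENNReal.ofReal_mul (by positivity)]
          congr 1
          field_simp
      _ ≤ _ := by gcongr
  rw [ENNReal.ofReal_mul (by positivity), ENNReal.ofReal_add (by positivity) (by positivity),
    mul_assoc, add_mul, mul_add]
  refine (add_le_add U1 U0).trans (le_of_eq ?_)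
  rw [← ENNReal.ofReal_add (by positivity) (by positivity)]
  congr 1
  ring

/-! ### The Taylor remainder. -/

theorem hasDerivAt_integral_segment {p f : ℝ → ℝ} (hp : Continuous p) (hf : ContDiff ℝ 1 f)
    (a y : ℝ) : HasDerivAt (fun y => ∫ t in (0 : ℝ)..1, p t * f (a + t * y))
      (∫ t in (0 : ℝ)..1, (p t * t) * deriv f (a + t * y)) y := by
  have cf := hf.continuous
  have cf' : Continuous (deriv f) := hf.continuous_deriv le_rfl
  obtain ⟨K, hK⟩ := (isCompact_Icc (a := (0 : ℝ)) (b := 1)).prod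
    (isCompact_closedBall y 1) |>.exists_bound_of_continuousOn
    (f := fun z : ℝ × ℝ => (p z.1 * z.1) * deriv f (a + z.1 * z.2))
    (by fun_prop : Continuous _).continuousOn
  refine (intervalIntegral.hasDerivAt_integral_of_dominated_loc_of_deriv_le (μ := volume)
    (F := fun y t => p t * f (a + t * y)) (F' := fun y t => (p t * t) * deriv f (a + t * y))
    (s := Metric.ball y 1) (bound := fun _ => K) (Metric.ball_mem_nhds y one_pos)
    (Eventually.of_forall fun x => (by fun_prop : Continuous _).aestronglyMeasurable)
    ((by fun_prop : Continuous _).intervalIntegrable _ _)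
    ((by fun_prop : Continuous _).aestronglyMeasurable)
    (ae_of_all _ fun t ht x hx => ?_) (by simp) (ae_of_all _ fun t _ x _ => ?_)).2
  · rw [uIoc_of_le zero_le_one] at ht
    exact hK (t, x) ⟨⟨ht.1.le, ht.2⟩, Metric.ball_subset_closedBall hx⟩
  · have h1 : HasDerivAt (fun x => a + t * x) t x := by
      simpa using ((hasDerivAt_id x).const_mul t).const_add a
    have h2 := ((hf.differentiable one_ne_zero) (a + t * x)).hasDerivAt
    convert! ((h2.comp x h1).const_mul (p t)) using 1
    ring

/-- Each derivative in `y` brings out a factor `t`, so the induction runs over all weights `p`. -/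
theorem contDiff_integral_segment {n : ℕ} {p f : ℝ → ℝ} (hp : Continuous p)
    (hf : ContDiff ℝ n f) (a : ℝ) :
    ContDiff ℝ n (fun y => ∫ t in (0 : ℝ)..1, p t * f (a + t * y)) ∧
    ∀ j ≤ n, ∀ y, iteratedDeriv j (fun y => ∫ t in (0 : ℝ)..1, p t * f (a + t * y)) y =
      ∫ t in (0 : ℝ)..1, (p t * t ^ j) * iteratedDeriv j f (a + t * y) := by
  induction n generalizing p f with
  | zero =>
    have cf := hf.continuous
    constructor
    · rw [Nat.cast_zero, contDiff_zero]
      exact intervalIntegral.continuous_parametric_intervalIntegral_of_continuous'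
        (f := fun y t => p t * f (a + t * y)) (by fun_prop) 0 1
    · intro j hj y
      obtain rfl : j = 0 := by omega
      simp
  | succ n ih =>
    have h1 : ContDiff ℝ 1 f := hf.of_le (by exact_mod_cast Nat.succ_le_succ (Nat.zero_le n))
    have hd : ContDiff ℝ n (deriv f) := (contDiff_succ_iff_deriv.1 (by exact_mod_cast hf)).2.2
    have hderiv : deriv (fun y => ∫ t in (0 : ℝ)..1, p t * f (a + t * y)) =
        fun y => ∫ t in (0 : ℝ)..1, (p t * t) * deriv f (a + t * y) :=
      funext fun y => (hasDerivAt_integral_segment hp h1 a y).deriv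
    obtain ⟨i1, i2⟩ := ih (p := fun t => p t * t) (by fun_prop) hd
    constructor
    · rw [Nat.cast_succ, contDiff_succ_iff_deriv]
      refine ⟨fun y => (hasDerivAt_integral_segment hp h1 a y).differentiableAt,
        fun h => by simp at h, ?_⟩
      rw [hderiv]
      exact i1
    · intro j hj y
      rcases j with _ | j
      · simp
      · rw [iteratedDeriv_succ', hderiv, i2 j (by omega)]
        refine intervalIntegral.integral_congr fun t _ => ?_
        rw [← iteratedDeriv_succ']
        ring

/-- The factor `W_a` of the Taylor remainder of `V'`, in integral form. -/
def remainderFactor (V : ℝ → ℝ) (a y : ℝ) : ℝ :=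
  ∫ t in (0 : ℝ)..1, ((1 - t) ^ 2 / 2) * iteratedDeriv 4 V (a + t * y)

/-- Expand `V'` to second order around the moving point `a + ty` and evaluate at `a + y`. The
derivative in `t` telescopes to the integrand, and the values at `t = 1` and `t = 0` are `V'(a + y)`
and the Taylor polynomial at `a`. -/
theorem taylorRem_eq {V : ℝ → ℝ} (hV : ContDiff ℝ 4 V) (a y : ℝ) :
    taylorRem V a (a + y) = y ^ 3 * remainderFactor V a y := by
  have hd : ∀ n : ℕ, n < 4 → ∀ x, HasDerivAt (iteratedDeriv n V) (iteratedDeriv (n + 1) V x) x := by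
    intro n hn x
    rw [iteratedDeriv_succ]
    exact ((hV.differentiable_iteratedDeriv n (by exact_mod_cast hn)) x).hasDerivAt
  have hcomp : ∀ n : ℕ, n < 4 → ∀ t, HasDerivAt (fun t => iteratedDeriv n V (a + t * y))
      (iteratedDeriv (n + 1) V (a + t * y) * y) t := by
    intro n hn t
    have h1 : HasDerivAt (fun t => a + t * y) y t := by
      simpa using ((hasDerivAt_id t).mul_const y).const_add a
    exact (hd n hn (a + t * y)).comp t h1
  have c4 : Continuous (iteratedDeriv 4 V) := hV.continuous_iteratedDeriv 4 (by norm_num)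
  have hmain : ∀ t, HasDerivAt (fun t => iteratedDeriv 1 V (a + t * y) +
      (1 - t) * y * iteratedDeriv 2 V (a + t * y) +
      (1 - t) ^ 2 / 2 * y ^ 2 * iteratedDeriv 3 V (a + t * y))
      (y ^ 3 * (((1 - t) ^ 2 / 2) * iteratedDeriv 4 V (a + t * y))) t := by
    intro t
    have l1 : HasDerivAt (fun t : ℝ => (1 - t) * y) (-y) t := by
      simpa using ((hasDerivAt_id t).const_sub 1).mul_const y
    have l2 : HasDerivAt (fun t : ℝ => (1 - t) ^ 2 / 2 * y ^ 2) (-((1 - t) * y ^ 2)) t := by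
      have := (((((hasDerivAt_id t).const_sub 1).pow 2).div_const 2).mul_const (y ^ 2))
      convert! this using 1
      simp
      ring
    convert! ((hcomp 1 (by norm_num) t).add (l1.mul (hcomp 2 (by norm_num) t))).add
      (l2.mul (hcomp 3 (by norm_num) t)) using 1
    norm_num
    ring
  have hftc := intervalIntegral.integral_eq_sub_of_hasDerivAt (a := 0) (b := 1)
    (fun t _ => hmain t) ((by fun_prop : Continuous _).intervalIntegrable _ _)
  rw [intervalIntegral.integral_const_mul] at hftc
  rw [remainderFactor, hftc, taylorRem, ← iteratedDeriv_one]
  simp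
  ring

theorem iteratedDeriv_iteratedDeriv_four (V : ℝ → ℝ) (j : ℕ) :
    iteratedDeriv j (iteratedDeriv 4 V) = iteratedDeriv (j + 3) (deriv V) := by
  rw [← iteratedDeriv_succ', iteratedDeriv_eq_iterate, iteratedDeriv_eq_iterate,
    iteratedDeriv_eq_iterate, ← Function.iterate_add_apply]

theorem contDiff_remainderFactor {m : ℕ} {V : ℝ → ℝ} (hV : ContDiff ℝ (m + 4 : ℕ) V) (a : ℝ) :
    ContDiff ℝ m (remainderFactor V a) ∧
    ∀ j ≤ m, ∀ y, iteratedDeriv j (remainderFactor V a) y =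
      ∫ t in (0 : ℝ)..1, ((1 - t) ^ 2 / 2 * t ^ j) * iteratedDeriv (j + 3) (deriv V) (a + t * y) := by
  have h4 : ContDiff ℝ m (iteratedDeriv 4 V) := by
    rw [iteratedDeriv_eq_iterate]
    exact ContDiff.iterate_deriv' m 4 (by exact_mod_cast hV)
  have h := contDiff_integral_segment (p := fun t => (1 - t) ^ 2 / 2) (by fun_prop) h4 a
  simp only [iteratedDeriv_iteratedDeriv_four] at h
  exact h

theorem norm_iteratedDeriv_remainderFactor_le {m : ℕ} {V : ℝ → ℝ}
    (hV : ContDiff ℝ (m + 4 : ℕ) V) {r N : ℝ}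
    (hN : ∀ j ≤ m + 3, ∀ x ∈ Icc (-r) r, ‖iteratedDeriv j (deriv V) x‖ ≤ N) {a y : ℝ}
    (ha : a ∈ Icc (-r) r) (hy : a + y ∈ Icc (-r) r) {j : ℕ} (hj : j ≤ m) :
    ‖iteratedDeriv j (remainderFactor V a) y‖ ≤ N := by
  rw [(contDiff_remainderFactor hV a).2 j hj y]
  refine (intervalIntegral.norm_integral_le_of_norm_le_const (C := N) fun t ht => ?_).trans
    (by simp)
  rw [uIoc_of_le zero_le_one] at ht
  have hmem : a + t * y ∈ Icc (-r) r := by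
    have := (convex_Icc (-r) r) ha hy (sub_nonneg.2 ht.2) ht.1.le (by ring)
    simp only [smul_eq_mul] at this
    convert this using 1
    ring
  rw [norm_mul]
  have h1 : ‖(1 - t) ^ 2 / 2 * t ^ j‖ ≤ 1 := by
    have t0 := ht.1.le
    rw [Real.norm_eq_abs, abs_of_nonneg (by positivity)]
    have h2 : (1 - t) ^ 2 / 2 ≤ 1 := by nlinarith [ht.1, ht.2]
    exact mul_le_one₀ h2 (by positivity) (pow_le_one₀ t0 ht.2)
  have h2 := hN (j + 3) (by omega) _ hmem
  calc _ ≤ 1 * N := by gcongr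
    _ = N := one_mul N

/-- The truncated factor `η(a + y) W_a(y)`. -/
def truncatedFactor (η V : ℝ → ℝ) (a y : ℝ) : ℂ := ((η (a + y) * remainderFactor V a y : ℝ) : ℂ)

theorem contDiff_truncatedFactor {m : ℕ} {η V : ℝ → ℝ} (hη : ContDiff ℝ m η)
    (hV : ContDiff ℝ (m + 4 : ℕ) V) (a : ℝ) : ContDiff ℝ m (truncatedFactor η V a) := by
  refine Complex.ofRealCLM.contDiff.comp (ContDiff.mul ?_ (contDiff_remainderFactor hV a).1)
  exact hη.comp (contDiff_const.add contDiff_id)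

/-- By Leibniz' rule. If `a + y` lies in `[-3R, 3R]`, convexity keeps the whole segment from `a`
there and `N` applies; otherwise every derivative of `η` vanishes at `a + y`. Thus `V` is controlled
only on `[-3R, 3R]`. -/
theorem exists_norm_iteratedDeriv_truncatedFactor_le (m : ℕ) {R : ℝ} (hR : 0 < R) {η : ℝ → ℝ}
    (hη : ContDiff ℝ m η) (hs : ∀ x, 3 / 2 * R ≤ |x| → η x = 0) :
    ∃ C : ℝ, 0 ≤ C ∧ ∀ a ∈ Icc (-(3 * R)) (3 * R), ∀ V : ℝ → ℝ, ContDiff ℝ (m + 4 : ℕ) V →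
      ∀ N : ℝ, (∀ j ≤ m + 3, ∀ x ∈ Icc (-(3 * R)) (3 * R), ‖iteratedDeriv j (deriv V) x‖ ≤ N) →
      ∀ j ≤ m, ∀ y, ‖iteratedDeriv j (truncatedFactor η V a) y‖ ≤ C * N := by
  have hsub : tsupport η ⊆ Icc (-(3 / 2 * R)) (3 / 2 * R) := by
    refine closure_minimal (fun x hx => ?_) isClosed_Icc
    by_contra hx'
    rw [mem_Icc, ← abs_le, not_le] at hx'
    exact hx (hs x hx'.le)
  have hcη : HasCompactSupport η := HasCompactSupport.of_support_subset_isCompact isCompact_Icc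
    ((subset_tsupport η).trans hsub)
  have hbd : ∀ i : ℕ, ∃ C : ℝ, i ≤ m → ∀ x, ‖iteratedFDeriv ℝ i η x‖ ≤ C := by
    intro i
    by_cases hi : i ≤ m
    · obtain ⟨C, hC⟩ := (hcη.iteratedFDeriv (𝕜 := ℝ) i).exists_bound_of_continuous
        (hη.continuous_iteratedFDeriv (by exact_mod_cast hi))
      exact ⟨C, fun _ => hC⟩
    · exact ⟨0, fun h => absurd h hi⟩
  choose c hc using hbd
  set K := ∑ i ∈ Finset.range (m + 1), |c i| with hK
  have hK0 : 0 ≤ K := Finset.sum_nonneg fun i _ => abs_nonneg _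
  have hcK : ∀ i ≤ m, ∀ x, ‖iteratedFDeriv ℝ i η x‖ ≤ K := fun i hi x =>
    (hc i hi x).trans ((le_abs_self _).trans
      (Finset.single_le_sum (f := fun i => |c i|) (fun i _ => abs_nonneg _)
        (Finset.mem_range.2 (by omega))))
  refine ⟨2 ^ m * K, by positivity, fun a ha V hV N hN j hj y => ?_⟩
  have hN0 : 0 ≤ N := (norm_nonneg _).trans (hN 0 (by omega) a ha)
  have hshift : ContDiff ℝ m fun y => η (a + y) := hη.comp (contDiff_const.add contDiff_id)
  have hW := contDiff_remainderFactor hV a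
  have hshiftd : ∀ i, iteratedFDeriv ℝ i (fun y => η (a + y)) y = iteratedFDeriv ℝ i η (a + y) :=
    fun i => by rw [iteratedFDeriv_comp_add_left]
  rw [← norm_iteratedFDeriv_eq_norm_iteratedDeriv]
  have hof : ‖iteratedFDeriv ℝ j (truncatedFactor η V a) y‖ =
      ‖iteratedFDeriv ℝ j (fun y => η (a + y) * remainderFactor V a y) y‖ :=
    Complex.ofRealLI.norm_iteratedFDeriv_comp_left
      ((hshift.mul hW.1).contDiffAt (x := y)) (by exact_mod_cast hj)
  rw [hof]
  refine (norm_iteratedFDeriv_mul_le hshift hW.1 y (by exact_mod_cast hj)).trans ?_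
  have hterm : ∀ i ∈ Finset.range (j + 1), (j.choose i : ℝ) *
      ‖iteratedFDeriv ℝ i (fun y => η (a + y)) y‖ *
      ‖iteratedFDeriv ℝ (j - i) (remainderFactor V a) y‖ ≤ (j.choose i : ℝ) * (K * N) := by
    intro i hi
    have hij : i ≤ j := by have := Finset.mem_range.1 hi; omega
    rw [hshiftd, mul_assoc]
    refine mul_le_mul_of_nonneg_left ?_ (by positivity)
    by_cases hy : a + y ∈ Icc (-(3 * R)) (3 * R)
    · have h2 := norm_iteratedDeriv_remainderFactor_le hV hN ha hy (j := j - i) (by omega)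
      rw [← norm_iteratedFDeriv_eq_norm_iteratedDeriv] at h2
      exact mul_le_mul (hcK i (by omega) _) h2 (norm_nonneg _) hK0
    · have hz : iteratedFDeriv ℝ i η (a + y) = 0 := by
        by_contra h
        have h3 := hsub (tsupport_iteratedFDeriv_subset (𝕜 := ℝ) i
          (subset_tsupport _ (Function.mem_support.2 h)))
        exact hy ⟨by linarith [h3.1], by linarith [h3.2]⟩
      rw [hz, norm_zero, zero_mul]
      positivity
  refine (Finset.sum_le_sum hterm).trans ?_
  rw [← Finset.sum_mul, ← mul_assoc]
  have hchoose : ∑ i ∈ Finset.range (j + 1), (j.choose i : ℝ) = 2 ^ j := by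
    exact_mod_cast Nat.sum_range_choose j
  rw [hchoose]
  gcongr
  norm_num

/-- A factor `y = (a + y) - a` is absorbed by replacing `η(x)` with `x η(x)`, at the price of a
multiple of `|a| ≤ 3R`. For this the induction on `l` must run over all cutoffs `η`. -/
theorem exists_norm_fourierT_pow_mul_truncatedFactor_le (m : ℕ) {R : ℝ} (hR : 0 < R) (l : ℕ)
    {η : ℝ → ℝ} (hη : ContDiff ℝ m η) (hs : ∀ x, 3 / 2 * R ≤ |x| → η x = 0) :
    ∃ C : ℝ, 0 ≤ C ∧ ∀ a ∈ Icc (-(3 * R)) (3 * R), ∀ V : ℝ → ℝ, ContDiff ℝ (m + 4 : ℕ) V →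
      ∀ N : ℝ, (∀ j ≤ m + 3, ∀ x ∈ Icc (-(3 * R)) (3 * R), ‖iteratedDeriv j (deriv V) x‖ ≤ N) →
      ∀ s, ‖fourierT (fun y => (y : ℂ) ^ l * truncatedFactor η V a y) s‖ ≤
        C * N / (1 + |s|) ^ m := by
  have supp : ∀ {θ : ℝ → ℝ}, (∀ x, 3 / 2 * R ≤ |x| → θ x = 0) → ∀ a ∈ Icc (-(3 * R)) (3 * R),
      ∀ V y, 5 * R < |y| → truncatedFactor θ V a y = 0 := by
    intro θ hθ a ha V y hy
    have h1 : |a| ≤ 3 * R := abs_le.2 ha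
    have h2 : |y| ≤ |a + y| + |a| := by
      have := abs_sub (a + y) a
      simpa using this
    rw [truncatedFactor, hθ (a + y) (by linarith), zero_mul, Complex.ofReal_zero]
  induction l generalizing η with
  | zero =>
    obtain ⟨C, hC, h⟩ := exists_norm_iteratedDeriv_truncatedFactor_le m hR hη hs
    refine ⟨2 ^ m * (4 * (5 * R) * C), by positivity, fun a ha V hV N hN s => ?_⟩
    simp only [pow_zero, one_mul]
    refine (norm_fourierT_le_of_support (contDiff_truncatedFactor hη hV a)
      (by positivity : (0 : ℝ) ≤ 5 * R) (supp hs a ha V) (h a ha V hV N hN) s).trans (le_of_eq ?_)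
    ring
  | succ l ih =>
    obtain ⟨C₀, hC₀, h₀⟩ := ih hη hs
    obtain ⟨C₁, hC₁, h₁⟩ := ih (η := fun x => x * η x) (contDiff_id.mul hη)
      (fun x hx => by rw [hs x hx, mul_zero])
    refine ⟨C₁ + 3 * R * C₀, by positivity, fun a ha V hV N hN s => ?_⟩
    have hint : ∀ {θ : ℝ → ℝ}, ContDiff ℝ m θ → (∀ x, 3 / 2 * R ≤ |x| → θ x = 0) →
        Integrable fun y : ℝ => (y : ℂ) ^ l * truncatedFactor θ V a y := by
      intro θ cθ hθ
      have cc := (contDiff_truncatedFactor cθ hV a).continuous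
      refine (by fun_prop : Continuous _).integrable_of_hasCompactSupport ?_
      refine HasCompactSupport.intro (isCompact_Icc (a := -(5 * R)) (b := 5 * R)) fun y hy => ?_
      rw [supp hθ a ha V y (by rw [← not_le, abs_le]; exact hy), mul_zero]
    have hi₁ := hint (θ := fun x => x * η x) (contDiff_id.mul hη)
      (fun x hx => by rw [hs x hx, mul_zero])
    have heq : (fun y : ℝ => (y : ℂ) ^ (l + 1) * truncatedFactor η V a y) = fun y : ℝ =>
        (y : ℂ) ^ l * truncatedFactor (fun x => x * η x) V a y +
          (-a : ℂ) * ((y : ℂ) ^ l * truncatedFactor η V a y) := by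
      funext y
      simp only [truncatedFactor]
      push_cast
      ring
    rw [heq, fourierT_add hi₁ ((hint hη hs).const_mul _), fourierT_const_mul]
    have ha' : ‖(-a : ℂ)‖ ≤ 3 * R := by simpa using abs_le.2 ha
    calc _ ≤ ‖fourierT (fun y => (y : ℂ) ^ l * truncatedFactor (fun x => x * η x) V a y) s‖ +
          ‖(-a : ℂ)‖ * ‖fourierT (fun y => (y : ℂ) ^ l * truncatedFactor η V a y) s‖ := by
          rw [← norm_mul]; exact norm_add_le _ _
      _ ≤ C₁ * N / (1 + |s|) ^ m + 3 * R * (C₀ * N / (1 + |s|) ^ m) := by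
          gcongr
          · exact h₁ a ha V hV N hN s
          · exact h₀ a ha V hV N hN s
      _ = _ := by ring

/-! ### Pointwise bounds for `𝒦` of the remainder function. -/

theorem deriv_stieltjesKernel (z : ℂ) (x : ℝ) :
    deriv (stieltjesKernel z) x = -1 / ((x : ℂ) - z) ^ 2 := by
  by_cases h : (x : ℂ) - z = 0
  -- At the pole both sides are `0` by convention. The kernel is not continuous there, since its
  -- product with `y - z` equals `1` nearby and `0` at the pole. Hence the formula also holds on the
  -- null set `b_T = 0`.
  · have hz : z = x := (sub_eq_zero.1 h).symm
    rw [h, zero_pow two_ne_zero, div_zero]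
    refine deriv_zero_of_not_differentiableAt fun hd => ?_
    have hc : ContinuousAt (stieltjesKernel z) x := hd.continuousAt
    have h1 : ContinuousAt (fun y : ℝ => stieltjesKernel z y * ((y : ℂ) - z)) x :=
      hc.mul (by fun_prop)
    have h2 : Tendsto (fun y : ℝ => stieltjesKernel z y * ((y : ℂ) - z)) (𝓝[≠] x) (𝓝 0) := by
      have h3 := h1.tendsto
      simp only [h, mul_zero] at h3
      exact h3.mono_left nhdsWithin_le_nhds
    have h4 : Tendsto (fun y : ℝ => stieltjesKernel z y * ((y : ℂ) - z)) (𝓝[≠] x) (𝓝 1) := by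
      refine (tendsto_const_nhds (x := (1 : ℂ))).congr' ?_
      filter_upwards [self_mem_nhdsWithin] with y hy
      have hne : (y : ℂ) - z ≠ 0 := by
        rw [hz, sub_ne_zero]
        exact_mod_cast hy
      rw [stieltjesKernel, one_div, inv_mul_cancel₀ hne]
    exact zero_ne_one (tendsto_nhds_unique h2 h4)
  · have h1 : HasDerivAt (fun x : ℝ => (x : ℂ) - z) 1 x := by
      simpa using (Complex.ofRealCLM.hasDerivAt (x := x)).sub_const z
    have h2 := h1.inv h
    have : stieltjesKernel z = (fun x : ℝ => (x : ℂ) - z)⁻¹ := by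
      funext y; simp [stieltjesKernel]
    rw [this, h2.deriv]

theorem remFun_eq (χ V : ℝ → ℝ) (w : ℝ × ℝ) (x : ℝ) :
    remFun χ V w x = (χ x : ℂ) * (taylorRem V w.1 x : ℂ) *
      (-1 / ((x : ℂ) - ((w.1 : ℂ) + Complex.I * (w.2 : ℂ))) ^ 2) := by
  rw [remFun, deriv_stieltjesKernel]

theorem remFun_conj (χ V : ℝ → ℝ) (w : ℝ × ℝ) :
    remFun χ V (w.1, -w.2) = fun x => conj (remFun χ V w x) := by
  funext x
  simp [remFun_eq]

theorem IsCutoff.eq_zero_of_le_abs {R : ℝ} {χ : ℝ → ℝ} (h : IsCutoff R χ) (x : ℝ)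
    (hx : 3 / 2 * R ≤ |x|) : χ x = 0 :=
  h.eq_zero x (by simpa [Metric.mem_ball, Real.dist_eq] using hx)

/-- With `u = y - ib`, expanding `(u + ib)³ / u²` gives `y + 2ib - 3b²/u - ib³/u²`. -/
theorem remFun_add_eq {χ V : ℝ → ℝ} (hV : ContDiff ℝ 4 V) (a : ℝ) {b : ℝ} (hb : b ≠ 0) (y : ℝ) :
    remFun χ V (a, b) (a + y) =
      ((-1 : ℂ) * ((y : ℂ) ^ 1 * truncatedFactor χ V a y) +
        (-(2 * Complex.I * b)) * ((y : ℂ) ^ 0 * truncatedFactor χ V a y)) +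
      truncatedFactor χ V a y * singularFactor (3 * b ^ 2) (Complex.I * b ^ 2) b y := by
  have hu := sub_I_mul_ne_zero hb y
  have he : ((a + y : ℝ) : ℂ) - ((a : ℂ) + Complex.I * b) = (y : ℂ) - Complex.I * b := by
    push_cast; ring
  rw [remFun_eq, taylorRem_eq hV]
  simp only [he, truncatedFactor, singularFactor]
  push_cast
  field_simp
  ring_nf
  simp only [Complex.I_sq, show Complex.I ^ 3 = -Complex.I by
    rw [pow_succ, Complex.I_sq]; ring]
  ring

theorem exists_remFun_bound_of_pos (k : ℕ) {R : ℝ} (hR : 0 < R) {χ : ℝ → ℝ} (hχ : IsCutoff R χ) :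
    ∃ C : ℝ, 0 ≤ C ∧ ∀ B : ℝ, B ≤ 1 → ∀ V : ℝ → ℝ, ContDiff ℝ (k + 8 : ℕ) V →
      ∀ N : ℝ, (∀ j ≤ k + 7, ∀ x ∈ Icc (-(3 * R)) (3 * R), ‖iteratedDeriv j (deriv V) x‖ ≤ N) →
      ∀ a ∈ Icc (-(3 * R)) (3 * R), ∀ b : ℝ, 0 < b → b ≤ B →
      Integrable (remFun χ V (a, b)) ∧
      Integrable (fun s => symbolK k B s * fourierT (remFun χ V (a, b)) s) ∧
      ∀ y, b ^ k * ‖opK k B (remFun χ V (a, b)) (a + y)‖ ≤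
        C * N * B⁻¹ ^ 2 * (1 / (1 + y ^ 2) + b / (y ^ 2 + b ^ 2)) := by
  have hχm : ContDiff ℝ (k + 4 : ℕ) χ := hχ.smooth.of_le
    (WithTop.coe_le_coe.2 (le_top : ((k + 4 : ℕ) : ℕ∞) ≤ ⊤))
  choose c hc0 hc using fun l => exists_norm_fourierT_pow_mul_truncatedFactor_le (k + 4) hR l hχm
    hχ.eq_zero_of_le_abs
  obtain ⟨C₁, hC₁, h₁⟩ := exists_opK_smooth_bound k
  obtain ⟨C₂, hC₂, h₂⟩ := exists_opK_singular_bound k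
  set A := c 0 + c 1 + c 2 + c 3 with hA
  have p0 := hc0 0
  have p1 := hc0 1
  have p2 := hc0 2
  have p3 := hc0 3
  have hA0 : 0 ≤ A := by positivity
  -- Powers up to `y³` occur: the smooth part contains `yΦ`, and `𝒦` requires two further
  -- multiplications by `y`.
  have hcA : ∀ l < 4, c l ≤ A := by
    intro l hl
    interval_cases l <;> linarith
  refine ⟨(C₁ + 4 * C₂) * (Real.pi * (3 * A)), by positivity,
    fun B hB1 V hV N hN a ha b hb hbB => ?_⟩
  have hB : 0 < B := hb.trans_le hbB
  have hBi : 1 ≤ B⁻¹ := (one_le_inv₀ hB).2 hB1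
  have hN0 : 0 ≤ N := (norm_nonneg _).trans (hN 0 (by omega) a ha)
  have hV4 : ContDiff ℝ 4 V := hV.of_le (by exact_mod_cast (by omega : 4 ≤ k + 8))
  set Φ := truncatedFactor χ V a with hΦ
  have cΦ : Continuous Φ := (contDiff_truncatedFactor hχm (by exact_mod_cast hV) a).continuous
  have sΦ : HasCompactSupport Φ := by
    refine HasCompactSupport.intro (isCompact_Icc (a := -(5 * R)) (b := 5 * R)) fun y hy => ?_
    rw [mem_Icc, ← abs_le, not_le] at hy
    have h1 : |a| ≤ 3 * R := abs_le.2 ha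
    have h2 : |y| ≤ |a + y| + |a| := by simpa using abs_sub (a + y) a
    rw [hΦ, truncatedFactor, hχ.eq_zero_of_le_abs (a + y) (by linarith), zero_mul,
      Complex.ofReal_zero]
  have iT : ∀ l : ℕ, Integrable fun y : ℝ => (y : ℂ) ^ l * Φ y := fun l =>
    (by fun_prop : Continuous _).integrable_of_hasCompactSupport sΦ.mul_left
  have dec : ∀ l < 4, ∀ s, ‖fourierT (fun y => (y : ℂ) ^ l * Φ y) s‖ ≤
      A * N / (1 + |s|) ^ (k + 4) := fun l hl s => by
    refine (hc l a ha V hV N hN s).trans ?_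
    have := hcA l hl
    gcongr
  set f : ℝ → ℂ := fun y => (-1 : ℂ) * ((y : ℂ) ^ 1 * Φ y) +
        (-(2 * Complex.I * b)) * ((y : ℂ) ^ 0 * Φ y) with hf
  have decf : ∀ l < 3, ∀ s, ‖fourierT (fun y => (y : ℂ) ^ l * f y) s‖ ≤
      3 * A * N / (1 + |s|) ^ (k + 4) := fun l hl s => by
    have e : (fun y : ℝ => (y : ℂ) ^ l * f y) = fun y : ℝ => (-1 : ℂ) * ((y : ℂ) ^ (l + 1) * Φ y) +
        (-(2 * Complex.I * b)) * ((y : ℂ) ^ l * Φ y) := by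
      funext y; simp only [hf]; ring
    rw [e, fourierT_add ((iT _).const_mul _) ((iT _).const_mul _), fourierT_const_mul,
      fourierT_const_mul]
    refine (norm_add_le _ _).trans ?_
    rw [norm_mul, norm_mul]
    have n2 : ‖-(2 * Complex.I * (b : ℂ))‖ ≤ 2 := by
      simp [abs_of_pos hb]; linarith
    have n1 : ‖(-1 : ℂ)‖ = 1 := by simp
    rw [n1, one_mul]
    calc _ ≤ A * N / (1 + |s|) ^ (k + 4) + 2 * (A * N / (1 + |s|) ^ (k + 4)) := by
          gcongr
          · exact dec (l + 1) (by omega) s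
          · exact dec l (by omega) s
      _ = _ := by ring
  set M := Real.pi * (3 * A * N) with hM
  have hM0 : 0 ≤ M := by positivity
  have sn : ∀ {g : ℝ → ℂ}, (∀ s, ‖g s‖ ≤ 3 * A * N / (1 + |s|) ^ (k + 4)) →
      scaleNorm 1 (k + 2) g ≤ ENNReal.ofReal M := fun h => scaleNorm_le_of_decay (by positivity) h
  have dec3 : ∀ l < 4, ∀ s, ‖fourierT (fun y => (y : ℂ) ^ l * Φ y) s‖ ≤
      3 * A * N / (1 + |s|) ^ (k + 4) := fun l hl s => by
    refine (dec l hl s).trans ?_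
    gcongr
    linarith
  have cf : Continuous f := by fun_prop
  have sf : HasCompactSupport f := sΦ.mul_left.mul_left.add sΦ.mul_left.mul_left
  have f0 := decf 0 (by norm_num)
  have f1 := decf 1 (by norm_num)
  have f2 := decf 2 (by norm_num)
  simp only [pow_zero, one_mul] at f0
  simp only [pow_one] at f1
  simp only [pow_two, mul_assoc (_ : ℂ) (_ : ℂ) (f _)] at f2
  have d0 := dec3 0 (by norm_num)
  have d1 := dec3 1 (by norm_num)
  simp only [pow_zero, one_mul] at d0
  simp only [pow_one] at d1
  obtain ⟨i₁, b₁⟩ := h₁ B hB hB1 f cf sf M hM0 (sn f0) (sn f1) (sn f2) (by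
    refine (f0 0).trans ?_
    simp only [abs_zero, add_zero, one_pow, div_one]
    have := Real.pi_gt_three
    have h3 : 0 ≤ 3 * A * N := by positivity
    rw [hM]
    nlinarith)
  obtain ⟨i₂, b₂⟩ := h₂ b B hb hbB hB1 Φ cΦ sΦ M hM0 (sn d0) (sn d1) (3 * b ^ 2)
    (Complex.I * b ^ 2)
  have hG : ∀ y, remFun χ V (a, b) (a + y) = f y +
      Φ y * singularFactor (3 * b ^ 2) (Complex.I * b ^ 2) b y :=
    fun y => remFun_add_eq hV4 a hb.ne' y
  have if' : Integrable f := cf.integrable_of_hasCompactSupport sf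
  have is' : Integrable fun y => Φ y * singularFactor (3 * b ^ 2) (Complex.I * b ^ 2) b y :=
    (cΦ.mul (continuous_singularFactor _ _ hb.ne')).integrable_of_hasCompactSupport sΦ.mul_right
  have iG : Integrable fun y => remFun χ V (a, b) (a + y) := by
    simp only [hG]
    exact if'.add is'
  refine ⟨?_, ?_, fun y => ?_⟩
  · have := iG.comp_add_left (-a)
    simpa using this
  · have h3 := i₁.add i₂
    have h4 : Integrable fun s : ℝ => (symbolK k B s * fourierT f s + symbolK k B s *
      fourierT (fun x => Φ x * singularFactor (3 * b ^ 2) (Complex.I * b ^ 2) b x) s) *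
      Complex.exp (-(Complex.I * (a : ℂ) * (s : ℂ))) :=
      h3.mul_bdd (c := 1) (by fun_prop) (ae_of_all _ fun s => (norm_cexp_neg_I_mul a s).le)
    refine h4.congr (ae_of_all _ fun s => ?_)
    beta_reduce
    rw [fourierT_comp_add (remFun χ V (a, b)) a]
    simp only [hG]
    rw [fourierT_add if' is']
    ring
  rw [opK_comp_add]
  simp only [hG]
  rw [opK_add if' is' i₁ i₂]
  have q1 := b₁ y
  have q2 := b₂ y
  have hσ : ‖(3 * (b : ℂ) ^ 2)‖ + ‖Complex.I * (b : ℂ) ^ 2‖ = 4 * b ^ 2 := by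
    simp [abs_of_pos hb]; ring
  rw [hσ] at q2
  set X := ‖opK k B f y‖
  set Y := ‖opK k B (fun x => Φ x * singularFactor (3 * b ^ 2) (Complex.I * b ^ 2) b x) y‖
  have hx : b ^ k * X ≤ C₁ * M * B⁻¹ ^ 2 * (1 / (1 + y ^ 2)) := by
    rw [mul_one_div, le_div_iff₀ (by positivity)]
    have hbk : b ^ k * B⁻¹ ^ k ≤ 1 := by
      rw [← mul_pow]
      refine pow_le_one₀ (by positivity) ?_
      rw [← div_eq_mul_inv, div_le_one hB]; exact hbB
    calc b ^ k * X * (1 + y ^ 2) = b ^ k * ((1 + y ^ 2) * X) := by ring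
      _ ≤ b ^ k * (C₁ * M * B⁻¹ ^ (k + 2)) := by gcongr
      _ = (b ^ k * B⁻¹ ^ k) * (C₁ * M * B⁻¹ ^ 2) := by ring
      _ ≤ 1 * (C₁ * M * B⁻¹ ^ 2) := by gcongr
      _ = _ := one_mul _
  -- The coefficients of the singular factor have total size `4b²`, which cancels two of the powers
  -- in `b^(k+2)`. The bound obtained has `B⁻¹`; it is weakened to `B⁻²` to match the smooth part.
  have hy : b ^ k * Y ≤ 4 * C₂ * M * B⁻¹ ^ 2 * (b / (y ^ 2 + b ^ 2)) := by
    rw [← mul_div_assoc, le_div_iff₀ (by positivity)]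
    refine le_of_mul_le_mul_left ?_ (by positivity : 0 < b ^ 2)
    calc b ^ 2 * (b ^ k * Y * (y ^ 2 + b ^ 2)) = b ^ (k + 2) * (y ^ 2 + b ^ 2) * Y := by ring
      _ ≤ C₂ * (4 * b ^ 2) * M * (b * B⁻¹) := q2
      _ = b ^ 2 * (4 * C₂ * M * B⁻¹ ^ 1 * b) := by ring
      _ ≤ _ := by
        gcongr
        norm_num
  have e1 : 0 ≤ 1 / (1 + y ^ 2) := by positivity
  have e2 : 0 ≤ b / (y ^ 2 + b ^ 2) := by positivity
  calc _ ≤ b ^ k * (X + Y) := by gcongr; exact norm_add_le _ _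
    _ = b ^ k * X + b ^ k * Y := mul_add _ _ _
    _ ≤ C₁ * M * B⁻¹ ^ 2 * (1 / (1 + y ^ 2)) + 4 * C₂ * M * B⁻¹ ^ 2 * (b / (y ^ 2 + b ^ 2)) :=
      add_le_add hx hy
    _ ≤ (C₁ + 4 * C₂) * M * B⁻¹ ^ 2 * (1 / (1 + y ^ 2)) +
        (C₁ + 4 * C₂) * M * B⁻¹ ^ 2 * (b / (y ^ 2 + b ^ 2)) := by
      gcongr <;> linarith
    _ = _ := by rw [hM]; ring

/-- The Schur kernel that dominates the kernel `g_pot`. -/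
def schurKernel (x : ℝ) (w : ℝ × ℝ) : ℝ :=
  1 / (1 + (x - w.1) ^ 2) + |w.2| / ((x - w.1) ^ 2 + w.2 ^ 2)

theorem integrable_symbolK_mul_fourierT_conj {k : ℕ} {B : ℝ} (hB : 0 < B) {f : ℝ → ℂ}
    (h : Integrable fun s => symbolK k B s * fourierT f s) :
    Integrable fun s => symbolK k B s * fourierT (fun x => conj (f x)) s := by
  have h1 : Integrable fun s => conj (symbolK k B (-s) * fourierT f (-s)) :=
    (Complex.conjCLE.toContinuousLinearMap.integrable_comp h.comp_neg)
  refine h1.congr (ae_of_all _ fun s => ?_)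
  simp only [fourierT_conj, map_mul, symbolK_eq_symbolHalf k hB, abs_neg, Complex.conj_ofReal]

theorem exists_remFun_bound (k : ℕ) {R : ℝ} (hR : 0 < R) {χ : ℝ → ℝ} (hχ : IsCutoff R χ) :
    ∃ C : ℝ, 0 ≤ C ∧ ∀ B : ℝ, B ≤ 1 → ∀ V : ℝ → ℝ, ContDiff ℝ (k + 8 : ℕ) V →
      ∀ N : ℝ, (∀ j ≤ k + 7, ∀ x ∈ Icc (-(3 * R)) (3 * R), ‖iteratedDeriv j (deriv V) x‖ ≤ N) →
      ∀ w : ℝ × ℝ, w.1 ∈ Icc (-(3 * R)) (3 * R) → w.2 ≠ 0 → |w.2| ≤ B →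
      Integrable (remFun χ V w) ∧
      Integrable (fun s => symbolK k B s * fourierT (remFun χ V w) s) ∧
      ∀ x, |w.2| ^ k * ‖opK k B (remFun χ V w) x‖ ≤ C * N * B⁻¹ ^ 2 * schurKernel x w := by
  obtain ⟨C, hC, h⟩ := exists_remFun_bound_of_pos k hR hχ
  refine ⟨C, hC, fun B hB1 V hV N hN w hw hw0 hwB => ?_⟩
  obtain ⟨h1, h2, h3⟩ := h B hB1 V hV N hN w.1 hw |w.2| (abs_pos.2 hw0) hwB
  have hB : 0 < B := (abs_pos.2 hw0).trans_le hwB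
  have key : ∀ x, |w.2| ^ k * ‖opK k B (remFun χ V (w.1, |w.2|)) x‖ ≤
      C * N * B⁻¹ ^ 2 * schurKernel x w := by
    intro x
    have := h3 (x - w.1)
    rw [add_sub_cancel, sq_abs] at this
    exact this
  rcases abs_choice w.2 with hs | hs
  · rw [hs] at h1 h2
    refine ⟨h1, h2, fun x => ?_⟩
    have := key x
    rw [hs] at this ⊢
    exact this
  · have e : remFun χ V w = fun x => conj (remFun χ V (w.1, |w.2|) x) := by
      rw [← remFun_conj]
      simp [hs]
    refine ⟨?_, ?_, fun x => ?_⟩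
    · rw [e]
      exact Complex.conjCLE.toContinuousLinearMap.integrable_comp h1
    · rw [e]
      exact integrable_symbolK_mul_fourierT_conj hB h2
    · rw [e, opK_conj hB, Complex.norm_conj]
      exact key x

/-! ### The Schur test on the strip. -/

theorem volume_snd_eq_zero : volume {w : ℝ × ℝ | w.2 = 0} = 0 := by
  have : {w : ℝ × ℝ | w.2 = 0} = univ ×ˢ {0} := by ext w; simp
  rw [this, Measure.volume_eq_prod, Measure.prod_prod]
  simp

theorem ae_snd_ne_zero : ∀ᵐ w : ℝ × ℝ, w.2 ≠ 0 := by
  rw [ae_iff]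
  simpa using volume_snd_eq_zero

theorem measurableSet_box (R B : ℝ) : MeasurableSet (box R B) :=
  measurableSet_Icc.prod measurableSet_Ioo

theorem measurableSet_strip (B : ℝ) : MeasurableSet (strip B) := by
  have h : Measurable fun z : ℝ × ℝ => |z.2| := by fun_prop
  exact (measurableSet_lt measurable_const h).inter (measurableSet_lt h measurable_const)

theorem mem_strip_of_mem_box {R B : ℝ} {w : ℝ × ℝ} (hw : w ∈ box R B) (h0 : w.2 ≠ 0) :
    w ∈ strip B := ⟨abs_pos.2 h0, abs_lt.2 hw.2⟩

theorem restrict_box_le (R B : ℝ) :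
    (volume : Measure (ℝ × ℝ)).restrict (box R B) ≤ volume.restrict (strip B) := by
  refine Measure.restrict_mono' ?_ le_rfl
  filter_upwards [ae_snd_ne_zero] with w h0 hw
  exact mem_strip_of_mem_box hw h0

theorem ae_restrict_box (R B : ℝ) : ∀ᵐ w ∂(volume.restrict (box R B)), w ∈ box R B ∧ w.2 ≠ 0 := by
  filter_upwards [ae_restrict_mem (measurableSet_box R B),
    ae_restrict_of_ae ae_snd_ne_zero] with w h1 h2 using ⟨h1, h2⟩

theorem stripNorm_one (B : ℝ) (h : ℝ × ℝ → ℂ) :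
    stripNorm B 1 h = ∫⁻ z in strip B, ‖h z‖ₑ := by
  simp [stripNorm]

theorem stripNorm_top (B : ℝ) (h : ℝ × ℝ → ℂ) :
    stripNorm B ∞ h = ⨆ z ∈ strip B, ‖h z‖ₑ := by
  simp [stripNorm]

/-- The Schur test on the strip. -/
theorem schur_test {R B : ℝ} {K : ℝ × ℝ → ℝ × ℝ → ℂ} (hK : Measurable (Function.uncurry K))
    {c : ℝ≥0∞} (hc : c < ∞) (hrow : ∀ z ∈ strip B, ∫⁻ w in box R B, ‖K z w‖ₑ ≤ c)
    (hcol : ∀ w ∈ box R B, w.2 ≠ 0 → ∫⁻ z in strip B, ‖K z w‖ₑ ≤ c)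
    {p : ℝ≥0∞} (hp : p = 1 ∨ p = ∞) {h : ℝ × ℝ → ℂ}
    (hm : AEMeasurable h (volume.restrict (strip B))) (hfin : stripNorm B p h < ∞) :
    (∀ᵐ z ∂(volume.restrict (strip B)), IntegrableOn (fun w => K z w * h w) (box R B)) ∧
    (p = ∞ → ∀ z ∈ strip B, IntegrableOn (fun w => K z w * h w) (box R B)) ∧
    Measurable (fun z => ∫ w in box R B, K z w * h w) ∧
    stripNorm B p (fun z => ∫ w in box R B, K z w * h w) ≤ c * stripNorm B p h := by
  have hmb : AEMeasurable h (volume.restrict (box R B)) := hm.mono_measure (restrict_box_le R B)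
  have hmeas : ∀ z, AEStronglyMeasurable (fun w => K z w * h w) (volume.restrict (box R B)) :=
    fun z => ((hK.comp (measurable_const.prodMk measurable_id)).aemeasurable.mul
      hmb).aestronglyMeasurable
  have hTm : Measurable (fun z => ∫ w in box R B, K z w * h w) := by
    -- Changing `h` on a null set does not change the integral at any `z`, so a measurable
    -- representative gives measurability everywhere.
    have e : (fun z => ∫ w in box R B, K z w * h w) =
        fun z => ∫ w in box R B, K z w * hmb.mk h w := by
      funext z
      refine integral_congr_ae ?_
      filter_upwards [hmb.ae_eq_mk] with w hw
      rw [hw]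
    rw [e]
    have hu : StronglyMeasurable (Function.uncurry fun z w => K z w * hmb.mk h w) :=
      (hK.mul (hmb.measurable_mk.comp measurable_snd)).stronglyMeasurable
    exact hu.integral_prod_right.measurable
  have hle : ∀ z, ‖∫ w in box R B, K z w * h w‖ₑ ≤ ∫⁻ w in box R B, ‖K z w‖ₑ * ‖h w‖ₑ :=
    fun z => (enorm_integral_le_lintegral_enorm _).trans (le_of_eq (by simp only [enorm_mul]))
  rcases hp with rfl | rfl
  · rw [stripNorm_one] at hfin
    have hswap : ∫⁻ z in strip B, ∫⁻ w in box R B, ‖K z w‖ₑ * ‖h w‖ₑ ≤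
        c * ∫⁻ z in strip B, ‖h z‖ₑ := by
      have hjm : AEMeasurable (Function.uncurry fun z w => ‖K z w‖ₑ * ‖h w‖ₑ)
          ((volume.restrict (strip B)).prod (volume.restrict (box R B))) :=
        hK.enorm.aemeasurable.mul (hmb.enorm.comp_snd)
      rw [lintegral_lintegral_swap hjm]
      calc _ ≤ ∫⁻ w in box R B, c * ‖h w‖ₑ := by
            refine lintegral_mono_ae ?_
            filter_upwards [ae_restrict_box R B] with w hw
            have hz : Measurable fun z => ‖K z w‖ₑ :=
              (hK.comp (measurable_id.prodMk measurable_const)).enorm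
            rw [lintegral_mul_const _ hz]
            gcongr
            exact hcol w hw.1 hw.2
        _ = c * ∫⁻ w in box R B, ‖h w‖ₑ := lintegral_const_mul' _ _ hc.ne
        _ ≤ _ := mul_le_mul_right (lintegral_mono' (restrict_box_le R B) le_rfl) _
    have hfin' : ∫⁻ z in strip B, ∫⁻ w in box R B, ‖K z w‖ₑ * ‖h w‖ₑ < ∞ :=
      hswap.trans_lt (ENNReal.mul_lt_top hc hfin)
    refine ⟨?_, by simp, hTm, ?_⟩
    · have hjm : AEMeasurable (fun z => ∫⁻ w in box R B, ‖K z w‖ₑ * ‖h w‖ₑ)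
          (volume.restrict (strip B)) :=
        (hK.enorm.aemeasurable.mul (hmb.enorm.comp_snd) : AEMeasurable
          (Function.uncurry fun z w => ‖K z w‖ₑ * ‖h w‖ₑ)
          ((volume.restrict (strip B)).prod (volume.restrict (box R B)))).lintegral_prod_right'
      filter_upwards [ae_lt_top' hjm hfin'.ne] with z hz
      refine ⟨hmeas z, ?_⟩
      simpa only [HasFiniteIntegral, enorm_mul] using hz
    · rw [stripNorm_one, stripNorm_one]
      exact (lintegral_mono fun z => hle z).trans hswap
  · have hae : ∀ᵐ w ∂(volume.restrict (box R B)), ‖h w‖ₑ ≤ stripNorm B ∞ h := by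
      filter_upwards [ae_restrict_box R B] with w hw
      rw [stripNorm_top]
      exact le_iSup₂ (f := fun z (_ : z ∈ strip B) => ‖h z‖ₑ) w (mem_strip_of_mem_box hw.1 hw.2)
    have hb : ∀ z ∈ strip B, ∫⁻ w in box R B, ‖K z w‖ₑ * ‖h w‖ₑ ≤ c * stripNorm B ∞ h := by
      intro z hz
      calc _ ≤ ∫⁻ w in box R B, ‖K z w‖ₑ * stripNorm B ∞ h := by
            refine lintegral_mono_ae ?_
            filter_upwards [hae] with w hw
            gcongr
        _ = (∫⁻ w in box R B, ‖K z w‖ₑ) * stripNorm B ∞ h := lintegral_mul_const' _ _ hfin.ne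
        _ ≤ _ := by
            gcongr
            exact hrow z hz
    have hint : ∀ z ∈ strip B, IntegrableOn (fun w => K z w * h w) (box R B) := fun z hz =>
      ⟨hmeas z, by
        simpa only [HasFiniteIntegral, enorm_mul] using
          (hb z hz).trans_lt (ENNReal.mul_lt_top hc hfin)⟩
    refine ⟨?_, fun _ => hint, hTm, ?_⟩
    · filter_upwards [ae_restrict_mem (measurableSet_strip B)] with z hz using hint z hz
    · rw [stripNorm_top (h := fun z => ∫ w in box R B, K z w * h w)]
      exact iSup₂_le fun z hz => (hle z).trans (hb z hz)

theorem measurable_schurKernel : Measurable fun q : ℝ × (ℝ × ℝ) => schurKernel q.1 q.2 := by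
  unfold schurKernel
  fun_prop

/-- Each of the two profiles has integral `π`, whatever its scale. -/
theorem lintegral_schur_profile {b : ℝ} (hb : b ≠ 0) :
    ∫⁻ y : ℝ, ENNReal.ofReal (1 / (1 + y ^ 2) + |b| / (y ^ 2 + b ^ 2)) =
      ENNReal.ofReal (2 * Real.pi) := by
  have h1 : Integrable fun y : ℝ => 1 / (1 + y ^ 2) := by
    simpa only [one_div] using integrable_inv_one_add_sq
  have h2 : Integrable fun y : ℝ => |b| / (y ^ 2 + b ^ 2) := by
    simpa only [sq_abs] using integrable_div_sq_add_sq (abs_pos.2 hb)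
  have h12 : Integrable fun y : ℝ => 1 / (1 + y ^ 2) + |b| / (y ^ 2 + b ^ 2) := h1.add h2
  rw [← ofReal_integral_eq_lintegral_ofReal h12 (ae_of_all _ fun y => by positivity)]
  congr 1
  have h3 : ∫ y : ℝ, 1 / (1 + y ^ 2) = Real.pi := by
    simp only [one_div]; exact integral_univ_inv_one_add_sq
  have h4 : ∫ y : ℝ, |b| / (y ^ 2 + b ^ 2) = Real.pi := by
    have e := Measure.integral_comp_div (fun y : ℝ => 1 / (1 + y ^ 2)) |b|
    rw [h3, abs_abs] at e
    have e2 : (fun y : ℝ => |b| / (y ^ 2 + b ^ 2)) =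
        fun y : ℝ => |b|⁻¹ * (1 / (1 + (y / |b|) ^ 2)) := by
      funext y
      have hb' := abs_pos.2 hb
      rw [← sq_abs b]
      field_simp
      ring
    rw [e2, integral_const_mul, e, smul_eq_mul, ← mul_assoc,
      inv_mul_cancel₀ (abs_pos.2 hb).ne', one_mul]
  rw [integral_add h1 h2, h3, h4]
  ring

theorem lintegral_schurKernel_fst (x : ℝ) {b : ℝ} (hb : b ≠ 0) :
    ∫⁻ a : ℝ, ENNReal.ofReal (schurKernel x (a, b)) = ENNReal.ofReal (2 * Real.pi) := by
  rw [← lintegral_schur_profile hb, ← lintegral_sub_left_eq_self _ x]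
  simp only [schurKernel, sub_sub_cancel]

theorem lintegral_schurKernel_snd {w : ℝ × ℝ} (hw : w.2 ≠ 0) :
    ∫⁻ x : ℝ, ENNReal.ofReal (schurKernel x w) = ENNReal.ofReal (2 * Real.pi) := by
  rw [← lintegral_schur_profile hw]
  exact lintegral_sub_right_eq_self
    (fun y => ENNReal.ofReal (1 / (1 + y ^ 2) + |w.2| / (y ^ 2 + w.2 ^ 2))) w.1

theorem lintegral_slab_le {B : ℝ} {s : Set (ℝ × ℝ)} (hs : s ⊆ univ ×ˢ Ioo (-B) B)
    {G : ℝ × ℝ → ℝ≥0∞} (hG : Measurable G) {c : ℝ≥0∞}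
    (h : ∀ b, b ≠ 0 → ∫⁻ a, G (a, b) ≤ c) :
    ∫⁻ w in s, G w ≤ c * ENNReal.ofReal (2 * B) := by
  calc _ ≤ ∫⁻ w in univ ×ˢ Ioo (-B) B, G w := lintegral_mono_set hs
    _ = ∫⁻ b in Ioo (-B) B, ∫⁻ a, G (a, b) := by
        rw [Measure.volume_eq_prod, ← Measure.prod_restrict, Measure.restrict_univ,
          lintegral_prod_symm' _ hG]
    _ ≤ ∫⁻ b in Ioo (-B) B, c := by
        refine lintegral_mono_ae (ae_restrict_of_ae ?_)
        filter_upwards [(measure_eq_zero_iff_ae_notMem (s := {(0 : ℝ)})).1 (by simp)] with b hb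
        exact h b (by simpa using hb)
    _ = _ := by
        rw [setLIntegral_const, Real.volume_Ioo]
        ring_nf

/-! ### Measurability, symmetry and size of the kernel; conclusion. -/

theorem measurable_potKernel {χ V : ℝ → ℝ} (hχ : Continuous χ) (hV : ContDiff ℝ 3 V) (k κ : ℕ)
    {B : ℝ} (hB : 0 < B) :
    Measurable (Function.uncurry fun z w : ℝ × ℝ => potKernel χ V k κ B z w) := by
  have c1 : Continuous (deriv V) := hV.continuous_deriv (by norm_num)
  have c2 : Continuous (iteratedDeriv 2 V) := hV.continuous_iteratedDeriv 2 (by norm_num)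
  have c3 : Continuous (iteratedDeriv 3 V) := hV.continuous_iteratedDeriv 3 (by norm_num)
  have m1 : Measurable fun q : (ℝ × ℝ) × ℝ => remFun χ V q.1 q.2 := by
    simp only [remFun_eq, taylorRem]
    refine Measurable.mul (by fun_prop : Continuous _).measurable ?_
    exact (by fun_prop : Measurable fun q : (ℝ × ℝ) × ℝ => (-1 : ℂ) /
      ((q.2 : ℂ) - ((q.1.1 : ℂ) + Complex.I * (q.1.2 : ℂ))) ^ 2)
  have m2 : Measurable fun q : (ℝ × ℝ) × ℝ => fourierT (remFun χ V q.1) q.2 := by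
    have hu : StronglyMeasurable (Function.uncurry fun (q : (ℝ × ℝ) × ℝ) (x : ℝ) =>
        remFun χ V q.1 x * Complex.exp (-(Complex.I * (x : ℂ) * (q.2 : ℂ)))) := by
      refine Measurable.stronglyMeasurable (Measurable.mul ?_ ?_)
      · exact m1.comp ((measurable_fst.comp measurable_fst).prodMk measurable_snd)
      · exact (by fun_prop : Continuous fun p : ((ℝ × ℝ) × ℝ) × ℝ =>
          Complex.exp (-(Complex.I * (p.2 : ℂ) * (p.1.2 : ℂ)))).measurable
    exact hu.integral_prod_right.measurable
  have m3 : Measurable fun q : (ℝ × ℝ) × ℝ => opK k B (remFun χ V q.1) q.2 := by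
    have hu : StronglyMeasurable (Function.uncurry fun (q : (ℝ × ℝ) × ℝ) (s : ℝ) =>
        (symbolK k B s * fourierT (remFun χ V q.1) s) *
          Complex.exp (Complex.I * (q.2 : ℂ) * (s : ℂ))) := by
      refine Measurable.stronglyMeasurable (Measurable.mul (Measurable.mul ?_ ?_) ?_)
      · exact (continuous_symbolK k hB).measurable.comp measurable_snd
      · exact m2.comp ((measurable_fst.comp measurable_fst).prodMk measurable_snd)
      · exact (by fun_prop : Continuous fun p : ((ℝ × ℝ) × ℝ) × ℝ =>
          Complex.exp (Complex.I * (p.1.2 : ℂ) * (p.2 : ℂ))).measurable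
    have hi := (hu.integral_prod_right (ν := volume)).measurable
    have hc := hi.const_mul (1 / (2 * (Real.pi : ℂ)))
    simpa only [opK, fourierTInv] using hc
  have m4 : Measurable fun p : (ℝ × ℝ) × (ℝ × ℝ) => opK k B (remFun χ V p.2) p.1.1 :=
    m3.comp (g := fun q : (ℝ × ℝ) × ℝ => opK k B (remFun χ V q.1) q.2)
      (f := fun p : (ℝ × ℝ) × (ℝ × ℝ) => (p.2, p.1.1)) (by fun_prop)
  have m5 : Measurable fun p : (ℝ × ℝ) × (ℝ × ℝ) => (-Complex.I * (p.2.2 : ℂ)) *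
      ((|p.2.2| : ℝ) : ℂ) ^ κ / (Nat.factorial (1 + κ) : ℂ) :=
    (by fun_prop : Continuous _).measurable
  refine Measurable.ite ?_ (m5.mul m4) measurable_const
  exact measurableSet_lt (by fun_prop : Measurable fun p : (ℝ × ℝ) × (ℝ × ℝ) => |p.1.2|)
    measurable_const

theorem potKernel_conj (χ V : ℝ → ℝ) (k κ : ℕ) {B : ℝ} (hB : 0 < B) (z w : ℝ × ℝ) :
    potKernel χ V k κ B z (w.1, -w.2) = conj (potKernel χ V k κ B z w) := by
  unfold potKernel
  split_ifs with h
  · rw [remFun_conj, opK_conj hB]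
    simp
  · simp

/-- The kernel depends on `b` only through `|b|`, so the output is even in `b` and must be shown
real. Reflecting `b_T` in the integral conjugates both the kernel and `h`. -/
theorem potOp_symm (χ V : ℝ → ℝ) (R : ℝ) (k κ : ℕ) {B : ℝ} (hB : 0 < B) {h : ℝ × ℝ → ℂ}
    (hh : ∀ z ∈ strip B, h (z.1, -z.2) = conj (h z)) (z : ℝ × ℝ) :
    potOp χ V R k κ B h (z.1, -z.2) = conj (potOp χ V R k κ B h z) := by
  have e1 : potOp χ V R k κ B h (z.1, -z.2) = potOp χ V R k κ B h z := by
    simp [potOp, potKernel]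
  rw [e1, potOp, ← integral_conj]
  have hpres : MeasurePreserving (Prod.map (id : ℝ → ℝ) (Neg.neg : ℝ → ℝ))
      (volume : Measure (ℝ × ℝ)) volume :=
    (MeasurePreserving.id volume).prod (Measure.measurePreserving_neg volume)
  have hemb : MeasurableEmbedding (Prod.map (id : ℝ → ℝ) (Neg.neg : ℝ → ℝ)) :=
    MeasurableEmbedding.id.prodMap (MeasurableEquiv.neg ℝ).measurableEmbedding
  have hpre : (Prod.map (id : ℝ → ℝ) (Neg.neg : ℝ → ℝ)) ⁻¹' box R B = box R B := by
    ext w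
    simp only [box, mem_preimage, mem_prod, Prod.map_fst, Prod.map_snd, id, mem_Ioo]
    constructor <;> rintro ⟨h1, h2, h3⟩ <;> exact ⟨h1, by linarith, by linarith⟩
  rw [← hpres.setIntegral_preimage_emb hemb _ (box R B), hpre]
  refine integral_congr_ae ?_
  filter_upwards [ae_restrict_box R B] with w hw
  have hws := mem_strip_of_mem_box hw.1 hw.2
  change potKernel χ V k κ B z (w.1, -w.2) * h (w.1, -w.2) = _
  rw [potKernel_conj χ V k κ hB, hh w hws, map_mul]

/-- The prefactor has size at most `|b_T|^(κ+1)`: `|b_T|^k` is spent on the bound for `𝒦`, and the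
rest is at most `B^(κ+1-k)`. -/
theorem norm_potKernel_le {χ V : ℝ → ℝ} {k κ : ℕ} {B : ℝ} (hk : k ≤ κ + 1) {z w : ℝ × ℝ}
    (hwB : |w.2| ≤ B) {L : ℝ}
    (h : |w.2| ^ k * ‖opK k B (remFun χ V w) z.1‖ ≤ L * schurKernel z.1 w) :
    ‖potKernel χ V k κ B z w‖ ≤ B ^ (κ + 1 - k) * L * schurKernel z.1 w := by
  have hB : 0 ≤ B := (abs_nonneg _).trans hwB
  have h0 : 0 ≤ L * schurKernel z.1 w := le_trans (by positivity) h
  unfold potKernel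
  split_ifs with hz
  · have hf : (1 : ℝ) ≤ (Nat.factorial (1 + κ) : ℝ) := by
      exact_mod_cast Nat.factorial_pos (1 + κ)
    have e : ‖(-Complex.I * (w.2 : ℂ)) * ((|w.2| : ℝ) : ℂ) ^ κ / (Nat.factorial (1 + κ) : ℂ)‖ ≤
        |w.2| ^ (κ + 1) := by
      rw [norm_div, norm_mul, norm_mul, norm_pow, norm_neg, Complex.norm_I, Complex.norm_real,
        Complex.norm_real, Real.norm_eq_abs, Real.norm_eq_abs, abs_abs, one_mul,
        Complex.norm_natCast]
      refine (div_le_self (by positivity) hf).trans (le_of_eq ?_)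
      ring
    calc _ ≤ |w.2| ^ (κ + 1) * ‖opK k B (remFun χ V w) z.1‖ := by
          rw [norm_mul]; gcongr
      _ = |w.2| ^ (κ + 1 - k) * (|w.2| ^ k * ‖opK k B (remFun χ V w) z.1‖) := by
          rw [← mul_assoc, ← pow_add, Nat.sub_add_cancel hk]
      _ ≤ B ^ (κ + 1 - k) * (L * schurKernel z.1 w) := by gcongr
      _ = _ := by ring
  · rw [norm_zero, mul_assoc]
    positivity

theorem ckNorm_lt_top {n : ℕ} {f : ℝ → ℝ} (hf : ContDiff ℝ n f) (r : ℝ) : ckNorm n r f < ∞ := by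
  have hb : ∀ j : ℕ, ∃ C : ℝ, j ≤ n → ∀ x ∈ Icc (-r) r, ‖iteratedDeriv j f x‖ ≤ C := by
    intro j
    by_cases hj : j ≤ n
    · obtain ⟨C, hC⟩ := (isCompact_Icc (a := -r) (b := r)).exists_bound_of_continuousOn
        (hf.continuous_iteratedDeriv j (by exact_mod_cast hj)).continuousOn
      exact ⟨C, fun _ => hC⟩
    · exact ⟨0, fun h => absurd h hj⟩
  choose c hc using hb
  refine lt_of_le_of_lt (b := ENNReal.ofReal (∑ j ∈ Finset.range (n + 1), |c j|)) ?_
    ENNReal.ofReal_lt_top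
  refine iSup₂_le fun j hj => iSup₂_le fun x hx => ?_
  rw [← ofReal_norm]
  refine ENNReal.ofReal_le_ofReal ((hc j hj x hx).trans ((le_abs_self _).trans ?_))
  exact Finset.single_le_sum (f := fun i => |c i|) (fun i _ => abs_nonneg _)
    (Finset.mem_range.2 (Nat.lt_succ_of_le hj))

theorem norm_iteratedDeriv_le_ckNorm {n : ℕ} {f : ℝ → ℝ} {r : ℝ} (h : ckNorm n r f < ∞) {j : ℕ}
    (hj : j ≤ n) {x : ℝ} (hx : x ∈ Icc (-r) r) : ‖iteratedDeriv j f x‖ ≤ (ckNorm n r f).toReal := by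
  rw [← ENNReal.ofReal_le_ofReal_iff ENNReal.toReal_nonneg, ENNReal.ofReal_toReal h.ne, ofReal_norm]
  exact le_trans (le_iSup₂ (f := fun x (_ : x ∈ Icc (-r) r) => ‖iteratedDeriv j f x‖ₑ) x hx)
    (le_iSup₂ (f := fun j (_ : j ∈ Iic n) => ⨆ x ∈ Icc (-r) r, ‖iteratedDeriv j f x‖ₑ) j hj)

theorem exists_potOp_bound {k κ : ℕ} (hk : k ≤ κ + 1) {R : ℝ} (hR : 1 ≤ R) {χ : ℝ → ℝ}
    (hχ : IsCutoff R χ) :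
    ∃ C : ℝ≥0, ∀ B : ℝ, 0 < B → B ≤ 1 / 2 → ∀ V : ℝ → ℝ, ContDiff ℝ (k + 8 : ℕ) V →
      KernelDefined χ V R k B ∧
      ∀ p : ℝ≥0∞, p = 1 ∨ p = ∞ →
        ActsOn χ V R k κ B p ∧
        stripOpNorm B p (potOp χ V R k κ B) ≤
          C * ENNReal.ofReal (B ^ (κ + 1 - k) * B⁻¹) * ckNorm (k + 7) (3 * R) (deriv V) := by
  obtain ⟨C, hC, hrem⟩ := exists_remFun_bound k (by linarith : 0 < R) hχ
  refine ⟨(C * (4 * Real.pi)).toNNReal, fun B hB hB2 V hV => ?_⟩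
  have hV3 : ContDiff ℝ 3 V := hV.of_le (by exact_mod_cast (by omega : 3 ≤ k + 8))
  have hVd : ContDiff ℝ (k + 7 : ℕ) (deriv V) := by
    have : ContDiff ℝ ((k + 7 : ℕ) + 1) V := by exact_mod_cast hV
    exact (contDiff_succ_iff_deriv.1 this).2.2
  have hfinN := ckNorm_lt_top hVd (3 * R)
  set N := (ckNorm (k + 7) (3 * R) (deriv V)).toReal with hN
  have hN0 : 0 ≤ N := ENNReal.toReal_nonneg
  have hNe : ENNReal.ofReal N = ckNorm (k + 7) (3 * R) (deriv V) :=
    ENNReal.ofReal_toReal hfinN.ne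
  have hw := fun w => hrem B (by linarith) V hV N
    (fun j hj x hx => norm_iteratedDeriv_le_ckNorm hfinN hj hx) w
  refine ⟨fun w hwb hw0 => ⟨(hw w hwb.1 hw0 (abs_lt.2 hwb.2).le).1,
    (hw w hwb.1 hw0 (abs_lt.2 hwb.2).le).2.1⟩, fun p hp => ?_⟩
  set L := B ^ (κ + 1 - k) * (C * N * B⁻¹ ^ 2) with hL
  have hL0 : 0 ≤ L := by positivity
  have hker : ∀ z, ∀ w ∈ box R B, w.2 ≠ 0 →
      ‖potKernel χ V k κ B z w‖ₑ ≤ ENNReal.ofReal L * ENNReal.ofReal (schurKernel z.1 w) := by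
    intro z w hwb hw0
    have hwB : |w.2| ≤ B := (abs_lt.2 hwb.2).le
    rw [← ofReal_norm, ← ENNReal.ofReal_mul hL0]
    exact ENNReal.ofReal_le_ofReal (norm_potKernel_le hk hwB ((hw w hwb.1 hw0 hwB).2.2 z.1))
  -- Row and column sums share this bound: `2π` from the horizontal integral and `2B` from the
  -- height of the strip. The factor `2B` reduces `B⁻²` to `B⁻¹`.
  set c : ℝ≥0∞ := ENNReal.ofReal L * (ENNReal.ofReal (2 * Real.pi) * ENNReal.ofReal (2 * B)) with hc
  have hce : c = ((C * (4 * Real.pi)).toNNReal : ℝ≥0∞) *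
      ENNReal.ofReal (B ^ (κ + 1 - k) * B⁻¹) * ckNorm (k + 7) (3 * R) (deriv V) := by
    rw [← hNe, ← ENNReal.ofReal, ← ENNReal.ofReal_mul (by positivity),
      ← ENNReal.ofReal_mul (by positivity), hc, ← ENNReal.ofReal_mul (by positivity),
      ← ENNReal.ofReal_mul hL0, hL]
    congr 1
    field_simp
    ring
  have hrow : ∀ z ∈ strip B, ∫⁻ w in box R B, ‖potKernel χ V k κ B z w‖ₑ ≤ c := by
    intro z _
    calc _ ≤ ∫⁻ w in box R B, ENNReal.ofReal L * ENNReal.ofReal (schurKernel z.1 w) := by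
          refine lintegral_mono_ae ?_
          filter_upwards [ae_restrict_box R B] with w hwb using hker z w hwb.1 hwb.2
      _ = ENNReal.ofReal L * ∫⁻ w in box R B, ENNReal.ofReal (schurKernel z.1 w) :=
          lintegral_const_mul' _ _ ENNReal.ofReal_ne_top
      _ ≤ _ := by
          rw [hc]
          gcongr
          refine lintegral_slab_le (fun w hwb => ⟨mem_univ _, hwb.2⟩) ?_
            (fun b hb => (lintegral_schurKernel_fst z.1 hb).le)
          exact (measurable_schurKernel.comp (measurable_const.prodMk measurable_id)).ennreal_ofReal
  have hcol : ∀ w ∈ box R B, w.2 ≠ 0 → ∫⁻ z in strip B, ‖potKernel χ V k κ B z w‖ₑ ≤ c := by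
    intro w hwb hw0
    calc _ ≤ ∫⁻ z in strip B, ENNReal.ofReal L * ENNReal.ofReal (schurKernel z.1 w) :=
          lintegral_mono fun z => hker z w hwb hw0
      _ = ENNReal.ofReal L * ∫⁻ z in strip B, ENNReal.ofReal (schurKernel z.1 w) :=
          lintegral_const_mul' _ _ ENNReal.ofReal_ne_top
      _ ≤ _ := by
          rw [hc]
          gcongr
          refine lintegral_slab_le (G := fun z => ENNReal.ofReal (schurKernel z.1 w))
            (fun z hz => ⟨mem_univ _, abs_lt.1 hz.2⟩) ?_
            (fun b hb => (lintegral_schurKernel_snd hw0).le)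
          exact (measurable_schurKernel.comp
            (measurable_fst.prodMk measurable_const)).ennreal_ofReal
  have hcf : c < ∞ := by rw [hc]; finiteness
  have hschur := fun (h : ℝ × ℝ → ℂ) (hh : MemStrip B p h) =>
    schur_test (measurable_potKernel hχ.smooth.continuous hV3 k κ hB) hcf hrow hcol hp
      hh.aemeasurable hh.norm_lt_top
  refine ⟨fun h hh => ⟨(hschur h hh).1, (hschur h hh).2.1, (hschur h hh).2.2.1.aemeasurable,
    fun z _ => potOp_symm χ V R k κ hB hh.symm z,
    (hschur h hh).2.2.2.trans_lt (ENNReal.mul_lt_top hcf hh.norm_lt_top)⟩, ?_⟩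
  rw [← hce]
  exact sInf_le fun h hh => (hschur h hh).2.2.2

end StieltjesPot

end

theorem mainTheorem4 (κ : ℕ) (R : ℝ) (hR : 1 ≤ R) (χ : ℝ → ℝ) (hχ : IsCutoff R χ) :
    ∃ C : ℝ≥0, ∀ bmax : ℝ, 0 < bmax → bmax ≤ 1 / 2 → ∀ V : ℝ → ℝ,
      (ContDiff ℝ ((κ + 9 : ℕ) : WithTop ℕ∞) V →
        KernelDefined χ V R (κ + 1) bmax ∧
        ∀ p : ℝ≥0∞, p = 1 ∨ p = ∞ →
          ActsOn χ V R (κ + 1) κ bmax p ∧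
          stripOpNorm bmax p (potOp χ V R (κ + 1) κ bmax) ≤
            C * ENNReal.ofReal bmax⁻¹ * ckNorm (8 + κ) (3 * R) (deriv V)) ∧
      (ContDiff ℝ ((κ + 8 : ℕ) : WithTop ℕ∞) V →
        KernelDefined χ V R κ bmax ∧
        ∀ p : ℝ≥0∞, p = 1 ∨ p = ∞ →
          ActsOn χ V R κ κ bmax p ∧
          stripOpNorm bmax p (potOp χ V R κ κ bmax) ≤
            C * ckNorm (7 + κ) (3 * R) (deriv V)) := by
  obtain ⟨C₁, h₁⟩ := exists_potOp_bound (le_refl (κ + 1)) hR hχ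
  obtain ⟨C₂, h₂⟩ := exists_potOp_bound (Nat.le_succ κ) hR hχ
  refine ⟨max C₁ C₂, fun B hB hB2 V => ⟨fun hV => ?_, fun hV => ?_⟩⟩
  · have hV' : ContDiff ℝ (κ + 1 + 8 : ℕ) V := by
      rwa [show κ + 1 + 8 = κ + 9 by omega]
    obtain ⟨hd, ha⟩ := h₁ B hB hB2 V hV'
    refine ⟨hd, fun p hp => ⟨(ha p hp).1, (ha p hp).2.trans ?_⟩⟩
    rw [Nat.sub_self, pow_zero, one_mul, show κ + 1 + 7 = 8 + κ by omega]
    gcongr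
    exact le_max_left _ _
  · obtain ⟨hd, ha⟩ := h₂ B hB hB2 V hV
    refine ⟨hd, fun p hp => ⟨(ha p hp).1, (ha p hp).2.trans ?_⟩⟩
    rw [show κ + 1 - κ = 1 by omega, pow_one, mul_inv_cancel₀ hB.ne', ENNReal.ofReal_one, mul_one,
      show κ + 7 = 7 + κ by omega]
    gcongr
    exact le_max_right _ _
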